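/- **Models.** Fix a set of basic operations consisting of measurement of a qubit in the computational basis and a set of one- and two-qubit unitary gates that is universal: every unitary on a pair of qubits is, up to a global phase, a finite product of basic gates applied to this pair. A *circuit* is a machine $M$ running in polynomial time that has finitely many basic gates wired in and can also address basic gates by fixed hardware names (bit strings). On a classical input $x\in\{0,1\}^n$, a uniformly random seed $r$ of length polynomial in $n$, and the measurement outcomes of all previous timesteps, $M$ either stops or outputs a set of basic operations acting on pairwise disjoint sets of qubits, which are performed in the next timestep. In the model CCAC the qubits are indexed by $\mathbb N$ and two-qubit gates may act on any two qubits; in $k$-D CCNTC the qubits are indexed by $\mathbb Z^k$ and two-qubit gates may act only on nearest neighbours. For inputs of length $n$, the *depth* and the *size* are the maximal number of timesteps and the maximal total number of operations, over all $x$, $r$ and all sequences of outcomes that occur with positive probability for some quantum input. The *width* is the maximum over $x\in\{0,1\}^n$ of $|A_x|$, where $A_x$ is the set of all qubits acted on for some seed and some such outcomes (CCAC), or the smallest axis-parallel hypercube of $\mathbb Z^k$ containing this set ($k$-D CCNTC). The $n$ data qubits, which hold the quantum input and, at the end, the output, are $0,\dots,n-1$ in CCAC and $(i,0,\dots,0)$,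 $0\le i<n$, in $k$-D CCNTC; all other qubits start in the state $|0\rangle$. A circuit *implements* a family $\mathcal E=(\mathcal E_n)_{n\in\mathbb N}$ of CPTP maps $\mathcal E_n$ on $n$ qubits with error at most $\epsilon=(\epsilon_n)_n$, $\epsilon_n\ge 0$, if for all $n$ and all $x\in\{0,1\}^n$ the quantum operation it performs on the data qubits (averaged over seed and outcomes, all other qubits traced out) is within diamond-norm distance $\epsilon_n$ of $\mathcal E_n$. A function $d:\mathbb N\to\mathbb N$ is *achieved* in a model if some circuit of this model with depth exactly $d(n)$, and with size and width bounded by a polynomial in $n$, implements $\mathcal E$ with error at most $\epsilon$. It is a *minimum depth* for $(\mathcal E,\epsilon)$ in this model if it is achieved and $d=O(d')$ as $n\to\infty$ for every achieved $d'$. (In particular, an achieved $d$ such that, for every achieved $d'$, $d(n)\le d'(n)$ for all large $n$ is a minimum depth.) **Corollary.** Let $k\ge 2$, let $\mathcal E=(\mathcal E_n)_n$ be a family of CPTP maps, $\mathcal E_n$ on $n$ qubits, and let $\epsilon=(\epsilon_n)_n$ with $\epsilon_n\ge 0$. Suppose that $d_1$ is a minimum depth for $(\mathcal E,\epsilon)$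 in CCAC. Then a minimum depth for $(\mathcal E,\epsilon)$ in $k$-D CCNTC exists, and every minimum depth $d_2$ for $(\mathcal E,\epsilon)$ in $k$-D CCNTC satisfies $d_1=\Theta(d_2)$ as $n\to\infty$. -/

import Mathlib

open scoped Kronecker ComplexOrder

namespace QArch

/-! ## Polynomial-time machines

Programs over binary trees with an explicit running time.  Every elementary step is charged the
size of the tree it reads or builds, so running times agree with those of Turing machines up to a
polynomial. -/

/-- Binary trees, the data on which programs work. -/
inductive Data : Type
  | nil : Data
  | cons : Data → Data → Data
  deriving DecidableEq

namespace Data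

/-- Number of nodes of a tree. -/
def size : Data → ℕ
  | nil => 1
  | cons a b => 1 + size a + size b

def hd : Data → Data
  | nil => nil
  | cons a _ => a

def tl : Data → Data
  | nil => nil
  | cons _ b => b

/-- Truth values: `nil` is false, `cons nil nil` is true. -/
def ofBool : Bool → Data
  | false => nil
  | true => cons nil nil

end Data

/-- Programs: straight-line tree operations, composition, branching and unbounded loops. -/
inductive Prog : Type
  | id : Prog
  | nil : Prog
  | hd : Prog
  | tl : Prog
  | eq : Prog
  | pair : Prog → Prog → Prog
  | comp : Prog → Prog → Prog
  | ite : Prog → Prog → Prog → Prog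
  | loop : Prog → Prog → Prog

/-- `Runs p x t y`: the program `p`, started on `x`, halts after time `t` with result `y`.
`comp p q` runs `p` first; `ite c p q` branches on whether the result of `c` is `nil` (then `q`);
`loop c p` repeats `p` as long as the result of `c` is not `nil`. -/
inductive Runs : Prog → Data → ℕ → Data → Prop
  | id (x : Data) : Runs Prog.id x x.size x
  | nil (x : Data) : Runs Prog.nil x 1 Data.nil
  | hd (x : Data) : Runs Prog.hd x x.size x.hd
  | tl (x : Data) : Runs Prog.tl x x.size x.tl
  | eq (x : Data) : Runs Prog.eq x x.size (Data.ofBool (decide (x.hd = x.tl)))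
  | pair {p q : Prog} {x y z : Data} {s t : ℕ} (hp : Runs p x s y) (hq : Runs q x t z) :
      Runs (Prog.pair p q) x (s + t + (Data.cons y z).size) (Data.cons y z)
  | comp {p q : Prog} {x y z : Data} {s t : ℕ} (hp : Runs p x s y) (hq : Runs q y t z) :
      Runs (Prog.comp p q) x (s + t + 1) z
  | ite_true {c p q : Prog} {x b y : Data} {s t : ℕ} (hc : Runs c x s b) (hb : b ≠ Data.nil)
      (hp : Runs p x t y) : Runs (Prog.ite c p q) x (s + t + 1) y
  | ite_false {c p q : Prog} {x y : Data} {s t : ℕ} (hc : Runs c x s Data.nil)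
      (hq : Runs q x t y) : Runs (Prog.ite c p q) x (s + t + 1) y
  | loop_stop {c p : Prog} {x : Data} {s : ℕ} (hc : Runs c x s Data.nil) :
      Runs (Prog.loop c p) x (s + 1) x
  | loop_step {c p : Prog} {x b y z : Data} {s t u : ℕ} (hc : Runs c x s b) (hb : b ≠ Data.nil)
      (hp : Runs p x t y) (hl : Runs (Prog.loop c p) y u z) :
      Runs (Prog.loop c p) x (s + t + u + 1) z

/-- Types whose elements are written down as trees, without loss of information. -/
class Coded (α : Type) where
  enc : α → Data
  enc_injective : Function.Injective enc

instance instCodedBool : Coded Bool where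
  enc := Data.ofBool
  enc_injective := by
    intro a b h
    cases a <;> cases b <;> simp_all [Data.ofBool]

/-- Lists are coded as right combs. -/
def encList {α : Type} [Coded α] : List α → Data
  | [] => Data.nil
  | a :: l => Data.cons (Coded.enc a) (encList l)

theorem encList_injective {α : Type} [Coded α] :
    Function.Injective (encList : List α → Data) := by
  intro l
  induction l with
  | nil => intro m h; cases m <;> simp_all [encList]
  | cons a l ih =>
    intro m h
    cases m with
    | nil => simp [encList] at h
    | cons b m =>
      simp only [encList, Data.cons.injEq] at h
      rw [Coded.enc_injective h.1, ih h.2]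

instance instCodedList {α : Type} [Coded α] : Coded (List α) := ⟨encList, encList_injective⟩

instance instCodedProd {α β : Type} [Coded α] [Coded β] : Coded (α × β) where
  enc x := Data.cons (Coded.enc x.1) (Coded.enc x.2)
  enc_injective := by
    rintro ⟨a, b⟩ ⟨c, d⟩ h
    simp only [Data.cons.injEq] at h
    rw [Coded.enc_injective h.1, Coded.enc_injective h.2]

instance instCodedOption {α : Type} [Coded α] : Coded (Option α) where
  enc x := match x with
    | none => Data.nil
    | some a => Data.cons Data.nil (Coded.enc a)
  enc_injective := by
    rintro (_ | a) (_ | b) h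
    · rfl
    · simp at h
    · simp at h
    · simp only [Data.cons.injEq, true_and] at h
      rw [Coded.enc_injective h]

/-- Natural numbers are written in binary, least significant bit first. -/
instance instCodedNat : Coded ℕ where
  enc n := Coded.enc (Nat.bits n)
  enc_injective := by
    intro m n h
    have h1 : Nat.bits m = Nat.bits n := Coded.enc_injective h
    have h2 : ∀ k : ℕ, Nat.ofDigits 2 ((Nat.bits k).map fun b => cond b 1 0) = k := by
      intro k
      rw [← Nat.digits_two_eq_bits, Nat.ofDigits_digits]
    rw [← h2 m, ← h2 n, h1]

/-- Integers are written as a sign and a binary number. -/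
instance instCodedInt : Coded ℤ where
  enc z := match z with
    | Int.ofNat n => Coded.enc (false, n)
    | Int.negSucc n => Coded.enc (true, n)
  enc_injective := by
    rintro (m | m) (n | n) h
    · have := Coded.enc_injective h; simp_all
    · have := Coded.enc_injective h; simp_all
    · have := Coded.enc_injective h; simp_all
    · have := Coded.enc_injective h; simp_all

/-- Grid points are written as the list of their coordinates. -/
instance instCodedGrid (k : ℕ) : Coded (Fin k → ℤ) where
  enc p := Coded.enc (List.ofFn p)
  enc_injective := by
    intro p q h
    exact List.ofFn_injective (Coded.enc_injective h)

/-- `f` is computed by some program in time polynomial in the size of the coded argument. -/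
def PolyTime {α β : Type} [Coded α] [Coded β] (f : α → β) : Prop :=
  ∃ (p : Prog) (P : Polynomial ℕ), ∀ a : α,
    ∃ t ≤ P.eval (Data.size (Coded.enc a)), Runs p (Coded.enc a) t (Coded.enc (f a))

/-! ## Basic operations -/

/-- The unitary basic operations of the hardware.  The sets may be uncountable; a machine can only
write down a gate by a bit string, so the hardware also comes with names for (some of) its gates.
Computational-basis measurement of a qubit is always a basic operation in addition. -/
structure GateSet where
  one : Set (Matrix.unitaryGroup Bool ℂ)
  two : Set (Matrix.unitaryGroup (Bool × Bool) ℂ)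
  named1 : List Bool → Option one
  named2 : List Bool → Option two

/-- The basic gates as operations on an ordered pair of qubits: a one-qubit gate on either qubit, or
a two-qubit gate in either orientation. -/
def GateSet.onPair (G : GateSet) : Set (Matrix (Bool × Bool) (Bool × Bool) ℂ) :=
  {V | (∃ g ∈ G.one, V = (g : Matrix Bool Bool ℂ) ⊗ₖ (1 : Matrix Bool Bool ℂ)) ∨
       (∃ g ∈ G.one, V = (1 : Matrix Bool Bool ℂ) ⊗ₖ (g : Matrix Bool Bool ℂ)) ∨
       (∃ g ∈ G.two, V = (g : Matrix (Bool × Bool) (Bool × Bool) ℂ)) ∨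
       (∃ g ∈ G.two, V = (g : Matrix (Bool × Bool) (Bool × Bool) ℂ).submatrix Prod.swap Prod.swap)}

/-- Every unitary on a pair of qubits (in particular `U ⊗ 1` for a one-qubit unitary `U`) is, up to a
global phase, a finite product of basic gates on this pair. -/
def GateSet.Universal (G : GateSet) : Prop :=
  ∀ U : Matrix.unitaryGroup (Bool × Bool) ℂ,
    ∃ l : List (Matrix (Bool × Bool) (Bool × Bool) ℂ), (∀ V ∈ l, V ∈ G.onPair) ∧
      ∃ c : ℂ, ‖c‖ = 1 ∧ (U : Matrix (Bool × Bool) (Bool × Bool) ℂ) = c • l.prod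

/-- How a machine refers to a gate: one of the finitely many gates wired into its description, or
a gate addressed by its hardware name. -/
inductive GateRef : Type
  | wired : ℕ → GateRef
  | named : List Bool → GateRef

instance instCodedGateRef : Coded GateRef where
  enc g := match g with
    | GateRef.wired i => Coded.enc (false, i)
    | GateRef.named s => Coded.enc (true, s)
  enc_injective := by
    rintro (i | s) (j | t) h
    · have := Coded.enc_injective h; simp_all
    · simp [Coded.enc, Data.ofBool] at h
    · simp [Coded.enc, Data.ofBool] at h
    · have := Coded.enc_injective h; simp_all

/-- A basic operation together with the qubits (elements of `Q`) on which it acts. -/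
inductive Op (Q : Type) : Type
  | meas : Q → Op Q
  | gate1 : GateRef → Q → Op Q
  | gate2 : GateRef → Q → Q → Op Q

namespace Op

/-- The qubits acted on. -/
def qubits {Q : Type} : Op Q → List Q
  | meas q => [q]
  | gate1 _ q => [q]
  | gate2 _ p q => [p, q]

end Op

instance instCodedOp {Q : Type} [Coded Q] : Coded (Op Q) where
  enc o := match o with
    | Op.meas q => Data.cons Data.nil (Coded.enc q)
    | Op.gate1 g q => Data.cons (Data.cons Data.nil Data.nil) (Coded.enc (g, q))
    | Op.gate2 g p q =>
        Data.cons (Data.cons (Data.cons Data.nil Data.nil) Data.nil) (Coded.enc (g, p, q))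
  enc_injective := by
    rintro (q | ⟨g, q⟩ | ⟨g, p, q⟩) (q' | ⟨g', q'⟩ | ⟨g', p', q'⟩) h
    all_goals simp only [Data.cons.injEq, true_and, reduceCtorEq, false_and] at h
    all_goals have := Coded.enc_injective h
    all_goals simp_all

/-! ## Architectures -/

/-- The qubits are indexed by `Q`.  Two-qubit operations are allowed on pairs related by `adj`; `data n`
lists the qubits holding an `n`-qubit input and, at the end, the output; `width S` is the width
charged for acting on exactly the qubits in `S`. -/
structure Architecture (Q : Type) where
  adj : Q → Q → Prop
  data : (n : ℕ) → Fin n → Q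
  width : Set Q → ℕ∞

/-- Qubits indexed by `ℕ`, arbitrary interactions; the width is the number of qubits. -/
noncomputable def CCAC : Architecture ℕ where
  adj p q := p ≠ q
  data _ i := i
  width S := S.encard

/-- Qubits on the grid `ℤ^k`, interactions between nearest neighbours, data qubits on a
line; the width is the number of points in the smallest axis-parallel hypercube containing the set. -/
noncomputable def CCNTC (k : ℕ) : Architecture (Fin k → ℤ) where
  adj p q := ∑ i, |p i - q i| = 1
  data _ i := fun j => if j.val = 0 then (i.val : ℤ) else 0
  width S := ⨅ (s : ℕ) (_ : ∃ c : Fin k → ℤ, ∀ z ∈ S, ∀ i, c i ≤ z i ∧ z i < c i + s),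
    ((s ^ k : ℕ) : ℕ∞)

/-! ## Circuits with a classical controller -/

/-- The description of a circuit: the wired-in gates, and the controller `next`, which is given
the classical input, the random seed, and the list of the outcome lists of the previous physical
timesteps (the most recent timestep first), and returns the operations for the next timestep, or
`none` if no more timesteps are to be performed.  For inputs of length `n` the seed is uniformly
distributed over `seedLen n` bits. -/
structure Circuit (Q : Type) [Coded Q] (G : GateSet) where
  seedLen : Polynomial ℕ
  wired1 : List G.one
  wired2 : List G.two
  next : List Bool → List Bool → List (List Bool) → Option (List (Op Q))
  polyTime : PolyTime fun i : List Bool × List Bool × List (List Bool) => next i.1 i.2.1 i.2.2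

section Dynamics

variable {Q : Type} [DecidableEq Q]

/-- Action of a one-qubit matrix on amplitude functions. -/
def apply1 (U : Matrix Bool Bool ℂ) (q : Q) (ψ : (Q → Bool) → ℂ) : (Q → Bool) → ℂ :=
  fun c => ∑ b, U (c q) b * ψ (Function.update c q b)

/-- Action of a two-qubit matrix on amplitude functions. -/
def apply2 (U : Matrix (Bool × Bool) (Bool × Bool) ℂ) (p q : Q) (ψ : (Q → Bool) → ℂ) :
    (Q → Bool) → ℂ :=
  fun c => ∑ b : Bool × Bool, U (c p, c q) b * ψ (Function.update (Function.update c p b.1) q b.2)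

/-- Projection onto outcome `b` of the computational-basis measurement of `q`. -/
def project (q : Q) (b : Bool) (ψ : (Q → Bool) → ℂ) : (Q → Bool) → ℂ :=
  fun c => if c q = b then ψ c else 0

end Dynamics

namespace Circuit

variable {Q : Type} [DecidableEq Q] [Coded Q] {G : GateSet}

/-- The one-qubit gate meant by a reference, if there is one. -/
def gate1 (C : Circuit Q G) : GateRef → Option G.one
  | GateRef.wired i => C.wired1[i]?
  | GateRef.named s => G.named1 s

/-- The two-qubit gate meant by a reference, if there is one. -/
def gate2 (C : Circuit Q G) : GateRef → Option G.two
  | GateRef.wired i => C.wired2[i]?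
  | GateRef.named s => G.named2 s

/-- Unnormalised state after applying the operations with the given outcomes, one for each
measurement in order.  A wrong number of outcomes has amplitude zero. -/
def applyOps (C : Circuit Q G) : List (Op Q) → List Bool → ((Q → Bool) → ℂ) → ((Q → Bool) → ℂ)
  | [], [], ψ => ψ
  | [], _ :: _, _ => 0
  | Op.meas _ :: _, [], _ => 0
  | Op.meas q :: l, b :: o, ψ => applyOps C l o (project q b ψ)
  | Op.gate1 g q :: l, o, ψ => applyOps C l o (match C.gate1 g with
      | some U => apply1 (U.val : Matrix Bool Bool ℂ) q ψ
      | none => ψ)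
  | Op.gate2 g p q :: l, o, ψ => applyOps C l o (match C.gate2 g with
      | some U => apply2 (U.val : Matrix (Bool × Bool) (Bool × Bool) ℂ) p q ψ
      | none => ψ)

/-- The basis state with data qubits `a` and all other qubits `0`. -/
noncomputable def initial (A : Architecture Q) (n : ℕ) (a : Fin n → Bool) : (Q → Bool) → ℂ :=
  open Classical in
  fun c => if c = Function.extend (A.data n) a (fun _ => false) then 1 else 0

/-- Unnormalised state of the qubits, started with the basis state `a` on the data qubits, after the
timesteps with outcome history `h` (classical input `x`, seed `r`).  Histories that continue after
the controller has stopped have amplitude zero. -/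
noncomputable def amp (C : Circuit Q G) (A : Architecture Q) (x r : List Bool) {n : ℕ}
    (a : Fin n → Bool) : List (List Bool) → ((Q → Bool) → ℂ)
  | [] => initial A n a
  | o :: h => match C.next x r h with
      | none => 0
      | some l => C.applyOps l o (C.amp A x r a h)

/-- The outcome history `h` occurs with positive probability for some quantum input. -/
def Possible (C : Circuit Q G) (A : Architecture Q) (n : ℕ) (x r : List Bool)
    (h : List (List Bool)) : Prop :=
  ∃ a : Fin n → Bool, C.amp A x r a h ≠ 0

/-- The random seeds for inputs of length `n`. -/
abbrev Seed (C : Circuit Q G) (n : ℕ) : Type := Fin (C.seedLen.eval n) → Bool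

/-- The operation is a basic operation that the architecture allows. -/
def Allowed (C : Circuit Q G) (A : Architecture Q) : Op Q → Prop
  | Op.meas _ => True
  | Op.gate1 g _ => (C.gate1 g).isSome
  | Op.gate2 g p q => (C.gate2 g).isSome ∧ A.adj p q

/-- In every timestep that can occur, the operations are allowed and act on disjoint qubits. -/
def Legal (C : Circuit Q G) (A : Architecture Q) : Prop :=
  ∀ (n : ℕ) (x : Fin n → Bool) (r : C.Seed n) (h : List (List Bool)),
    C.Possible A n (List.ofFn x) (List.ofFn r) h →
    ∀ l : List (Op Q), C.next (List.ofFn x) (List.ofFn r) h = some l →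
      (l.flatMap Op.qubits).Nodup ∧ ∀ o ∈ l, C.Allowed A o

/-- Worst-case number of physical timesteps on inputs of length `n`. -/
noncomputable def depth (C : Circuit Q G) (A : Architecture Q) (n : ℕ) : ℕ∞ :=
  ⨆ (x : Fin n → Bool) (r : C.Seed n) (h : List (List Bool))
    (_ : C.Possible A n (List.ofFn x) (List.ofFn r) h), (h.length : ℕ∞)

/-- Number of operations applied along a history. -/
def opCount (C : Circuit Q G) (x r : List Bool) : List (List Bool) → ℕ
  | [] => 0
  | _ :: h => C.opCount x r h + ((C.next x r h).getD []).length

/-- Worst-case total number of operations on inputs of length `n`. -/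
noncomputable def size (C : Circuit Q G) (A : Architecture Q) (n : ℕ) : ℕ∞ :=
  ⨆ (x : Fin n → Bool) (r : C.Seed n) (h : List (List Bool))
    (_ : C.Possible A n (List.ofFn x) (List.ofFn r) h),
    (C.opCount (List.ofFn x) (List.ofFn r) h : ℕ∞)

/-- The qubits acted on for the classical input `x`, over all seeds and possible outcomes. -/
def acted (C : Circuit Q G) (A : Architecture Q) (n : ℕ) (x : Fin n → Bool) : Set Q :=
  {q | ∃ (r : C.Seed n) (h : List (List Bool)) (l : List (Op Q)),
    C.Possible A n (List.ofFn x) (List.ofFn r) h ∧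
    C.next (List.ofFn x) (List.ofFn r) h = some l ∧ ∃ o ∈ l, q ∈ o.qubits}

/-- Worst-case width on inputs of length `n`. -/
noncomputable def width (C : Circuit Q G) (A : Architecture Q) (n : ℕ) : ℕ∞ :=
  ⨆ x : Fin n → Bool, A.width (C.acted A n x)

/-- The map on `n`-qubit states realised on the data qubits: average over the seed, sum over the complete
outcome histories, partial trace over all qubits other than the data qubits. -/
noncomputable def channel (C : Circuit Q G) (A : Architecture Q) (n : ℕ) (x : Fin n → Bool)
    (ρ : Matrix (Fin n → Bool) (Fin n → Bool) ℂ) : Matrix (Fin n → Bool) (Fin n → Bool) ℂ :=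
  Matrix.of fun b b' =>
    ((2 : ℂ) ^ (C.seedLen.eval n))⁻¹ * ∑ r : C.Seed n,
      ∑ᶠ (h : List (List Bool)) (_ : C.next (List.ofFn x) (List.ofFn r) h = none),
        ∑ᶠ (e : Q → Bool) (_ : ∀ i, e (A.data n i) = false),
          ∑ a : Fin n → Bool, ∑ a' : Fin n → Bool,
            C.amp A (List.ofFn x) (List.ofFn r) a h (Function.extend (A.data n) b e) * ρ a a' *
              star (C.amp A (List.ofFn x) (List.ofFn r) a' h (Function.extend (A.data n) b' e))

end Circuit

/-! ## Quantum operations -/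

/-- `id ⊗ Φ`, with a reference system of dimension `m`. -/
def ampliate {ι : Type} (m : ℕ) (Φ : Matrix ι ι ℂ → Matrix ι ι ℂ)
    (X : Matrix (Fin m × ι) (Fin m × ι) ℂ) : Matrix (Fin m × ι) (Fin m × ι) ℂ :=
  Matrix.of fun p q => Φ (Matrix.of fun a b => X (p.1, a) (q.1, b)) p.2 q.2

/-- Completely positive and trace preserving. -/
def IsCPTP {ι : Type} [Fintype ι] [DecidableEq ι] (Φ : Matrix ι ι ℂ →ₗ[ℂ] Matrix ι ι ℂ) : Prop :=
  (∀ (m : ℕ) (X : Matrix (Fin m × ι) (Fin m × ι) ℂ), X.PosSemidef → (ampliate m Φ X).PosSemidef) ∧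
    ∀ X : Matrix ι ι ℂ, (Φ X).trace = X.trace

/-- Sum of the singular values. -/
noncomputable def traceNorm {ι : Type} [Fintype ι] [DecidableEq ι] (X : Matrix ι ι ℂ) : ℝ :=
  ∑ i, √((Matrix.isHermitian_conjTranspose_mul_self X).eigenvalues i)

/-- `Φ` and `Ψ` differ by at most `ε` in diamond norm. -/
def DiamondClose {ι : Type} [Fintype ι] [DecidableEq ι] (Φ Ψ : Matrix ι ι ℂ → Matrix ι ι ℂ)
    (ε : ℝ) : Prop :=
  ∀ (m : ℕ) (ρ : Matrix (Fin m × ι) (Fin m × ι) ℂ), ρ.PosSemidef → ρ.trace = 1 →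
    traceNorm (ampliate m Φ ρ - ampliate m Ψ ρ) ≤ ε

/-! ## Minimum depth -/

section MinDepth

variable {Q : Type} [DecidableEq Q] [Coded Q]

/-- The family `E` is implemented with error at most `ε` by a circuit of depth `d` with polynomial size and
width on the architecture `A`, whatever the classical input is. -/
def Achieves (A : Architecture Q) (G : GateSet)
    (E : (n : ℕ) → Matrix (Fin n → Bool) (Fin n → Bool) ℂ →ₗ[ℂ] Matrix (Fin n → Bool) (Fin n → Bool) ℂ)
    (ε : ℕ → ℝ) (d : ℕ → ℕ) : Prop :=
  ∃ C : Circuit Q G, C.Legal A ∧ (∀ n, C.depth A n = d n) ∧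
    (∃ P : Polynomial ℕ, ∀ n, C.size A n ≤ (P.eval n : ℕ) ∧ C.width A n ≤ (P.eval n : ℕ)) ∧
    ∀ (n : ℕ) (x : Fin n → Bool), DiamondClose (E n) (C.channel A n x) (ε n)

/-- `d` is the minimum depth for polynomial size and width: it is achieved, and no other achieved
depth is of smaller order.  A `d` that is achieved and satisfies `d n ≤ d' n` for all large `n` and every
achieved depth `d'` is a minimum depth in this sense. -/
def IsMinDepth (A : Architecture Q) (G : GateSet)
    (E : (n : ℕ) → Matrix (Fin n → Bool) (Fin n → Bool) ℂ →ₗ[ℂ] Matrix (Fin n → Bool) (Fin n → Bool) ℂ)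
    (ε : ℕ → ℝ) (d : ℕ → ℕ) : Prop :=
  Achieves A G E ε d ∧ ∀ d' : ℕ → ℕ, Achieves A G E ε d' →
    Asymptotics.IsBigO Filter.atTop (fun n => (d n : ℝ)) (fun n => (d' n : ℝ))

end MinDepth

end QArch

namespace QArch

/-! ## A calculus of polynomial-time functions -/

/-! Each model simulates the other with exactly the same channel, polynomially larger size and
width, and depth larger by at most a constant factor. From the grid to CCAC (`achieves_CCAC`)
nothing is lost in depth: all pairs of distinct qubits may interact, so only the names of the qubits
change. From CCAC to the grid (`achieves_CCNTC`) every timestep becomes a round of `K` timesteps,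
where `K` does not depend on `n`. The corollary is then formal: simulating an optimal CCAC circuit
gives a grid depth `d ≤ K * d₁`, and every grid depth `d'` dominates an achieved CCAC depth, so `d₁
= O(d')`. Hence `d = O(d₁) = O(d')`, so `d` is a minimum depth on the grid, and any other minimum
depth there is squeezed between the same bounds.

The constant slowdown comes from teleportation. A qubit travels along a path of any length in
constant depth: Bell pairs are prepared on all hops at once, then all junctions are measured in the
Bell basis at once. What remains at the far end is a Pauli error whose exponents are parities of the
outcomes, which the classical controller computes between two timesteps (`hop_place`,
`pathOps_place`, `act_transportOps`, `transport_block`). The outcome strings have equal weights,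
independently of the transported state. Universality supplies the Bell, Pauli and exchange unitaries
exactly, up to a phase, as words of fixed length.

The geometry is as follows. Qubit `i` rests at `(i, 0)`. The two-qubit gate with number `r` in a
timestep, acting on `p < q`, owns rows `2r` and `2r + 1`. Both qubits climb in their own columns to
row `2r`; if `q - p` is even, the larger one steps up into row `2r + 1`; then the smaller one
travels right until the two are neighbours. Paths of one stage are disjoint because columns, and
then rows, are distinct (`vert_routes`, `side_swaps`, `hor_routes`). The timestep is performed, and
the motion is undone.

The columns have to be polynomially bounded, but a CCAC circuit may address qubits by exponentially
large numbers. Therefore qubits are first renumbered in the order of their first use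
(`exists_relabel`); changing the number of a qubit that still holds `0` does not matter.

The comparison of channels, depths and sizes is done once, in `simulation`: a history of the
simulating circuit splits into rounds, and over each history of the simulated circuit lie finitely
many histories of equal weight with total weight one. That the new controllers run in polynomial
time is shown in a calculus `PT` of functions between encoded types, closed under composition, case
distinction and size-bounded folds. -/

theorem Data.size_pos (x : Data) : 0 < x.size := by
  cases x <;> simp [Data.size]

theorem Data.size_hd_le (x : Data) : x.hd.size ≤ x.size := by
  cases x <;> simp [Data.size, Data.hd]; omega

theorem Data.size_tl_le (x : Data) : x.tl.size ≤ x.size := by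
  cases x <;> simp [Data.size, Data.tl]

theorem Data.size_ofBool_le (b : Bool) : (Data.ofBool b).size ≤ 3 := by
  cases b <;> simp [Data.size, Data.ofBool]

/-- Steps that build a tree are charged its size, so a short computation cannot have a large result;
this makes polynomial-time programs composable. A factor larger than one is needed because `eq`
turns `nil`, of size one, into a tree of size three in one unit of time. -/
theorem Runs.size_le {p : Prog} {x y : Data} {t : ℕ} (h : Runs p x t y) :
    y.size ≤ x.size + 3 * t := by
  induction h with
  | id x => omega
  | nil x => simp [Data.size]
  | hd x => have := x.size_hd_le; omega
  | tl x => have := x.size_tl_le; omega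
  | eq x =>
    have := Data.size_ofBool_le (decide (x.hd = x.tl)); have := x.size_pos; omega
  | pair hp hq ihp ihq => omega
  | comp hp hq ihp ihq => omega
  | ite_true hc hb hp ihc ihp => omega
  | ite_false hc hq ihc ihq => omega
  | loop_stop hc ihc => omega
  | loop_step hc hb hp hl ihc ihp ihl => omega

theorem eval_mono (P : Polynomial ℕ) {m n : ℕ} (h : m ≤ n) : P.eval m ≤ P.eval n := by
  induction P using Polynomial.induction_on' with
  | add p q hp hq => simpa using add_le_add hp hq
  | monomial k a => simpa using Nat.mul_le_mul_left a (Nat.pow_le_pow_left h k)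

/-! ### Polynomial time relative to chosen encodings. -/

/-- `f` is computed in polynomial time with respect to the encodings `ea` and `eb`. -/
def PT {α β : Type} (ea : α → Data) (eb : β → Data) (f : α → β) : Prop :=
  ∃ (p : Prog) (P : Polynomial ℕ), ∀ a : α,
    ∃ t ≤ P.eval (ea a).size, Runs p (ea a) t (eb (f a))

/-- A quantity bounded by a polynomial in the size of the encoded argument. -/
def PB {γ : Type} (eg : γ → Data) (s : γ → ℕ) : Prop :=
  ∃ Q : Polynomial ℕ, ∀ c, s c ≤ Q.eval (eg c).size

variable {α β γ δ : Type} {ea : α → Data} {eb : β → Data} {eg : γ → Data} {ed : δ → Data}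

namespace PB

theorem const (n : ℕ) : PB eg fun _ => n := ⟨Polynomial.C n, fun c => by simp⟩

theorem size : PB eg fun c => (eg c).size := ⟨Polynomial.X, fun c => by simp⟩

theorem add {s s' : γ → ℕ} (h : PB eg s) (h' : PB eg s') : PB eg fun c => s c + s' c :=
  let ⟨Q, hQ⟩ := h
  let ⟨Q', hQ'⟩ := h'
  ⟨Q + Q', fun c => by simpa using add_le_add (hQ c) (hQ' c)⟩

theorem mul {s s' : γ → ℕ} (h : PB eg s) (h' : PB eg s') : PB eg fun c => s c * s' c :=
  let ⟨Q, hQ⟩ := h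
  let ⟨Q', hQ'⟩ := h'
  ⟨Q * Q', fun c => by simpa using Nat.mul_le_mul (hQ c) (hQ' c)⟩

theorem eval {s : γ → ℕ} (h : PB eg s) (P : Polynomial ℕ) : PB eg fun c => P.eval (s c) :=
  let ⟨Q, hQ⟩ := h
  ⟨P.comp Q, fun c => by simpa [Polynomial.eval_comp] using eval_mono P (hQ c)⟩

end PB

/-- Encoding of lists. -/
def eL {α : Type} (e : α → Data) : List α → Data
  | [] => Data.nil
  | a :: l => Data.cons (e a) (eL e l)

/-- Encoding of pairs. -/
def eP {α β : Type} (e : α → Data) (e' : β → Data) (x : α × β) : Data := Data.cons (e x.1) (e' x.2)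

/-- Encoding of optional values. -/
def eO {α : Type} (e : α → Data) : Option α → Data
  | none => Data.nil
  | some a => Data.cons Data.nil (e a)

/-- Unary encoding of natural numbers. -/
def eU : ℕ → Data
  | 0 => Data.nil
  | n + 1 => Data.cons Data.nil (eU n)

/-! ### Encodings and the sizes of encoded data. -/

theorem encList_eq_eL {α : Type} [Coded α] : (encList : List α → Data) = eL Coded.enc := by
  funext l; induction l with
  | nil => rfl
  | cons a l ih => simp [encList, eL, ih]

theorem enc_list {α : Type} [Coded α] : (Coded.enc : List α → Data) = eL Coded.enc := encList_eq_eL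

theorem enc_option {α : Type} [Coded α] : (Coded.enc : Option α → Data) = eO Coded.enc := by
  funext o; cases o <;> rfl

theorem eU_injective : Function.Injective eU := by
  intro m
  induction m with
  | zero => intro n h; cases n <;> simp_all [eU]
  | succ m ih =>
    intro n h
    cases n with
    | zero => simp [eU] at h
    | succ n => simp only [eU, Data.cons.injEq, true_and] at h; rw [ih h]

theorem size_eL_cons (a : α) (l : List α) :
    (eL ea (a :: l)).size = 1 + (ea a).size + (eL ea l).size := rfl

theorem size_eL_append (l m : List α) :
    (eL ea (l ++ m)).size + 1 = (eL ea l).size + (eL ea m).size := by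
  induction l with
  | nil => simp [eL, Data.size]; omega
  | cons a l ih => simp only [List.cons_append, size_eL_cons]; omega

theorem size_eL_reverse (l : List α) : (eL ea l.reverse).size = (eL ea l).size := by
  induction l with
  | nil => rfl
  | cons a l ih =>
    have := size_eL_append (ea := ea) l.reverse [a]
    simp only [List.reverse_cons, size_eL_cons] at this ⊢
    simp only [eL, Data.size] at this ⊢; omega

theorem length_lt_size_eL (l : List α) : l.length < (eL ea l).size := by
  induction l with
  | nil => simp [eL, Data.size]
  | cons a l ih => simp only [size_eL_cons, List.length_cons]; omega

theorem size_lt_of_mem {a : α} {l : List α} (h : a ∈ l) : (ea a).size < (eL ea l).size := by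
  induction l with
  | nil => simp at h
  | cons b l ih =>
    rw [size_eL_cons]
    rcases List.mem_cons.1 h with rfl | h
    · omega
    · have := ih h; omega

theorem size_eL_sublist {l m : List α} (h : l.Sublist m) : (eL ea l).size ≤ (eL ea m).size := by
  induction h with
  | slnil => exact le_rfl
  | cons a _ ih => rw [size_eL_cons]; omega
  | cons_cons a _ ih => simp only [size_eL_cons]; omega

theorem size_eL_le (l : List α) (b : ℕ) (h : ∀ a ∈ l, (ea a).size ≤ b) :
    (eL ea l).size ≤ 1 + l.length * (1 + b) := by
  induction l with
  | nil => simp [eL, Data.size]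
  | cons a l ih =>
    have h1 := ih fun x hx => h x (List.mem_cons_of_mem _ hx)
    have h2 := h a List.mem_cons_self
    simp only [size_eL_cons, List.length_cons, add_mul, one_mul] at *; omega

theorem size_eU (n : ℕ) : (eU n).size = 2 * n + 1 := by
  induction n with
  | zero => rfl
  | succ n ih => simp only [eU, Data.size, ih]; omega

theorem size_eP (x : α × β) : (eP ea eb x).size = 1 + (ea x.1).size + (eb x.2).size := rfl

/-! ### Closure properties of polynomial-time functions. -/

namespace PT

theorem size_le {f : α → β} (h : PT ea eb f) :
    ∃ Q : Polynomial ℕ, ∀ a, (eb (f a)).size ≤ Q.eval (ea a).size := by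
  obtain ⟨p, P, h⟩ := h
  refine ⟨Polynomial.X + 3 * P, fun a => ?_⟩
  obtain ⟨t, ht, hr⟩ := h a
  have := hr.size_le
  simp only [Polynomial.eval_add, Polynomial.eval_X, Polynomial.eval_mul, Polynomial.eval_ofNat]
  omega

theorem pb {f : γ → α} (h : PT eg ea f) : PB eg fun c => (ea (f c)).size := h.size_le

/-- A program sees only trees, so encodings that agree as trees are interchangeable. This is how the
ad hoc encodings of lists, pairs and unary numbers are matched with `Coded.enc`. -/
theorem of_eq {α' β' : Type} {ea' : α' → Data} {eb' : β' → Data} {f : α → β} {f' : α' → β'}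
    (h : PT ea eb f) (g : α' → α) (h1 : ∀ a, ea' a = ea (g a))
    (h2 : ∀ a, eb' (f' a) = eb (f (g a))) : PT ea' eb' f' := by
  obtain ⟨p, P, h⟩ := h
  refine ⟨p, P, fun a => ?_⟩
  rw [h1, h2]; exact h (g a)

/-- Change of the encoding of the result. -/
theorem recode {β' : Type} {eb' : β' → Data} {f : α → β} {f' : α → β'}
    (h : PT ea eb f) (h2 : ∀ a, eb' (f' a) = eb (f a)) : PT ea eb' f' :=
  h.of_eq id (fun _ => rfl) h2

theorem congr {f f' : α → β} (h : PT ea eb f) (h' : ∀ a, f' a = f a) : PT ea eb f' :=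
  h.recode fun a => by rw [h']

protected theorem id : PT ea ea fun a => a :=
  ⟨Prog.id, Polynomial.X, fun a => ⟨_, by simp, Runs.id _⟩⟩

theorem runs_const (d : Data) : ∃ p t, ∀ x, ∃ s ≤ t, Runs p x s d := by
  induction d with
  | nil => exact ⟨Prog.nil, 1, fun x => ⟨1, le_rfl, Runs.nil x⟩⟩
  | cons a b iha ihb =>
    obtain ⟨p, s, hp⟩ := iha
    obtain ⟨q, t, hq⟩ := ihb
    refine ⟨Prog.pair p q, s + t + (Data.cons a b).size, fun x => ?_⟩
    obtain ⟨s', hs, hp⟩ := hp x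
    obtain ⟨t', ht, hq⟩ := hq x
    exact ⟨_, by omega, Runs.pair hp hq⟩

theorem const (b : β) : PT ea eb fun _ => b := by
  obtain ⟨p, t, h⟩ := runs_const (eb b)
  refine ⟨p, Polynomial.C t, fun a => ?_⟩
  obtain ⟨s, hs, h⟩ := h (ea a)
  exact ⟨s, by simpa using hs, h⟩

/-- The size bound for the intermediate result is substituted into the time polynomial of the second
program. -/
theorem comp {g : α → β} {f : γ → α} (hg : PT ea eb g) (hf : PT eg ea f) :
    PT eg eb fun c => g (f c) := by
  obtain ⟨Q, hQ⟩ := hf.size_le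
  obtain ⟨q, R, hg⟩ := hg
  obtain ⟨p, P, hf⟩ := hf
  refine ⟨Prog.comp p q, P + R.comp Q + 1, fun c => ?_⟩
  obtain ⟨s, hs, hr⟩ := hf c
  obtain ⟨t, ht, hr'⟩ := hg (f c)
  refine ⟨_, ?_, Runs.comp hr hr'⟩
  have := eval_mono R (hQ c)
  simp only [Polynomial.eval_add, Polynomial.eval_comp, Polynomial.eval_one]
  omega

theorem pair {f : γ → α} {g : γ → β} (hf : PT eg ea f) (hg : PT eg eb g) :
    PT eg (eP ea eb) fun c => (f c, g c) := by
  obtain ⟨Q, hQ⟩ := hf.size_le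
  obtain ⟨Q', hQ'⟩ := hg.size_le
  obtain ⟨p, P, hf⟩ := hf
  obtain ⟨q, R, hg⟩ := hg
  refine ⟨Prog.pair p q, P + R + (1 + Q + Q'), fun c => ?_⟩
  obtain ⟨s, hs, hr⟩ := hf c
  obtain ⟨t, ht, hr'⟩ := hg c
  refine ⟨_, ?_, Runs.pair hr hr'⟩
  have := hQ c
  have := hQ' c
  simp only [Polynomial.eval_add, Polynomial.eval_one, Data.size]
  omega

/-- A function that acts as `hd` on encodings. -/
theorem of_hd {f : α → β} (h : ∀ a, eb (f a) = (ea a).hd) : PT ea eb f :=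
  ⟨Prog.hd, Polynomial.X, fun a => ⟨(ea a).size, by simp, by rw [h]; exact Runs.hd _⟩⟩

/-- A function that acts as `tl` on encodings. -/
theorem of_tl {f : α → β} (h : ∀ a, eb (f a) = (ea a).tl) : PT ea eb f :=
  ⟨Prog.tl, Polynomial.X, fun a => ⟨(ea a).size, by simp, by rw [h]; exact Runs.tl _⟩⟩

theorem fst {f : γ → α × β} (h : PT eg (eP ea eb) f) : PT eg ea fun c => (f c).1 :=
  comp (g := Prod.fst) (of_hd fun _ => rfl) h

theorem snd {f : γ → α × β} (h : PT eg (eP ea eb) f) : PT eg eb fun c => (f c).2 :=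
  comp (g := Prod.snd) (of_tl fun _ => rfl) h

theorem beq {f g : γ → α} (hi : Function.Injective ea) [DecidableEq α] (hf : PT eg ea f)
    (hg : PT eg ea g) : PT eg Data.ofBool fun c => decide (f c = g c) :=
  comp (ea := eP ea ea) (g := fun x : α × α => decide (x.1 = x.2))
    ⟨Prog.eq, Polynomial.X, fun a => ⟨(eP ea ea a).size, by simp, by
      have h : decide (a.1 = a.2) = decide ((eP ea ea a).hd = (eP ea ea a).tl) := by
        simp [eP, Data.hd, Data.tl, hi.eq_iff]
      show Runs _ _ _ (Data.ofBool (decide (a.1 = a.2)))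
      rw [h]; exact Runs.eq _⟩⟩ (hf.pair hg)

/-- Case distinction on whether an encoded value is `nil`. -/
theorem ite_of {c : γ → Bool} {s : γ → α} {f g : γ → β} (hs : PT eg ea s)
    (hc : ∀ x, c x = true ↔ ea (s x) ≠ Data.nil)
    (hf : PT eg eb f) (hg : PT eg eb g) : PT eg eb fun x => if c x then f x else g x := by
  obtain ⟨p, P, hs⟩ := hs
  obtain ⟨q, Q, hf⟩ := hf
  obtain ⟨r, R, hg⟩ := hg
  refine ⟨Prog.ite p q r, P + Q + R + 1, fun x => ?_⟩
  obtain ⟨t, ht, hr⟩ := hs x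
  obtain ⟨t', ht', hr'⟩ := hf x
  obtain ⟨t'', ht'', hr''⟩ := hg x
  simp only [Polynomial.eval_add, Polynomial.eval_one]
  by_cases h : c x
  · rw [if_pos h]
    exact ⟨_, by omega, Runs.ite_true hr ((hc x).1 h) hr'⟩
  · rw [if_neg h]
    have : ea (s x) = Data.nil := by
      by_contra h'; exact h ((hc x).2 h')
    rw [this] at hr
    exact ⟨_, by omega, Runs.ite_false hr hr''⟩

protected theorem ite {c : γ → Bool} {f g : γ → β} (hc : PT eg Data.ofBool c)
    (hf : PT eg eb f) (hg : PT eg eb g) : PT eg eb fun x => if c x then f x else g x :=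
  ite_of hc (fun x => by cases c x <;> simp [Data.ofBool]) hf hg

theorem not {c : γ → Bool} (hc : PT eg Data.ofBool c) : PT eg Data.ofBool fun x => !(c x) :=
  (hc.ite (const false) (const true)).congr fun x => by cases c x <;> rfl

theorem xor {c d : γ → Bool} (hc : PT eg Data.ofBool c) (hd : PT eg Data.ofBool d) :
    PT eg Data.ofBool fun x => (c x ^^ d x) :=
  (hc.ite hd.not hd).congr fun x => by cases c x <;> cases d x <;> rfl

theorem cons {f : γ → α} {l : γ → List α} (hf : PT eg ea f) (hl : PT eg (eL ea) l) :
    PT eg (eL ea) fun c => f c :: l c :=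
  (hf.pair hl).recode fun _ => rfl

theorem some {f : γ → α} (hf : PT eg ea f) : PT eg (eO ea) fun c => Option.some (f c) :=
  ((const (eb := fun d : Data => d) (ea := eg) Data.nil).pair hf).recode fun _ => rfl

theorem tail {l : γ → List α} (hl : PT eg (eL ea) l) : PT eg (eL ea) fun c => (l c).tail :=
  comp (g := List.tail) (of_tl fun l => by cases l <;> rfl) hl

theorem isEmpty {l : γ → List α} (hl : PT eg (eL ea) l) :
    PT eg Data.ofBool fun c => (l c).isEmpty :=
  (ite_of (c := fun x => !(l x).isEmpty) hl (fun x => by cases l x <;> simp [eL])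
    (const false) (const true)).congr fun x => by cases l x <;> rfl

/-- Case distinction on a list; the branch for `cons` gets the head and the tail. -/
theorem listCases {l : γ → List α} {f : γ → β} {g : γ → α → List α → β} (hl : PT eg (eL ea) l)
    (hf : PT eg eb f) (hg : PT (eP eg (eP ea (eL ea))) eb fun x => g x.1 x.2.1 x.2.2) :
    PT eg eb fun c => match l c with
      | [] => f c
      | a :: m => g c a m := by
  obtain ⟨p, P, hl⟩ := hl
  obtain ⟨q, Q, hf⟩ := hf
  obtain ⟨r, R, hg⟩ := hg
  -- The code of a nonempty list is already the pair of its head and tail, so pairing the argument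
  -- with the list gives the input of the second branch.
  refine ⟨Prog.ite p (Prog.comp (Prog.pair Prog.id p) r) q,
    2 * P + Q + R.comp (1 + Polynomial.X + (Polynomial.X + 3 * P)) +
      (Polynomial.X + 1 + Polynomial.X + (Polynomial.X + 3 * P)) + 2, fun x => ?_⟩
  obtain ⟨t, ht, hr⟩ := hl x
  obtain ⟨t', ht', hr'⟩ := hf x
  have hsz := hr.size_le
  simp only [Polynomial.eval_add, Polynomial.eval_one, Polynomial.eval_comp, Polynomial.eval_mul,
    Polynomial.eval_ofNat, Polynomial.eval_X]
  cases h : l x with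
  | nil =>
    rw [h] at hr
    exact ⟨_, by omega, Runs.ite_false hr hr'⟩
  | cons a m =>
    rw [h] at hr hsz
    obtain ⟨t'', ht'', hr''⟩ := hg (x, a, m)
    refine ⟨_, ?_, Runs.ite_true hr (by simp [eL]) (Runs.comp (Runs.pair (Runs.id _) hr) hr'')⟩
    have h1 : (eP eg (eP ea (eL ea)) (x, a, m)).size ≤
        1 + (eg x).size + ((eg x).size + 3 * P.eval (eg x).size) := by
      simp only [size_eP, size_eL_cons] at *; omega
    have h2 := eval_mono R h1
    simp only [Data.size] at *
    omega

theorem headD {l : γ → List α} {d : γ → α} (hl : PT eg (eL ea) l) (hd : PT eg ea d) :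
    PT eg ea fun c => (l c).headD (d c) :=
  (listCases (g := fun _ a _ => a) hl hd PT.id.snd.fst).congr fun c => by cases l c <;> rfl

/-- An option is treated as a list with at most one element; on codes this only moves the payload
from the tail to the head of a node. -/
theorem optionCases {o : γ → Option α} {f : γ → β} {g : γ → α → β} (ho : PT eg (eO ea) o)
    (hf : PT eg eb f) (hg : PT (eP eg ea) eb fun x => g x.1 x.2) :
    PT eg eb fun c => match o c with
      | none => f c
      | Option.some a => g c a := by
  have h1 : PT eg (eL ea) fun c => (o c).toList := by
    have h : PT (eO ea) (eL ea) Option.toList := by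
      have h2 : PT (eO ea) (fun d : Data => d) fun o => (eO ea o).tl := of_tl fun _ => rfl
      have h3 : PT (eO ea) (fun d : Data => d) fun o => Data.cons (eO ea o).tl Data.nil :=
        (h2.pair (const (eb := fun d : Data => d) Data.nil)).recode fun _ => rfl
      have h4 : PT (eO ea) (fun d : Data => d) fun o : Option α =>
          if o.isSome then Data.cons (eO ea o).tl Data.nil else Data.nil :=
        ite_of (c := fun o => o.isSome) (PT.id (ea := eO ea)) (fun o => by cases o <;> simp [eO])
          h3 (const Data.nil)
      exact h4.recode fun o => by cases o <;> rfl
    exact comp h ho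
  exact (listCases (g := fun c a _ => g c a) h1 hf
    (comp (g := fun x : γ × α => g x.1 x.2) hg (PT.id.fst.pair PT.id.snd.fst))).congr
      fun c => by cases o c <;> rfl

end PT

/-! ### Iteration over lists -/

/-- The loop state is `(c, (rest, acc))`, and the loop test reads `rest`, which is `nil` exactly
when the list is exhausted. With `N` bounding the context and the list and `B` bounding all
accumulators, every state has size at most `2 + 2 * N + B`, whence one time bound for all
iterations. -/
theorem foldl_runs {F : γ → β → α → β} {p : Prog} {P : Polynomial ℕ} (c : γ) (N B : ℕ)
    (hp : ∀ a m b, ∃ t ≤ P.eval (Data.cons (eg c) (Data.cons (eL ea (a :: m)) (eb b))).size,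
      Runs p (Data.cons (eg c) (Data.cons (eL ea (a :: m)) (eb b))) t
        (Data.cons (eg c) (Data.cons (eL ea m) (eb (F c b a)))))
    (hc : (eg c).size ≤ N) (l : List α) (b : β) (hl : (eL ea l).size ≤ N)
    (hb : ∀ l₁, l₁ <+: l → (eb (l₁.foldl (F c) b)).size ≤ B) :
    ∃ t ≤ (l.length + 1) * (P.eval (2 + 2 * N + B) + 2 * (2 + 2 * N + B) + 3),
      Runs (Prog.loop (Prog.comp Prog.tl Prog.hd) p)
        (Data.cons (eg c) (Data.cons (eL ea l) (eb b))) t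
        (Data.cons (eg c) (Data.cons Data.nil (eb (l.foldl (F c) b)))) := by
  induction l generalizing b with
  | nil =>
    refine ⟨_, ?_, Runs.loop_stop (Runs.comp (Runs.tl _) (Runs.hd _))⟩
    have := hb [] List.nil_prefix
    simp only [eL, Data.size, Data.tl, List.foldl_nil, List.length_nil] at *
    have := Nat.zero_le (P.eval (2 + 2 * N + B))
    omega
  | cons a l ih =>
    have hb0 := hb [] List.nil_prefix
    simp only [List.foldl_nil] at hb0
    obtain ⟨t, ht, hr⟩ := hp a l b
    obtain ⟨u, hu, hr'⟩ := ih (F c b a) (by rw [size_eL_cons] at hl; omega) fun l₁ h₁ => by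
      simpa using hb (a :: l₁) (by simpa using h₁)
    have hS : (Data.cons (eg c) (Data.cons (eL ea (a :: l)) (eb b))).size ≤ 2 + 2 * N + B := by
      simp only [Data.size]; omega
    refine ⟨_, ?_, Runs.loop_step (Runs.comp (Runs.tl _) (Runs.hd _)) (by simp [eL, Data.tl, Data.hd])
      hr hr'⟩
    have h1 := eval_mono P hS
    have h2 := (Data.cons (eg c) (Data.cons (eL ea (a :: l)) (eb b))).size_tl_le
    simp only [List.length_cons]
    rw [add_mul (l.length + 1), one_mul]
    omega

namespace PT

/-- A bound on all intermediate accumulators has to be supplied: a polynomial-time step could double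
its accumulator, which after linearly many iterations would be exponentially large. -/
theorem foldl {F : γ → β → α → β} {l : γ → List α} {b : γ → β} (s : γ → ℕ)
    (hF : PT (eP eg (eP eb ea)) eb fun x => F x.1 x.2.1 x.2.2) (hl : PT eg (eL ea) l)
    (hb : PT eg eb b) (hs : PB eg s)
    (hB : ∀ c l₁, l₁ <+: l c → (eb (l₁.foldl (F c) (b c))).size ≤ s c) :
    PT eg eb fun c => (l c).foldl (F c) (b c) := by
  have hstep : PT (eP eg (eP (eP ea (eL ea)) eb)) (eP eg (eP (eL ea) eb))
      fun x => (x.1, (x.2.1.2, F x.1 x.2.2 x.2.1.1)) :=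
    PT.id.fst.pair (PT.id.snd.fst.snd.pair
      (comp hF (PT.id.fst.pair (PT.id.snd.snd.pair PT.id.snd.fst.fst))))
  have hinit : PT eg (eP eg (eP (eL ea) eb)) fun c => (c, (l c, b c)) := PT.id.pair (hl.pair hb)
  obtain ⟨p, P, hstep⟩ := hstep
  obtain ⟨L, hL⟩ := hl.size_le
  obtain ⟨S, hS⟩ := hs
  let T : Polynomial ℕ := 2 + 2 * (Polynomial.X + L) + S
  have hloop : PT eg (eP eg (eP (eL ea) eb)) fun c => (c, (([] : List α), (l c).foldl (F c) (b c))) := by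
    obtain ⟨q, Q, hinit⟩ := hinit
    refine ⟨Prog.comp q (Prog.loop (Prog.comp Prog.tl Prog.hd) p),
      Q + (L + 1) * (P.comp T + 2 * T + 3) + 1, fun c => ?_⟩
    obtain ⟨t, ht, hr⟩ := hinit c
    obtain ⟨u, hu, hr'⟩ := foldl_runs (F := F) (eg := eg) (ea := ea) (eb := eb) (p := p) (P := P) c
      ((eg c).size + L.eval (eg c).size) (S.eval (eg c).size)
      (fun a m b => hstep (c, ((a, m), b))) (by omega) (l c) (b c) (by have := hL c; omega)
      fun l₁ h₁ => (hB c l₁ h₁).trans (hS c)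
    refine ⟨_, ?_, Runs.comp hr hr'⟩
    have h1 : (l c).length + 1 ≤ L.eval (eg c).size + 1 := by
      have := hL c; have := length_lt_size_eL (ea := ea) (l c); omega
    have h2 := Nat.mul_le_mul_right (P.eval (2 + 2 * ((eg c).size + L.eval (eg c).size) +
      S.eval (eg c).size) + 2 * (2 + 2 * ((eg c).size + L.eval (eg c).size) +
      S.eval (eg c).size) + 3) h1
    simp only [T, Polynomial.eval_add, Polynomial.eval_one, Polynomial.eval_comp,
      Polynomial.eval_mul, Polynomial.eval_ofNat, Polynomial.eval_X]
    omega
  exact hloop.snd.snd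

theorem reverse {l : γ → List α} (hl : PT eg (eL ea) l) : PT eg (eL ea) fun c => (l c).reverse := by
  refine (foldl (F := fun _ acc a => a :: acc) (b := fun _ => []) (fun c => (eL ea (l c)).size)
    (cons PT.id.snd.snd PT.id.snd.fst) hl (const []) hl.pb fun c l₁ h₁ => ?_).congr fun c => by simp
  simp only [List.foldl_flip_cons_eq_append']
  simp only [List.append_nil, size_eL_reverse]
  exact size_eL_sublist h₁.sublist

theorem foldr {F : γ → α → β → β} {l : γ → List α} {b : γ → β} (s : γ → ℕ)
    (hF : PT (eP eg (eP ea eb)) eb fun x => F x.1 x.2.1 x.2.2) (hl : PT eg (eL ea) l)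
    (hb : PT eg eb b) (hs : PB eg s)
    (hB : ∀ c l₁, l₁ <:+ l c → (eb (l₁.foldr (F c) (b c))).size ≤ s c) :
    PT eg eb fun c => (l c).foldr (F c) (b c) := by
  refine (foldl (F := fun c b a => F c a b) s
    (comp hF (PT.id.fst.pair (PT.id.snd.snd.pair PT.id.snd.fst))) hl.reverse hb hs
    fun c l₁ h₁ => ?_).congr fun c => by simp
  have := hB c l₁.reverse (by simpa using h₁.reverse)
  simpa using this

theorem map {g : γ → α → β} {l : γ → List α} (hg : PT (eP eg ea) eb fun x => g x.1 x.2)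
    (hl : PT eg (eL ea) l) : PT eg (eL eb) fun c => (l c).map (g c) := by
  obtain ⟨Q, hQ⟩ := hg.size_le
  have h : ∀ c (l : List α), l.foldr (fun a acc => g c a :: acc) [] = l.map (g c) := fun c l => by
    induction l with
    | nil => rfl
    | cons a l ih => rw [List.foldr_cons, ih, List.map_cons]
  refine (foldr (F := fun c a acc => g c a :: acc) (b := fun _ => [])
    (fun c => 1 + (eL ea (l c)).size * (1 + Q.eval (1 + (eg c).size + (eL ea (l c)).size)))
    (cons (comp hg (PT.id.fst.pair PT.id.snd.fst)) PT.id.snd.snd) hl (const [])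
    ((PB.const 1).add (hl.pb.mul ((PB.const 1).add ((((PB.const 1).add PB.size).add hl.pb).eval Q))))
    fun c l₁ h₁ => ?_).congr fun c => (h c _).symm
  rw [h]
  refine (size_eL_le _ (Q.eval (1 + (eg c).size + (eL ea (l c)).size)) ?_).trans ?_
  · intro b hb
    obtain ⟨a, ha, rfl⟩ := List.mem_map.1 hb
    refine (hQ (c, a)).trans (eval_mono Q ?_)
    have := size_lt_of_mem (ea := ea) (h₁.subset ha)
    simp only [size_eP]; omega
  · have := length_lt_size_eL (ea := ea) (l c)
    have := h₁.length_le
    rw [List.length_map]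
    gcongr; omega

theorem append {l m : γ → List α} (hl : PT eg (eL ea) l) (hm : PT eg (eL ea) m) :
    PT eg (eL ea) fun c => l c ++ m c := by
  have hf : ∀ (l m : List α), l.foldr (fun a acc => a :: acc) m = l ++ m := fun l m => by
    induction l with
    | nil => rfl
    | cons a l ih => simp
  refine (foldr (F := fun _ a acc => a :: acc) (b := m)
    (fun c => (eL ea (l c)).size + (eL ea (m c)).size)
    (cons PT.id.snd.fst PT.id.snd.snd) hl hm (hl.pb.add hm.pb) fun c l₁ h₁ => ?_).congr fun c => by
      rw [hf]
  rw [hf]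
  have := size_eL_append (ea := ea) l₁ (m c)
  have := size_eL_sublist (ea := ea) h₁.sublist
  omega

theorem flatten {l : γ → List (List α)} (hl : PT eg (eL (eL ea)) l) :
    PT eg (eL ea) fun c => (l c).flatten := by
  have hsz : ∀ l : List (List α), (eL ea l.flatten).size ≤ (eL (eL ea) l).size := fun l => by
    induction l with
    | nil => exact le_rfl
    | cons a l ih =>
      have := size_eL_append (ea := ea) a l.flatten
      simp only [List.flatten_cons, size_eL_cons]; omega
  have hf : ∀ l : List (List α), l.foldr (fun a acc => a ++ acc) [] = l.flatten := fun l => by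
    induction l with
    | nil => rfl
    | cons a l ih => simp [ih]
  refine (foldr (F := fun _ a acc => a ++ acc) (b := fun _ => []) (fun c => (eL (eL ea) (l c)).size)
    (append PT.id.snd.fst PT.id.snd.snd) hl (const []) hl.pb fun c l₁ h₁ => ?_).congr fun c => by
      rw [hf]
  rw [hf]
  exact (hsz l₁).trans (size_eL_sublist h₁.sublist)

theorem flatMap {g : γ → α → List β} {l : γ → List α}
    (hg : PT (eP eg ea) (eL eb) fun x => g x.1 x.2) (hl : PT eg (eL ea) l) :
    PT eg (eL eb) fun c => (l c).flatMap (g c) :=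
  (flatten (map hg hl)).congr fun _ => List.flatMap_def

theorem filter {g : γ → α → Bool} {l : γ → List α}
    (hg : PT (eP eg ea) Data.ofBool fun x => g x.1 x.2) (hl : PT eg (eL ea) l) :
    PT eg (eL ea) fun c => (l c).filter (g c) :=
  (flatMap (g := fun c a => if g c a then [a] else [])
    (hg.ite (cons PT.id.snd (const [])) (const [])) hl).congr fun c => by
    induction l c with
    | nil => rfl
    | cons a l ih => rw [List.filter_cons, List.flatMap_cons, ih]; split <;> simp

/-- Iterated exclusive or. -/
theorem xorFold {g : γ → α → Bool} {l : γ → List α}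
    (hg : PT (eP eg ea) Data.ofBool fun x => g x.1 x.2) (hl : PT eg (eL ea) l) :
    PT eg Data.ofBool fun c => (l c).foldr (fun a b => g c a ^^ b) false :=
  foldr (F := fun c a b => g c a ^^ b) (b := fun _ => false) (fun _ => 3)
    (xor (comp hg (PT.id.fst.pair PT.id.snd.fst)) PT.id.snd.snd) hl (const false) (PB.const 3)
    fun _ _ _ => Data.size_ofBool_le _

/-! ### Unary numbers -/

theorem succ {f : γ → ℕ} (hf : PT eg eU f) : PT eg eU fun c => f c + 1 :=
  ((const (eb := fun d : Data => d) (ea := eg) Data.nil).pair hf).recode fun _ => rfl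

theorem pred {f : γ → ℕ} (hf : PT eg eU f) : PT eg eU fun c => f c - 1 :=
  comp (g := fun n : ℕ => n - 1) (of_tl fun n => by cases n <;> rfl) hf

theorem toUnits {f : γ → ℕ} (hf : PT eg eU f) :
    PT eg (eL fun _ : Unit => Data.nil) fun c => List.replicate (f c) () :=
  hf.recode fun c => by
    induction f c with
    | zero => rfl
    | succ n ih => simp [List.replicate_succ, eL, eU, ih]

theorem length {l : γ → List α} (hl : PT eg (eL ea) l) : PT eg eU fun c => (l c).length :=
  (map (eb := fun _ : Unit => Data.nil) (g := fun _ _ => ()) (const ()) hl).recode fun c => by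
    induction l c with
    | nil => rfl
    | cons a l ih => simp [eL, eU, ih]

/-- Iteration of a function a number of times given in unary. -/
theorem iterate {F : γ → β → β} {n : γ → ℕ} {b : γ → β} (s : γ → ℕ)
    (hF : PT (eP eg eb) eb fun x => F x.1 x.2) (hn : PT eg eU n)
    (hb : PT eg eb b) (hs : PB eg s)
    (hB : ∀ c i, i ≤ n c → (eb ((F c)^[i] (b c))).size ≤ s c) :
    PT eg eb fun c => (F c)^[n c] (b c) := by
  have hf : ∀ (c : γ) (l : List Unit) (x : β), l.foldl (fun b _ => F c b) x = (F c)^[l.length] x := by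
    intro c l
    induction l with
    | nil => intro x; rfl
    | cons a l ih => intro x; simp [ih]
  refine (foldl (F := fun c b (_ : Unit) => F c b) s (comp hF (PT.id.fst.pair PT.id.snd.fst))
    hn.toUnits hb hs fun c l₁ h₁ => ?_).congr fun c => by rw [hf]; simp
  rw [hf]
  exact hB c _ (by simpa using h₁.length_le)

theorem add {f g : γ → ℕ} (hf : PT eg eU f) (hg : PT eg eU g) : PT eg eU fun c => f c + g c :=
  (length (append hf.toUnits hg.toUnits)).congr fun c => by simp

theorem sub {f g : γ → ℕ} (hf : PT eg eU f) (hg : PT eg eU g) : PT eg eU fun c => f c - g c := by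
  have h : ∀ i n : ℕ, (fun m => m - 1)^[i] n = n - i := fun i => by
    induction i with
    | zero => intro n; rfl
    | succ i ih => intro n; rw [Function.iterate_succ_apply, ih]; omega
  refine (iterate (F := fun _ n => n - 1) (fun c => (eU (f c)).size) PT.id.snd.pred hg hf hf.pb
    fun c i _ => ?_).congr fun c => (h _ _).symm
  rw [h, size_eU, size_eU]; omega

theorem lt {f g : γ → ℕ} (hf : PT eg eU f) (hg : PT eg eU g) :
    PT eg Data.ofBool fun c => decide (f c < g c) :=
  ((isEmpty (hg.sub hf).toUnits).not).congr fun c => by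
    by_cases h : f c < g c
    · have : g c - f c ≠ 0 := by omega
      simp [h, this]
    · have : g c - f c = 0 := by omega
      simp [h, this]

/-- Half of a number, with the remainder. -/
theorem half {f : γ → ℕ} (hf : PT eg eU f) : PT eg eU fun c => f c / 2 := by
  -- Counting up to the number while keeping the quotient and the parity of the counter avoids any
  -- division.
  have h : ∀ i : ℕ, (fun x : ℕ × Bool => (if x.2 then x.1 + 1 else x.1, !x.2))^[i] (0, false) =
      (i / 2, decide (i % 2 = 1)) := fun i => by
    induction i with
    | zero => rfl
    | succ i ih =>
      rw [Function.iterate_succ_apply', ih]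
      rcases Nat.mod_two_eq_zero_or_one i with h | h
      · have : (i + 1) / 2 = i / 2 := by omega
        have h' : (i + 1) % 2 = 1 := by omega
        simp [h, h', this]
      · have : (i + 1) / 2 = i / 2 + 1 := by omega
        have h' : (i + 1) % 2 = 0 := by omega
        simp [h, h', this]
  refine (iterate (eb := eP eU Data.ofBool) (F := fun _ (x : ℕ × Bool) => (if x.2 then x.1 + 1 else x.1, !x.2))
    (b := fun _ => (0, false)) (fun c => (eU (f c)).size + 10)
    ((PT.ite PT.id.snd.snd PT.id.snd.fst.succ PT.id.snd.fst).pair PT.id.snd.snd.not) hf (const _)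
    (hf.pb.add (PB.const 10)) fun c i hi => ?_).fst.congr fun c => by rw [h]
  rw [h, size_eP, size_eU, size_eU]
  have := Data.size_ofBool_le (decide (i % 2 = 1))
  simp only; omega

theorem even {f : γ → ℕ} (hf : PT eg eU f) : PT eg Data.ofBool fun c => decide (f c % 2 = 0) :=
  (beq eU_injective hf (hf.half.add hf.half)).congr fun c => by
    have : f c % 2 = 0 ↔ f c = f c / 2 + f c / 2 := by omega
    simp [this]

theorem range {f : γ → ℕ} (hf : PT eg eU f) : PT eg (eL eU) fun c => List.range (f c) := by
  have h : ∀ i : ℕ, (fun l : List ℕ => l ++ [l.length])^[i] [] = List.range i := fun i => by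
    induction i with
    | zero => rfl
    | succ i ih => rw [Function.iterate_succ_apply', ih, List.range_succ]; simp
  refine (iterate (F := fun _ (l : List ℕ) => l ++ [l.length]) (b := fun _ => [])
    (fun c => 1 + (eU (f c)).size * (1 + (eU (f c)).size))
    (PT.id.snd.append (cons PT.id.snd.length (const []))) hf (const [])
    ((PB.const 1).add (hf.pb.mul ((PB.const 1).add hf.pb))) fun c i hi => ?_).congr fun c => (h _).symm
  rw [h]
  refine (size_eL_le _ (eU (f c)).size fun a ha => ?_).trans ?_
  · simp only [List.mem_range] at ha
    simp only [size_eU]; omega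
  · rw [List.length_range]
    gcongr
    rw [size_eU]; omega

end PT
end QArch

namespace QArch
set_option linter.unusedSectionVars false
set_option linter.unusedSimpArgs false

/-! ## Operators on amplitude functions -/

abbrev M4 : Type := Matrix (Bool × Bool) (Bool × Bool) ℂ

section Operators

variable {Q : Type} [DecidableEq Q]

theorem apply2_comm (M N : M4) {p q u v : Q} (h1 : p ≠ u) (h2 : p ≠ v) (h3 : q ≠ u) (h4 : q ≠ v)
    (ψ : (Q → Bool) → ℂ) : apply2 M p q (apply2 N u v ψ) = apply2 N u v (apply2 M p q ψ) := by
  funext c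
  simp only [apply2, Finset.mul_sum]
  rw [Finset.sum_comm]
  refine Finset.sum_congr rfl fun b _ => Finset.sum_congr rfl fun b' _ => ?_
  have e1 : Function.update (Function.update (Function.update (Function.update c p b'.1) q b'.2) u b.1) v b.2
      = Function.update (Function.update (Function.update (Function.update c u b.1) v b.2) p b'.1) q b'.2 := by
    funext x
    simp only [Function.update_apply]
    split_ifs <;> simp_all
  rw [e1]
  simp only [Function.update_apply, h1, h2, h3, h4, h1.symm, h2.symm, h3.symm, h4.symm, if_false]
  ring

theorem apply2_apply2 (M N : M4) {p q : Q} (h : p ≠ q) (ψ : (Q → Bool) → ℂ) :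
    apply2 M p q (apply2 N p q ψ) = apply2 (M * N) p q ψ := by
  funext c
  have e1 : ∀ b b' : Bool × Bool, Function.update (Function.update (Function.update
      (Function.update c p b.1) q b.2) p b'.1) q b'.2
      = Function.update (Function.update c p b'.1) q b'.2 := by
    intro b b'
    funext x
    simp only [Function.update_apply]
    split_ifs <;> simp_all
  simp only [apply2, Finset.mul_sum, Matrix.mul_apply, Finset.sum_mul, e1]
  rw [Finset.sum_comm]
  refine Finset.sum_congr rfl fun b _ => Finset.sum_congr rfl fun b' _ => ?_
  simp only [Function.update_apply, h, if_true, if_false]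
  ring

theorem apply2_one {p q : Q} (ψ : (Q → Bool) → ℂ) : apply2 (1 : M4) p q ψ = ψ := by
  funext c
  simp [apply2, Matrix.one_apply]

theorem apply2_smul_matrix (a : ℂ) (M : M4) (p q : Q) (ψ : (Q → Bool) → ℂ) :
    apply2 (a • M) p q ψ = a • apply2 M p q ψ := by
  funext c
  simp only [apply2, Matrix.smul_apply, smul_eq_mul, Pi.smul_apply, Finset.mul_sum]
  exact Finset.sum_congr rfl fun b _ => by ring

theorem apply2_smul (a : ℂ) (M : M4) (p q : Q) (ψ : (Q → Bool) → ℂ) :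
    apply2 M p q (a • ψ) = a • apply2 M p q ψ := by
  funext c
  simp only [apply2, smul_eq_mul, Pi.smul_apply, Finset.mul_sum]
  exact Finset.sum_congr rfl fun b _ => by ring

theorem apply2_swap (M : M4) {p q : Q} (h : p ≠ q) (ψ : (Q → Bool) → ℂ) :
    apply2 M q p ψ = apply2 (M.submatrix Prod.swap Prod.swap) p q ψ := by
  funext c
  simp only [apply2, Matrix.submatrix_apply, Prod.swap]
  refine Fintype.sum_equiv (Equiv.prodComm Bool Bool) _ _ fun b => ?_
  simp only [Equiv.prodComm_apply, Prod.swap]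
  rw [Function.update_comm h.symm]

/-- The second qubit is an idle partner and may be chosen freely. Gates, projections and corrections
thus all become two-qubit matrices, and one calculus of lists of such matrices covers them. -/
theorem apply1_eq_apply2_left (U : Matrix Bool Bool ℂ) {p q : Q} (h : p ≠ q)
    (ψ : (Q → Bool) → ℂ) : apply1 U p ψ = apply2 (U ⊗ₖ (1 : Matrix Bool Bool ℂ)) p q ψ := by
  funext c
  simp only [apply1, apply2, Matrix.kroneckerMap_apply, Fintype.sum_prod_type, Matrix.one_apply]
  refine Finset.sum_congr rfl fun b _ => ?_
  rw [Finset.sum_eq_single (c q)]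
  · have : Function.update (Function.update c p b) q (c q) = Function.update c p b := by
      funext x
      simp only [Function.update_apply]
      split_ifs <;> simp_all
    simp [this]
  · intro b' _ hb
    simp [hb.symm]
  · simp

theorem apply1_eq_apply2_right (U : Matrix Bool Bool ℂ) {p q : Q} (h : p ≠ q)
    (ψ : (Q → Bool) → ℂ) : apply1 U q ψ = apply2 ((1 : Matrix Bool Bool ℂ) ⊗ₖ U) p q ψ := by
  rw [apply1_eq_apply2_left U h.symm, apply2_swap _ h]
  congr 1
  ext a b
  simp [Matrix.kroneckerMap_apply, Matrix.one_apply, mul_comm]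

/-- The projector on a basis state of a qubit. -/
def proj1 (b : Bool) : Matrix Bool Bool ℂ := Matrix.of fun i j => if i = b ∧ j = b then 1 else 0

theorem project_eq_apply1 (q : Q) (b : Bool) (ψ : (Q → Bool) → ℂ) :
    project q b ψ = apply1 (proj1 b) q ψ := by
  funext c
  simp only [project, apply1, proj1, Matrix.of_apply]
  by_cases h : c q = b
  · simp only [h, true_and, ite_mul, one_mul, zero_mul, Finset.sum_ite_eq', Finset.mem_univ, if_true]
    rw [← h, Function.update_eq_self]
  · simp [h]

/-! ### Lists of two-qubit matrices and their reordering. -/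

/-- Successive action of two-qubit matrices. -/
def act (L : List (M4 × Q × Q)) (ψ : (Q → Bool) → ℂ) : (Q → Bool) → ℂ :=
  L.foldl (fun ψ t => apply2 t.1 t.2.1 t.2.2 ψ) ψ

@[simp] theorem act_nil (ψ : (Q → Bool) → ℂ) : act [] ψ = ψ := rfl

@[simp] theorem act_cons (t : M4 × Q × Q) (L : List (M4 × Q × Q)) (ψ : (Q → Bool) → ℂ) :
    act (t :: L) ψ = act L (apply2 t.1 t.2.1 t.2.2 ψ) := rfl

theorem act_append (L L' : List (M4 × Q × Q)) (ψ : (Q → Bool) → ℂ) :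
    act (L ++ L') ψ = act L' (act L ψ) := by
  simp [act, List.foldl_append]

theorem act_smul (L : List (M4 × Q × Q)) (a : ℂ) (ψ : (Q → Bool) → ℂ) :
    act L (a • ψ) = a • act L ψ := by
  induction L generalizing ψ with
  | nil => rfl
  | cons t L ih => simp only [act_cons, apply2_smul, ih]

/-- Qubits touched by a list of matrices. -/
def supp (L : List (M4 × Q × Q)) : List Q := L.flatMap fun t => [t.2.1, t.2.2]

theorem act_apply2_comm (L : List (M4 × Q × Q)) (M : M4) {p q : Q} (hp : p ∉ supp L)
    (hq : q ∉ supp L) (ψ : (Q → Bool) → ℂ) :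
    act L (apply2 M p q ψ) = apply2 M p q (act L ψ) := by
  induction L generalizing ψ with
  | nil => rfl
  | cons t L ih =>
    simp only [supp, List.flatMap_cons, List.mem_append, List.mem_cons, List.not_mem_nil,
      or_false, not_or] at hp hq
    rw [act_cons, act_cons, apply2_comm _ _ (Ne.symm hp.1.1) (Ne.symm hq.1.1) (Ne.symm hp.1.2) (Ne.symm hq.1.2)]
    exact ih hp.2 hq.2 _

theorem act_comm (L L' : List (M4 × Q × Q)) (h : (supp L).Disjoint (supp L'))
    (ψ : (Q → Bool) → ℂ) : act L (act L' ψ) = act L' (act L ψ) := by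
  induction L' generalizing ψ with
  | nil => rfl
  | cons t L' ih =>
    simp only [supp, List.flatMap_cons, List.disjoint_append_right] at h
    rw [act_cons, act_cons, ih h.2, act_apply2_comm]
    · exact fun hm => h.1 hm (by simp)
    · exact fun hm => h.1 hm (by simp)

theorem supp_append (L L' : List (M4 × Q × Q)) : supp (L ++ L') = supp L ++ supp L' := by
  simp [supp]

theorem mem_supp_flatMap {T : Type} (L : List T) (f : T → List (M4 × Q × Q)) (q : Q) :
    q ∈ supp (L.flatMap f) ↔ ∃ t ∈ L, q ∈ supp (f t) := by
  simp only [supp, List.mem_flatMap]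
  constructor
  · rintro ⟨a, ⟨t, ht, ha⟩, hq⟩; exact ⟨t, ht, a, ha, hq⟩
  · rintro ⟨t, ht, a, ha, hq⟩; exact ⟨a, ⟨t, ht, ha⟩, hq⟩

/-- Operations done in two layers may be done item by item instead, if later items do not interfere. -/
theorem act_flatMap_append {T : Type} (L : List T) (f g : T → List (M4 × Q × Q))
    (h : L.Pairwise fun s t => (supp (g s)).Disjoint (supp (f t))) (ψ : (Q → Bool) → ℂ) :
    act (L.flatMap fun t => f t ++ g t) ψ = act (L.flatMap f ++ L.flatMap g) ψ := by
  induction L generalizing ψ with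
  | nil => rfl
  | cons t L ih =>
    rw [List.pairwise_cons] at h
    simp only [List.flatMap_cons, act_append] at ih ⊢
    rw [ih h.2]
    congr 1
    refine act_comm _ _ ?_ _
    intro q hq hq'
    rw [mem_supp_flatMap] at hq
    obtain ⟨s, hs, hq⟩ := hq
    exact h.1 s hs hq' hq

theorem act_congr_items {T : Type} (L : List T) (f g : T → List (M4 × Q × Q))
    (h : ∀ t ∈ L, ∀ ψ, act (f t) ψ = act (g t) ψ) (ψ : (Q → Bool) → ℂ) :
    act (L.flatMap f) ψ = act (L.flatMap g) ψ := by
  induction L generalizing ψ with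
  | nil => rfl
  | cons t L ih =>
    simp only [List.flatMap_cons, act_append]
    rw [h t List.mem_cons_self, ih fun s hs => h s (List.mem_cons_of_mem _ hs)]

theorem apply1_smul (a : ℂ) (U : Matrix Bool Bool ℂ) (q : Q) (ψ : (Q → Bool) → ℂ) :
    apply1 U q (a • ψ) = a • apply1 U q ψ := by
  funext c
  simp only [apply1, smul_eq_mul, Pi.smul_apply, Finset.mul_sum]
  exact Finset.sum_congr rfl fun b _ => by ring

theorem apply1_smul_matrix (a : ℂ) (U : Matrix Bool Bool ℂ) (q : Q) (ψ : (Q → Bool) → ℂ) :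
    apply1 (a • U) q ψ = a • apply1 U q ψ := by
  funext c
  simp only [apply1, smul_eq_mul, Pi.smul_apply, Matrix.smul_apply, Finset.mul_sum]
  exact Finset.sum_congr rfl fun b _ => by ring

theorem apply1_one (q : Q) (ψ : (Q → Bool) → ℂ) : apply1 (1 : Matrix Bool Bool ℂ) q ψ = ψ := by
  funext c
  simp [apply1, Matrix.one_apply]

theorem apply1_apply1 (U V : Matrix Bool Bool ℂ) (q : Q) (ψ : (Q → Bool) → ℂ) :
    apply1 U q (apply1 V q ψ) = apply1 (U * V) q ψ := by
  funext c
  simp only [apply1, Finset.mul_sum, Matrix.mul_apply, Finset.sum_mul, Function.update_self,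
    Function.update_idem]
  rw [Finset.sum_comm]
  exact Finset.sum_congr rfl fun b _ => Finset.sum_congr rfl fun b' _ => by ring

theorem project_smul (a : ℂ) (q : Q) (b : Bool) (ψ : (Q → Bool) → ℂ) :
    project q b (a • ψ) = a • project q b ψ := by
  funext c
  simp [project]

end Operators

/-! ## Placing a register in a larger one -/

section Place

variable {I Q : Type} [DecidableEq I] [DecidableEq Q]

/-- The state in which qubit `π i` holds the `i`-th qubit of `ψ`, and all other qubits are `0`. -/
noncomputable def place (π : I → Q) (ψ : (I → Bool) → ℂ) : (Q → Bool) → ℂ :=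
  open Classical in fun c => if ∀ q ∉ Set.range π, c q = false then ψ (c ∘ π) else 0

theorem place_eq {π : I → Q} {c : Q → Bool} {P : Prop} [Decidable P]
    (hP : (∀ q ∉ Set.range π, c q = false) ↔ P) (ψ : (I → Bool) → ℂ) :
    place π ψ c = if P then ψ (c ∘ π) else 0 := by
  unfold place
  by_cases h : P
  · rw [if_pos h, if_pos (hP.2 h)]
  · rw [if_neg h, if_neg (mt hP.1 h)]

theorem place_smul (π : I → Q) (a : ℂ) (ψ : (I → Bool) → ℂ) :
    place π (a • ψ) = a • place π ψ := by
  funext c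
  simp only [place, Pi.smul_apply, smul_eq_mul]
  split <;> simp

theorem place_zero (π : I → Q) : place π (0 : (I → Bool) → ℂ) = 0 := by
  funext c
  simp [place]

theorem update_comp_inj {π : I → Q} (hπ : Function.Injective π) (c : Q → Bool) (i : I) (b : Bool) :
    Function.update c (π i) b ∘ π = Function.update (c ∘ π) i b := by
  funext j
  simp only [Function.comp, Function.update_apply, hπ.eq_iff]

/-- A gate at `π i` changes only values in the range of `π`, so it does not interfere with the
condition that all other qubits are `0`. This is why gates commute with `place`. -/
theorem update_off_range (π : I → Q) (c : Q → Bool) (i : I) (b : Bool) :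
    (∀ q ∉ Set.range π, Function.update c (π i) b q = false) ↔ ∀ q ∉ Set.range π, c q = false := by
  refine forall₂_congr fun q hq => ?_
  have : q ≠ π i := fun h => hq ⟨i, h.symm⟩
  rw [Function.update_of_ne this]

theorem apply1_place {π : I → Q} (hπ : Function.Injective π) (U : Matrix Bool Bool ℂ) (i : I)
    (ψ : (I → Bool) → ℂ) : apply1 U (π i) (place π ψ) = place π (apply1 U i ψ) := by
  classical
  funext c
  simp only [apply1, place_eq (update_off_range π c i _), place_eq (π := π) (c := c) Iff.rfl,
    update_comp_inj hπ]
  split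
  · rfl
  · simp

theorem apply2_place {π : I → Q} (hπ : Function.Injective π) (U : M4) (i j : I)
    (ψ : (I → Bool) → ℂ) : apply2 U (π i) (π j) (place π ψ) = place π (apply2 U i j ψ) := by
  classical
  funext c
  have h : ∀ b b', (∀ q ∉ Set.range π, Function.update (Function.update c (π i) b) (π j) b' q = false) ↔
      ∀ q ∉ Set.range π, c q = false := fun b b' => by rw [update_off_range, update_off_range]
  simp only [apply2, place_eq (h _ _), place_eq (π := π) (c := c) Iff.rfl, update_comp_inj hπ]
  split
  · rfl
  · simp

theorem project_place {π : I → Q} (b : Bool) (i : I)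
    (ψ : (I → Bool) → ℂ) : project (π i) b (place π ψ) = place π (project i b ψ) := by
  funext c
  simp only [project, place, Function.comp]
  split_ifs <;> rfl

/-- The place of a qubit that stays `0` does not matter. -/
theorem place_congr {π π' : I → Q} (hπ : Function.Injective π) (hπ' : Function.Injective π')
    (T : Set I) (hT : ∀ i ∈ T, π i = π' i) (ψ : (I → Bool) → ℂ)
    (hψ : ∀ c, ψ c ≠ 0 → ∀ i ∉ T, c i = false) : place π ψ = place π' ψ := by
  have key : ∀ {π π' : I → Q} (_ : Function.Injective π) (_ : Function.Injective π')
      (_ : ∀ i ∈ T, π i = π' i) (c : Q → Bool), place π ψ c ≠ 0 → place π ψ c = place π' ψ c := by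
    intro π π' hπ hπ' hT c hc
    simp only [place] at hc ⊢
    by_cases h : ∀ q ∉ Set.range π, c q = false
    · rw [if_pos h] at hc ⊢
      have h0 := hψ _ hc
      have h2 : ∀ i, i ∉ T → c (π' i) = false := by
        intro i hi
        by_cases hr : π' i ∈ Set.range π
        · obtain ⟨j, hj⟩ := hr
          by_cases hjT : j ∈ T
          · rw [hT j hjT] at hj
            exact absurd (hπ' hj ▸ hjT) hi
          · rw [← hj]; exact h0 j hjT
        · exact h _ hr
      have h1 : ∀ q ∉ Set.range π', c q = false := by
        intro q hq
        by_cases hr : q ∈ Set.range π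
        · obtain ⟨j, rfl⟩ := hr
          by_cases hjT : j ∈ T
          · exact absurd ⟨j, (hT j hjT).symm⟩ hq
          · exact h0 j hjT
        · exact h _ hr
      rw [if_pos h1]
      congr 1
      funext i
      by_cases hi : i ∈ T
      · simp only [Function.comp, hT i hi]
      · rw [h0 i hi]; exact (h2 i hi).symm
    · rw [if_neg h] at hc; exact absurd rfl hc
  funext c
  by_cases h : place π ψ c = 0
  · by_cases h' : place π' ψ c = 0
    · rw [h, h']
    · exact (key hπ' hπ (fun i hi => (hT i hi).symm) c h').symm
  · exact key hπ hπ' hT c h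

/-! ### Moving one qubit -/

theorem update_injective {π : I → Q} (hπ : Function.Injective π) (i : I) {w : Q}
    (hw : w ∉ Set.range π) : Function.Injective (Function.update π i w) := by
  intro a b h
  simp only [Function.update_apply] at h
  split_ifs at h with h1 h2 h2
  · rw [h1, h2]
  · exact absurd ⟨b, h.symm⟩ hw
  · exact absurd ⟨a, h⟩ hw
  · exact hπ h

theorem not_mem_range_update {π : I → Q} (hπ : Function.Injective π) (i : I) (w q : Q) :
    q ∉ Set.range (Function.update π i w) ↔ q ≠ w ∧ (q = π i ∨ q ∉ Set.range π) := by
  constructor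
  · intro h
    refine ⟨fun hq => h ⟨i, by simp [hq]⟩, ?_⟩
    by_contra hc
    push Not at hc
    obtain ⟨h1, j, rfl⟩ := hc
    have : j ≠ i := fun hji => h1 (hji ▸ rfl)
    exact h ⟨j, by simp [this]⟩
  · rintro ⟨h1, h2⟩ ⟨j, hj⟩
    simp only [Function.update_apply] at hj
    split_ifs at hj with hji
    · exact h1 hj.symm
    · rcases h2 with h2 | h2
      · exact hji (hπ (hj.trans h2))
      · exact h2 ⟨j, hj⟩

/-- The exchange of two qubits. -/
def swapM : M4 := Matrix.of fun i j => if i = j.swap then 1 else 0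

/-- The qubit `w` lies outside the register and so holds `0`; the exchange carries this `0` to `π
i`, which is then outside the new register. -/
theorem swap_place {π : I → Q} (hπ : Function.Injective π) (i : I) {w : Q}
    (hw : w ∉ Set.range π) (ψ : (I → Bool) → ℂ) :
    apply2 swapM (π i) w (place π ψ) = place (Function.update π i w) ψ := by
  have hne : w ≠ π i := fun h => hw ⟨i, h.symm⟩
  funext c
  have e : ∀ b : Bool × Bool, swapM (c (π i), c w) b = if b = (c w, c (π i)) then 1 else 0 := by
    intro b
    simp only [swapM, Matrix.of_apply, Prod.swap, Prod.ext_iff]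
    congr 1
    simp only [eq_iff_iff]
    constructor <;> rintro ⟨h, h'⟩ <;> exact ⟨h'.symm, h.symm⟩
  simp only [apply2, e, ite_mul, one_mul, zero_mul, Finset.sum_ite_eq', Finset.mem_univ, if_true]
  set c' := Function.update (Function.update c (π i) (c w)) w (c (π i)) with hc'
  have h1 : c' ∘ π = c ∘ Function.update π i w := by
    funext j
    simp only [Function.comp, hc']
    have hj : π j ≠ w := fun h => hw ⟨j, h⟩
    by_cases hji : j = i
    · subst hji; simp [hj]
    · have : π j ≠ π i := fun h => hji (hπ h)
      simp [hj, hji, this]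
  have h2 : (∀ q ∉ Set.range π, c' q = false) ↔
      ∀ q ∉ Set.range (Function.update π i w), c q = false := by
    simp only [not_mem_range_update hπ]
    constructor
    · rintro h q ⟨h1, h2 | h2⟩
      · have := h w hw
        rw [h2]; simpa [hc'] using this
      · have := h q h2
        have h3 : q ≠ π i := fun h => h2 ⟨i, h.symm⟩
        simpa [hc', h1, h3] using this
    · intro h q hq
      have h3 : q ≠ π i := fun h => hq ⟨i, h.symm⟩
      by_cases hqw : q = w
      · rw [hqw]; simpa [hc'] using h (π i) ⟨hne.symm, Or.inl rfl⟩
      · simpa [hc', h3, hqw] using h q ⟨hqw, Or.inr hq⟩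
  classical
  rw [place_eq h2, h1, place_eq Iff.rfl]

/-! ### Bell pairs and a single teleportation hop. -/

/-- The sign `(-1)^b`. -/
def sgn (b : Bool) : ℂ := if b then -1 else 1

theorem norm_sgn (b : Bool) : ‖sgn b‖ = 1 := by cases b <;> simp [sgn]

/-- The unitary that prepares the Bell basis. -/
noncomputable def bellM : M4 :=
  Matrix.of fun i j => if i.2 = (i.1 ^^ j.2) then ((√2 : ℝ) : ℂ)⁻¹ * sgn (i.1 && j.1) else 0

/-- The Bell measurement with outcome `(z, x)`, followed by a reset of both qubits. -/
noncomputable def bellProj (z x : Bool) : M4 :=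
  Matrix.of fun i j => if i = (false, false) ∧ j.2 = (j.1 ^^ x) then
    ((√2 : ℝ) : ℂ)⁻¹ * sgn (j.1 && z) else 0

/-- The Pauli operator `X^x Z^z`. -/
def pauli (x z : Bool) : Matrix Bool Bool ℂ :=
  Matrix.of fun i j => if i = (j ^^ x) then sgn (j && z) else 0

theorem sqrt_two_inv_sq : ((√2 : ℝ) : ℂ)⁻¹ * ((√2 : ℝ) : ℂ)⁻¹ = 1 / 2 := by
  rw [← mul_inv, ← Complex.ofReal_mul, Real.mul_self_sqrt (by norm_num)]
  norm_num

/-- Teleportation as an identity between unnormalised states, where `v` and `w` initially hold `0`.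
The scalar `1 / 2` consists of one factor `1 / √2` from the preparation and one from the projection;
it depends neither on the outcome nor on the state. Since `bellProj` includes the reset, the two
vacated qubits hold `0` again and the result is again of the form `place`. -/
theorem hop_place {π : I → Q} (hπ : Function.Injective π) (i : I) {v w : Q}
    (hv : v ∉ Set.range π) (hw : w ∉ Set.range π) (hvw : v ≠ w) (z x : Bool)
    (ψ : (I → Bool) → ℂ) :
    apply2 (bellProj z x) (π i) v (apply2 bellM v w (place π ψ)) =
      (1 / 2 : ℂ) • place (Function.update π i w) (apply1 (pauli x z) i ψ) := by
  have huv : π i ≠ v := fun h => hv ⟨i, h⟩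
  have huw : π i ≠ w := fun h => hw ⟨i, h⟩
  classical
  funext c
  -- the only configurations that contribute have `0` on `v` and `w`
  have key : ∀ b1 b2 b3 b4 : Bool,
      place π ψ (Function.update (Function.update (Function.update (Function.update c (π i) b1) v b2)
        v b3) w b4) = if b3 = false ∧ b4 = false ∧
          (∀ q ∉ Set.range π, q ≠ v → q ≠ w → c q = false) then
            ψ (Function.update (c ∘ Function.update π i w) i b1) else 0 := by
    intro b1 b2 b3 b4
    rw [Function.update_idem]
    set c' := Function.update (Function.update (Function.update c (π i) b1) v b3) w b4 with hc'
    have h1 : c' ∘ π = Function.update (c ∘ Function.update π i w) i b1 := by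
      funext j
      have hj : π j ≠ w := fun h => hw ⟨j, h⟩
      have hj' : π j ≠ v := fun h => hv ⟨j, h⟩
      by_cases hji : j = i
      · subst hji; simp [hc', hj, hj']
      · have : π j ≠ π i := fun h => hji (hπ h)
        simp [hc', hj, hj', hji, this]
    have h2 : (∀ q ∉ Set.range π, c' q = false) ↔ b3 = false ∧ b4 = false ∧
        (∀ q ∉ Set.range π, q ≠ v → q ≠ w → c q = false) := by
      constructor
      · intro h
        refine ⟨by simpa [hc', hvw] using h v hv, by simpa [hc'] using h w hw, fun q hq h3 h4 => ?_⟩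
        have h5 : q ≠ π i := fun h => hq ⟨i, h.symm⟩
        simpa [hc', h3, h4, h5] using h q hq
      · rintro ⟨h3, h4, h5⟩ q hq
        have h6 : q ≠ π i := fun h => hq ⟨i, h.symm⟩
        by_cases hqw : q = w
        · simp [hc', hqw, h4]
        · by_cases hqv : q = v
          · simp [hc', hqv, hvw, h3]
          · simpa [hc', hqw, hqv, h6] using h5 q hq hqv hqw
    rw [place_eq h2, h1]
  have hR : (∀ q ∉ Set.range (Function.update π i w), c q = false) ↔
      c (π i) = false ∧ c v = false ∧ (∀ q ∉ Set.range π, q ≠ v → q ≠ w → c q = false) := by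
    simp only [not_mem_range_update hπ]
    constructor
    · intro h
      exact ⟨h _ ⟨huw, Or.inl rfl⟩, h _ ⟨hvw, Or.inr hv⟩, fun q hq _ h4 => h q ⟨h4, Or.inr hq⟩⟩
    · rintro ⟨h1, h2, h3⟩ q ⟨h4, h5 | h5⟩
      · rw [h5, h1]
      · by_cases hqv : q = v
        · rw [hqv, h2]
        · exact h3 q h5 hqv h4
  simp only [Pi.smul_apply, smul_eq_mul]
  rw [place_eq hR]
  simp only [apply2, key]
  simp only [apply1, Function.comp_apply, Function.update_self, Fintype.sum_prod_type,
    Fintype.sum_bool, bellProj, bellM, pauli, Matrix.of_apply, Function.update_of_ne huv,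
    Function.update_of_ne huv.symm, Function.update_of_ne hvw.symm, Function.update_of_ne huw.symm]
  have hs := sqrt_two_inv_sq
  set r := ((√2 : ℝ) : ℂ)⁻¹
  have hs' : ∀ t : ℂ, r * (r * t) = 1 / 2 * t := fun t => by rw [← mul_assoc, hs]
  by_cases hA : ∀ q ∉ Set.range π, q ≠ v → q ≠ w → c q = false
  -- What is left are the values of `c` at the three qubits and the two outcome bits, 32 cases in
  -- which the two factors `1 / √2` combine to `1 / 2`.
  · cases h1 : c (π i) <;> cases h2 : c v <;> cases h3 : c w <;> cases x <;> cases z <;>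
      simp [sgn, hs', hA]
  · simp only [hA, and_false, if_false, mul_zero, add_zero, ite_self]

end Place

end QArch

namespace QArch
set_option linter.unusedSectionVars false
set_option linter.unusedSimpArgs false

/-! ## Teleportation along paths -/

/-- The sign comes from `Z X = - X Z`. It is a global phase and will be absorbed into scalars. -/
theorem pauli_mul_pauli (x z x' z' : Bool) :
    pauli x z * pauli x' z' = sgn (z && x') • pauli (x ^^ x') (z ^^ z') := by
  ext i j
  simp only [Matrix.mul_apply, pauli, Matrix.of_apply, Fintype.sum_bool, Matrix.smul_apply, smul_eq_mul]
  cases x <;> cases z <;> cases x' <;> cases z' <;> cases i <;> cases j <;> simp [sgn]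

theorem pauli_false : pauli false false = 1 := by
  ext i j
  simp only [pauli, Matrix.of_apply, Matrix.one_apply]
  cases i <;> cases j <;> simp [sgn]

/-- Exclusive or of the values of `f` on a list. -/
def xorOn {T : Type} (f : T → Bool) (L : List T) : Bool := L.foldr (fun t b => f t ^^ b) false

section Paths

variable {I Q : Type} [DecidableEq I] [DecidableEq Q]

/-- The hops `(u, v, w)` of `P` lead from `a` to `e`. -/
def IsPath (a : Q) : List (Q × Q × Q) → Q → Prop
  | [], e => a = e
  | h :: P, e => h.1 = a ∧ IsPath h.2.2 P e

/-- The qubits of a path other than its start. -/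
def cells (P : List (Q × Q × Q)) : List Q := P.flatMap fun h => [h.2.1, h.2.2]

/-- The path traversed backwards. -/
def revPath (P : List (Q × Q × Q)) : List (Q × Q × Q) :=
  (P.map fun h => (h.2.2, h.2.1, h.1)).reverse

@[simp] theorem cells_cons (h : Q × Q × Q) (P : List (Q × Q × Q)) :
    cells (h :: P) = h.2.1 :: h.2.2 :: cells P := rfl

theorem IsPath.end_mem {a e : Q} {P : List (Q × Q × Q)} (h : IsPath a P e) : e ∈ a :: cells P := by
  induction P generalizing a with
  | nil => simp [show a = e from h]
  | cons t P ih =>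
    have := ih h.2
    simp only [cells_cons, List.mem_cons] at this ⊢
    tauto

theorem IsPath.append_hop {a e : Q} {P : List (Q × Q × Q)} (h : IsPath a P e) (v w : Q) :
    IsPath a (P ++ [(e, v, w)]) w := by
  induction P generalizing a with
  | nil => exact ⟨(show a = e from h).symm, rfl⟩
  | cons t P ih => exact ⟨h.1, ih h.2⟩

theorem IsPath.rev {a e : Q} {P : List (Q × Q × Q)} (h : IsPath a P e) : IsPath e (revPath P) a := by
  induction P generalizing a with
  | nil => exact (show a = e from h).symm
  | cons t P ih =>
    obtain ⟨rfl, h⟩ := h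
    simpa [revPath] using (ih h).append_hop t.2.1 t.1

theorem IsPath.cells_rev {a e : Q} {P : List (Q × Q × Q)} (h : IsPath a P e) :
    (e :: cells (revPath P)).Perm (a :: cells P) := by
  induction P generalizing a with
  | nil => rw [show a = e from h]; exact List.Perm.refl _
  | cons t P ih =>
    obtain ⟨rfl, h⟩ := h
    have h1 : cells (revPath (t :: P)) = cells (revPath P) ++ [t.2.1, t.1] := by
      simp [revPath, cells]
    rw [h1, cells_cons, ← List.cons_append]
    refine ((ih h).append_right _).trans ?_
    refine List.perm_append_comm.trans ?_
    exact List.Perm.swap _ _ _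

/-- Bell preparation and Bell measurement, hop by hop, with measurement outcomes `β`. -/
noncomputable def pathOps (β : Q → Bool) (P : List (Q × Q × Q)) : List (M4 × Q × Q) :=
  P.flatMap fun h => [(bellM, h.2.1, h.2.2), (bellProj (β h.1) (β h.2.1), h.1, h.2.1)]

/-- Errors are not corrected hop by hop: the Pauli operator left by the first hop is carried along,
and products of Pauli operators multiply by adding exponents, up to sign. Only two parities of
outcomes matter at the end, so no hop has to wait for another. Outcomes can be given as a function
of the qubit because no qubit of the path is measured twice. -/
theorem pathOps_place (β : Q → Bool) (P : List (Q × Q × Q)) (i : I) (e : Q) : ∀ (π : I → Q)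
    (_ : Function.Injective π) (_ : IsPath (π i) P e) (_ : (π i :: cells P).Nodup)
    (_ : ∀ q ∈ cells P, q ∉ Set.range π),
    ∃ s : ℂ, ‖s‖ = (1 / 2) ^ P.length ∧ ∀ φ : (I → Bool) → ℂ, act (pathOps β P) (place π φ) =
      s • place (Function.update π i e) (apply1 (pauli (xorOn (fun h => β h.2.1) P)
        (xorOn (fun h => β h.1) P)) i φ) := by
  induction P with
  | nil =>
    intro π _ hP _ _
    refine ⟨1, by simp, fun φ => ?_⟩
    have : Function.update π i e = π := by rw [← (show π i = e from hP), Function.update_eq_self]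
    simp [pathOps, xorOn, this, pauli_false, apply1_one]
  | cons h P ih =>
    rintro π hπ ⟨h1, h2⟩ hnd hfr
    obtain ⟨u, v, w⟩ := h
    dsimp only at h1 h2
    simp only [cells_cons, List.nodup_cons, List.mem_cons, not_or] at hnd hfr
    have hv := hfr v (Or.inl rfl)
    have hw := hfr w (Or.inr (Or.inl rfl))
    obtain ⟨s, hs, ih⟩ := ih (Function.update π i w) (update_injective hπ i hw) (by simpa using h2)
      (by simpa using hnd.2.2) (fun q hq => (not_mem_range_update hπ i w q).2
        ⟨fun hqw => hnd.2.2.1 (hqw ▸ hq), Or.inr (hfr q (Or.inr (Or.inr hq)))⟩)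
    refine ⟨1 / 2 * s * sgn (xorOn (fun h => β h.1) P && β v), ?_, fun φ => ?_⟩
    · rw [norm_mul, norm_sgn, norm_mul, hs, List.length_cons, pow_succ]; norm_num; ring
    · rw [pathOps, List.flatMap_cons, act_append]
      simp only [act_cons, act_nil]
      rw [h1, hop_place hπ i hv hw hnd.2.1.1, act_smul]
      rw [show (P.flatMap fun h => [(bellM, h.2.1, h.2.2), (bellProj (β h.1) (β h.2.1), h.1, h.2.1)])
        = pathOps β P from rfl, ih, Function.update_idem, apply1_apply1, pauli_mul_pauli,
        apply1_smul_matrix, place_smul, smul_smul, smul_smul]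
      simp only [xorOn, List.foldr_cons, ← h1, Bool.xor_comm]

/-- The bit flip and the phase flip on the first qubit of a pair. -/
noncomputable def xM : M4 := pauli true false ⊗ₖ (1 : Matrix Bool Bool ℂ)

noncomputable def zM : M4 := pauli false true ⊗ₖ (1 : Matrix Bool Bool ℂ)

noncomputable def condM (b : Bool) (U : M4) : M4 := if b then U else 1

theorem condM_xM (b : Bool) : condM b xM = pauli b false ⊗ₖ (1 : Matrix Bool Bool ℂ) := by
  cases b
  · simp [condM, pauli_false]
  · rfl

theorem condM_zM (b : Bool) : condM b zM = pauli false b ⊗ₖ (1 : Matrix Bool Bool ℂ) := by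
  cases b
  · simp [condM, pauli_false]
  · rfl

/-- The last hop of a nonempty path, as an edge from the end to its predecessor. -/
def lastEdge (P : List (Q × Q × Q)) : List (Q × Q) := P.getLast?.toList.map fun h => (h.2.2, h.2.1)

/-- Corrections are one-qubit operations, but the available words of gates act on pairs of
neighbours; the predecessor `v` of the end serves as the idle partner. -/
theorem lastEdge_of_isPath {a e : Q} {P : List (Q × Q × Q)} (h : IsPath a P e) (hP : P ≠ [])
    (hnd : (a :: cells P).Nodup) :
    ∃ v, lastEdge P = [(e, v)] ∧ e ≠ v ∧ v ∈ cells P ∧ e ∈ cells P := by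
  induction P generalizing a with
  | nil => exact absurd rfl hP
  | cons t P ih =>
    obtain ⟨rfl, h⟩ := h
    by_cases hP' : P = []
    · subst hP'
      simp only [cells_cons, List.nodup_cons, List.mem_cons, not_or] at hnd
      refine ⟨t.2.1, ?_, ?_, ?_, ?_⟩
      · rw [← show t.2.2 = e from h]; rfl
      · rw [← show t.2.2 = e from h]; exact Ne.symm hnd.2.1.1
      · simp
      · simp [← show t.2.2 = e from h]
    · have hnd' : (t.2.2 :: cells P).Nodup := (List.nodup_cons.1 (List.nodup_cons.1 hnd).2).2
      obtain ⟨v, h1, h2, h3, h4⟩ := ih h hP' hnd'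
      refine ⟨v, ?_, h2, by simp [h3], by simp [h4]⟩
      rw [← h1]
      unfold lastEdge
      obtain ⟨x, P', rfl⟩ := List.exists_cons_of_ne_nil hP'
      rw [List.getLast?_cons_cons]

/-- The two Pauli corrections at the end of a path. -/
noncomputable def corrX (β : Q → Bool) (P : List (Q × Q × Q)) : List (M4 × Q × Q) :=
  (lastEdge P).map fun e => (condM (xorOn (fun h => β h.2.1) P) xM, e)

noncomputable def corrZ (β : Q → Bool) (P : List (Q × Q × Q)) : List (M4 × Q × Q) :=
  (lastEdge P).map fun e => (condM (xorOn (fun h => β h.1) P) zM, e)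

/-- Applying `X^x` and then `Z^z` is the exact inverse of the error `X^x Z^z`, without a sign. On
the empty path both parities are false and there is nothing to correct. -/
theorem path_place (β : Q → Bool) (P : List (Q × Q × Q)) (i : I) (e : Q) (π : I → Q)
    (hπ : Function.Injective π) (hP : IsPath (π i) P e) (hnd : (π i :: cells P).Nodup)
    (hfr : ∀ q ∈ cells P, q ∉ Set.range π) :
    ∃ s : ℂ, ‖s‖ = (1 / 2) ^ P.length ∧ ∀ φ : (I → Bool) → ℂ,
      act (pathOps β P ++ (corrX β P ++ corrZ β P)) (place π φ) =
        s • place (Function.update π i e) φ := by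
  obtain ⟨s, hs, h⟩ := pathOps_place β P i e π hπ hP hnd hfr
  refine ⟨s, hs, fun φ => ?_⟩
  rw [act_append, h, act_smul]
  congr 1
  by_cases hP0 : P = []
  · subst hP0
    simp [corrX, corrZ, lastEdge, xorOn, pauli_false, apply1_one]
  · obtain ⟨v, h1, h2, h3, h4⟩ := lastEdge_of_isPath hP hP0 hnd
    have hinj := update_injective hπ i (hfr e h4)
    simp only [corrX, corrZ, h1, List.map_cons, List.map_nil, List.singleton_append, act_cons, act_nil]
    rw [condM_xM, condM_zM, ← apply1_eq_apply2_left _ h2, ← apply1_eq_apply2_left _ h2]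
    have he : Function.update π i e i = e := by simp
    generalize Function.update π i e = π₁ at hinj he ⊢
    rw [← he, apply1_place hinj, apply1_place hinj, apply1_apply1, apply1_apply1]
    have h5 : ∀ x z : Bool, pauli false z * pauli x false * pauli x z = 1 := by
      intro x z
      rw [mul_assoc, pauli_mul_pauli, Matrix.mul_smul, pauli_mul_pauli, smul_smul]
      simp [pauli_false, sgn]
    rw [h5, apply1_one]

/-- The paths `L` move qubit `i` from `π i` to `π' i`, without meeting each other. -/
structure Routes (π π' : I → Q) (L : List (I × List (Q × Q × Q))) : Prop where
  keys : (L.map Prod.fst).Nodup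
  path : ∀ t ∈ L, IsPath (π t.1) t.2 (π' t.1)
  fix : ∀ i ∉ L.map Prod.fst, π i = π' i
  nodup : ∀ t ∈ L, (π t.1 :: cells t.2).Nodup
  fresh : ∀ t ∈ L, ∀ q ∈ cells t.2, q ∉ Set.range π
  disj : L.Pairwise fun s t => (π s.1 :: cells s.2).Disjoint (π t.1 :: cells t.2)

/-- The paths are traversed one at a time. Disjointness guarantees that after one qubit has moved,
the remaining paths still satisfy the conditions for the updated places, and the scalars of the
paths multiply. Injectivity of the final placement comes out of the same induction. -/
theorem Routes.place (β : Q → Bool) (L : List (I × List (Q × Q × Q))) (π' : I → Q) : ∀ (π : I → Q)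
    (_ : Function.Injective π) (_ : Routes π π' L), Function.Injective π' ∧
    ∃ s : ℂ, ‖s‖ = (1 / 2) ^ (L.map fun t => t.2.length).sum ∧ ∀ φ : (I → Bool) → ℂ,
      act (L.flatMap fun t => pathOps β t.2 ++ (corrX β t.2 ++ corrZ β t.2)) (place π φ) =
        s • place π' φ := by
  induction L with
  | nil =>
    intro π hπ h
    have : π = π' := funext fun i => h.fix i (by simp)
    subst this
    exact ⟨hπ, 1, by simp, fun φ => by simp⟩
  | cons t L ih =>
    intro π hπ h
    have hk := List.nodup_cons.1 (by simpa using h.keys : (t.1 :: L.map Prod.fst).Nodup)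
    have hd := List.pairwise_cons.1 h.disj
    have ht := List.mem_cons_self (a := t) (l := L)
    have hfresh := h.fresh t ht
    obtain ⟨s, hs, h1⟩ := path_place β t.2 t.1 _ π hπ (h.path t ht) (h.nodup t ht) hfresh
    have hne : ∀ t' ∈ L, t'.1 ≠ t.1 := fun t' ht' he =>
      hk.1 (he ▸ List.mem_map_of_mem ht')
    have hup : ∀ t' ∈ L, Function.update π t.1 (π' t.1) t'.1 = π t'.1 := fun t' ht' => by
      simp [hne t' ht']
    have hinj : Function.Injective (Function.update π t.1 (π' t.1)) := by
      rcases List.mem_cons.1 (h.path t ht).end_mem with he | he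
      · rw [he, Function.update_eq_self]; exact hπ
      · exact update_injective hπ _ (hfresh _ he)
    have hr : Routes (Function.update π t.1 (π' t.1)) π' L := by
      refine ⟨hk.2, fun t' ht' => ?_, fun i hi => ?_, fun t' ht' => ?_, fun t' ht' q hq => ?_, ?_⟩
      · rw [hup t' ht']; exact h.path t' (List.mem_cons_of_mem _ ht')
      · by_cases hit : i = t.1
        · simp [hit]
        · rw [Function.update_of_ne hit]
          exact h.fix i (by simpa [hit] using hi)
      · rw [hup t' ht']; exact h.nodup t' (List.mem_cons_of_mem _ ht')
      · rw [not_mem_range_update hπ]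
        refine ⟨fun hqe => ?_, Or.inr (h.fresh t' (List.mem_cons_of_mem _ ht') q hq)⟩
        exact hd.1 t' ht' (h.path t ht).end_mem (hqe ▸ List.mem_cons_of_mem _ hq)
      · refine List.Pairwise.imp_of_mem ?_ hd.2
        intro a b ha hb hab
        rw [hup a ha, hup b hb]; exact hab
    obtain ⟨hinj', s', hs', ih⟩ := ih _ hinj hr
    refine ⟨hinj', s * s', by rw [norm_mul, hs, hs', List.map_cons, List.sum_cons, pow_add], fun φ => ?_⟩
    rw [List.flatMap_cons, act_append, h1, act_smul, ih, smul_smul]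

/-- After the motion a track contains no register qubit except the one at its end: other moved
qubits end on disjoint tracks, and resting qubits were avoided from the start. So every track is
free for the way back. -/
theorem Routes.rev {π π' : I → Q} {L : List (I × List (Q × Q × Q))} (hπ : Function.Injective π)
    (h : Routes π π' L) : Routes π' π (L.map fun t => (t.1, revPath t.2)) := by
  have hp : ∀ t ∈ L, (π' t.1 :: cells (revPath t.2)).Perm (π t.1 :: cells t.2) :=
    fun t ht => (h.path t ht).cells_rev
  have hkeys : (L.map fun t => (t.1, revPath t.2)).map Prod.fst = L.map Prod.fst := by
    simp [Function.comp_def]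
  have hdis : ∀ t ∈ L, ∀ s ∈ L, s.1 ≠ t.1 → (π s.1 :: cells s.2).Disjoint (π t.1 :: cells t.2) := by
    have hsym : Std.Symm fun s t : I × List (Q × Q × Q) =>
        s.1 ≠ t.1 → (π s.1 :: cells s.2).Disjoint (π t.1 :: cells t.2) :=
      ⟨fun s t hst hne => (hst hne.symm).symm⟩
    intro t ht s hs
    exact List.Pairwise.forall_of_forall (R := fun s t : I × List (Q × Q × Q) =>
        s.1 ≠ t.1 → (π s.1 :: cells s.2).Disjoint (π t.1 :: cells t.2)) (fun a _ hne => absurd rfl hne) (h.disj.imp (S := fun s t : I × List (Q × Q × Q) =>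
        s.1 ≠ t.1 → (π s.1 :: cells s.2).Disjoint (π t.1 :: cells t.2)) fun hst _ => hst) hs ht
  refine ⟨by rw [hkeys]; exact h.keys, ?_, ?_, ?_, ?_, ?_⟩
  · intro t' ht'
    obtain ⟨t, ht, rfl⟩ := List.mem_map.1 ht'
    exact (h.path t ht).rev
  · intro i hi
    rw [hkeys] at hi
    exact (h.fix i hi).symm
  · intro t' ht'
    obtain ⟨t, ht, rfl⟩ := List.mem_map.1 ht'
    exact (hp t ht).nodup_iff.2 (h.nodup t ht)
  · intro t' ht' q hq
    obtain ⟨t, ht, rfl⟩ := List.mem_map.1 ht'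
    have hq1 : q ∈ π t.1 :: cells t.2 := (hp t ht).mem_iff.1 (List.mem_cons_of_mem _ hq)
    have hq2 : q ≠ π' t.1 := by
      rintro rfl
      exact (List.nodup_cons.1 ((hp t ht).nodup_iff.2 (h.nodup t ht))).1 hq
    rintro ⟨j, rfl⟩
    by_cases hj : j ∈ L.map Prod.fst
    · obtain ⟨s, hs, rfl⟩ := List.mem_map.1 hj
      have hne : s.1 ≠ t.1 := fun he => hq2 (by rw [he])
      exact hdis t ht s hs hne (h.path s hs).end_mem hq1
    · rw [← h.fix j hj] at hq1
      rcases List.mem_cons.1 hq1 with he | he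
      · exact hj (hπ he ▸ List.mem_map_of_mem ht)
      · exact h.fresh t ht _ he ⟨j, rfl⟩
  · rw [List.pairwise_map]
    refine List.Pairwise.imp_of_mem ?_ h.disj
    intro a b ha hb hab q h1 h2
    exact hab ((hp a ha).mem_iff.1 h1) ((hp b hb).mem_iff.1 h2)

/-! ### The same operations in layers -/

/-- `edges1` lists the pairs on which Bell states are prepared, `edges2` the pairs measured in the
Bell basis. On a path without repetitions the pairs of each list are disjoint, so each list can be
treated as one layer. -/
def edges1 (P : List (Q × Q × Q)) : List (Q × Q) := P.map fun h => (h.2.1, h.2.2)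

def edges2 (P : List (Q × Q × Q)) : List (Q × Q) := P.map fun h => (h.1, h.2.1)

/-- The operations of a hop between Bell preparation and final correction. -/
noncomputable def hopMeas (β : Q → Bool) (e : Q × Q) : List (M4 × Q × Q) :=
  [(bellM.conjTranspose, e), (proj1 (β e.1) ⊗ₖ proj1 (β e.2), e), (condM (β e.1) xM, e),
    (condM (β e.2) xM, e.2, e.1)]

/-- A Bell measurement with reset is obtained by undoing the Bell preparation, measuring both
qubits, and flipping those that showed `1`. -/
theorem hopMeas_act (β : Q → Bool) {u v : Q} (h : u ≠ v) (ψ : (Q → Bool) → ℂ) :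
    act (hopMeas β (u, v)) ψ = apply2 (bellProj (β u) (β v)) u v ψ := by
  simp only [hopMeas, act_cons, act_nil]
  rw [apply2_swap _ h, apply2_apply2 _ _ h, apply2_apply2 _ _ h, apply2_apply2 _ _ h]
  congr 1
  generalize β u = z
  generalize β v = x
  rw [condM_xM, condM_xM]
  ext ⟨i, i'⟩ ⟨j, j'⟩
  simp only [Matrix.mul_apply, Fintype.sum_prod_type, Fintype.sum_bool, bellM, bellProj, pauli, proj1,
    Matrix.conjTranspose_apply, Matrix.of_apply, Matrix.kroneckerMap_apply, Matrix.submatrix_apply,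
    Matrix.one_apply, Prod.swap, star_mul', RCLike.star_def, map_inv₀, Complex.conj_ofReal]
  cases z <;> cases x <;> cases i <;> cases i' <;> cases j <;> cases j' <;>
    simp [sgn]

/-- All operations of a transport along the paths `L`, in layers. -/
noncomputable def transportOps (β : Q → Bool) (L : List (I × List (Q × Q × Q))) :
    List (M4 × Q × Q) :=
  ((L.flatMap fun t => edges1 t.2).map fun e => (bellM, e)) ++
  (((L.flatMap fun t => edges2 t.2).map fun e => (bellM.conjTranspose, e)) ++
  (((L.flatMap fun t => edges2 t.2).map fun e => (proj1 (β e.1) ⊗ₖ proj1 (β e.2), e)) ++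
  (((L.flatMap fun t => edges2 t.2).map fun e => (condM (β e.1) xM, e)) ++
  (((L.flatMap fun t => edges2 t.2).map fun e => (condM (β e.2) xM, e.2, e.1)) ++
  ((L.flatMap fun t => corrX β t.2) ++ (L.flatMap fun t => corrZ β t.2))))))

theorem edges2_cells {a e : Q} {P : List (Q × Q × Q)} (h : IsPath a P e) :
    (P.flatMap fun h => [h.1, h.2.1]) ++ [e] = a :: cells P := by
  induction P generalizing a with
  | nil => simp [cells, show a = e from h]
  | cons t P ih =>
    obtain ⟨rfl, h⟩ := h
    rw [List.flatMap_cons, List.append_assoc, ih h]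
    rfl

/-- The qubits measured in one hop are not touched by the Bell preparations of later hops. Hence all
preparations may be moved to the front, which is what makes the depth independent of the length of
the path. -/
theorem hops_pairwise {a e : Q} {P : List (Q × Q × Q)} (h : IsPath a P e)
    (hnd : (a :: cells P).Nodup) :
    P.Pairwise fun s t => ([s.1, s.2.1] : List Q).Disjoint [t.2.1, t.2.2] := by
  induction P generalizing a with
  | nil => exact List.Pairwise.nil
  | cons s P ih =>
    obtain ⟨rfl, h⟩ := h
    simp only [cells_cons] at hnd
    refine List.pairwise_cons.2 ⟨fun t ht q hq hq' => ?_,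
      ih h (List.nodup_cons.1 (List.nodup_cons.1 hnd).2).2⟩
    have hc : q ∈ cells P := List.mem_flatMap.2 ⟨t, ht, hq'⟩
    simp only [List.mem_cons, List.not_mem_nil, or_false] at hq
    rcases hq with rfl | rfl
    · exact (List.nodup_cons.1 hnd).1 (by simp [hc])
    · exact (List.nodup_cons.1 (List.nodup_cons.1 hnd).2).1 (by simp [hc])

theorem edges2_nodup {a e : Q} {P : List (Q × Q × Q)} (h : IsPath a P e)
    (hnd : (a :: cells P).Nodup) : ((edges2 P).flatMap fun e => [e.1, e.2]).Nodup := by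
  rw [← edges2_cells h] at hnd
  have : (edges2 P).flatMap (fun e => [e.1, e.2]) = P.flatMap fun h => [h.1, h.2.1] := by
    simp [edges2, List.flatMap_map]
  rw [this]
  exact (List.nodup_append.1 hnd).1

/-- The layered order is the one that is executed, the order path by path is the one that is
understood. They are exchanged by repeated use of `act_flatMap_append`: inside a path the pairs of a
layer are disjoint, and different paths have disjoint supports. -/
theorem act_transportOps (β : Q → Bool) {π π' : I → Q} {L : List (I × List (Q × Q × Q))}
    (h : Routes π π' L) (ψ : (Q → Bool) → ℂ) :
    act (transportOps β L) ψ =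
      act (L.flatMap fun t => pathOps β t.2 ++ (corrX β t.2 ++ corrZ β t.2)) ψ := by
  -- regroup the operations of a single path
  have hsub1 : ∀ t : I × List (Q × Q × Q), ∀ q ∈ supp ((edges1 t.2).map fun e => (bellM, e)),
      q ∈ π t.1 :: cells t.2 := by
    intro t q hq
    simp only [supp, edges1, List.map_map, List.flatMap_map, Function.comp_def] at hq
    exact List.mem_cons_of_mem _ hq
  have hsub2 : ∀ t ∈ L, ∀ e ∈ edges2 t.2, e.1 ∈ π t.1 :: cells t.2 ∧ e.2 ∈ π t.1 :: cells t.2 := by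
    intro t ht e he
    have := edges2_cells (h.path t ht)
    obtain ⟨hp, hm, rfl⟩ := List.mem_map.1 he
    rw [← this]
    refine ⟨List.mem_append_left _ (List.mem_flatMap.2 ⟨hp, hm, by simp⟩),
      List.mem_append_left _ (List.mem_flatMap.2 ⟨hp, hm, by simp⟩)⟩
  have hsubX : ∀ t ∈ L, ∀ e ∈ lastEdge t.2, e.1 ∈ π t.1 :: cells t.2 ∧ e.2 ∈ π t.1 :: cells t.2 := by
    intro t ht e he
    obtain ⟨hp, hm, rfl⟩ := List.mem_map.1 he
    have hm' := List.mem_of_mem_getLast? (Option.mem_toList.1 hm)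
    exact ⟨List.mem_cons_of_mem _ (List.mem_flatMap.2 ⟨hp, hm', by simp⟩),
      List.mem_cons_of_mem _ (List.mem_flatMap.2 ⟨hp, hm', by simp⟩)⟩
  let f1 : I × List (Q × Q × Q) → List (M4 × Q × Q) := fun t => (edges1 t.2).map fun e => (bellM, e)
  let g1 : I × List (Q × Q × Q) → List (M4 × Q × Q) :=
    fun t => (edges2 t.2).map fun e => (bellM.conjTranspose, e)
  let g2 : I × List (Q × Q × Q) → List (M4 × Q × Q) :=
    fun t => (edges2 t.2).map fun e => (proj1 (β e.1) ⊗ₖ proj1 (β e.2), e)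
  let g3 : I × List (Q × Q × Q) → List (M4 × Q × Q) :=
    fun t => (edges2 t.2).map fun e => (condM (β e.1) xM, e)
  let g4 : I × List (Q × Q × Q) → List (M4 × Q × Q) :=
    fun t => (edges2 t.2).map fun e => (condM (β e.2) xM, e.2, e.1)
  have hin : ∀ t ∈ L, ∀ q, (q ∈ supp (f1 t) ∨ q ∈ supp (g1 t) ∨ q ∈ supp (g2 t) ∨ q ∈ supp (g3 t) ∨
      q ∈ supp (g4 t) ∨ q ∈ supp (corrX β t.2) ∨ q ∈ supp (corrZ β t.2)) → q ∈ π t.1 :: cells t.2 := by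
    intro t ht q hq
    have key2 : ∀ q, (∃ e ∈ edges2 t.2, q = e.1 ∨ q = e.2) → q ∈ π t.1 :: cells t.2 := by
      rintro q ⟨e, he, rfl | rfl⟩
      · exact (hsub2 t ht e he).1
      · exact (hsub2 t ht e he).2
    have keyX : ∀ q, (∃ e ∈ lastEdge t.2, q = e.1 ∨ q = e.2) → q ∈ π t.1 :: cells t.2 := by
      rintro q ⟨e, he, rfl | rfl⟩
      · exact (hsubX t ht e he).1
      · exact (hsubX t ht e he).2
    rcases hq with hq | hq | hq | hq | hq | hq | hq
    · exact hsub1 t q hq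
    all_goals
      simp only [supp, g1, g2, g3, g4, corrX, corrZ, List.flatMap_map, List.mem_flatMap, List.mem_cons,
        List.not_mem_nil, or_false] at hq
    · exact key2 q hq
    · exact key2 q hq
    · exact key2 q hq
    · obtain ⟨e, he, hq⟩ := hq
      exact key2 q ⟨e, he, hq.symm⟩
    · exact keyX q hq
    · exact keyX q hq
  have hpath : ∀ t ∈ L, ∀ ψ, act (pathOps β t.2 ++ (corrX β t.2 ++ corrZ β t.2)) ψ =
      act (f1 t ++ (g1 t ++ (g2 t ++ (g3 t ++ (g4 t ++ (corrX β t.2 ++ corrZ β t.2)))))) ψ := by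
    intro t ht ψ
    have hnd := h.nodup t ht
    have hpw := hops_pairwise (h.path t ht) hnd
    have e2 := edges2_nodup (h.path t ht) hnd
    have hne : ∀ e ∈ edges2 t.2, e.1 ≠ e.2 := by
      intro e he
      have := (List.nodup_flatMap.1 e2).1 e he
      simpa using this
    have hdj : (edges2 t.2).Pairwise fun s t => ([s.1, s.2] : List Q).Disjoint [t.1, t.2] :=
      (List.nodup_flatMap.1 e2).2
    -- Separates the Bell preparations of a path from its measurements; this needs the disjointness
    -- of earlier measurements from later preparations.
    have step1 : act (pathOps β t.2) ψ =
        act (f1 t ++ (edges2 t.2).flatMap (hopMeas β)) ψ := by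
      have h1 : f1 t = t.2.flatMap fun h => [(bellM, h.2.1, h.2.2)] := by
        simp [f1, edges1, List.flatMap_singleton', Function.comp_def, ← List.map_eq_flatMap]
      have h2 : (edges2 t.2).flatMap (hopMeas β) = t.2.flatMap fun h => hopMeas β (h.1, h.2.1) := by
        simp [edges2, List.flatMap_map]
      rw [h1, h2, ← act_flatMap_append]
      · refine act_congr_items _ _ _ (fun hp hm ψ => ?_) ψ
        have := hne (hp.1, hp.2.1) (List.mem_map_of_mem hm)
        rw [act_append, hopMeas_act _ this]
        rfl
      · refine hpw.imp fun {a b} hab q hq hq' => @hab q ?_ ?_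
        · simp only [supp, hopMeas, List.flatMap_cons, List.flatMap_nil, List.mem_append, List.mem_cons,
            List.not_mem_nil, or_false] at hq ⊢
          tauto
        · simpa [supp] using hq'
    have step2 : ∀ ψ, act ((edges2 t.2).flatMap (hopMeas β)) ψ =
        act (g1 t ++ (g2 t ++ (g3 t ++ g4 t))) ψ := by
      intro ψ
      have hm : ∀ M : Q × Q → M4 × Q × Q, (edges2 t.2).map M = (edges2 t.2).flatMap fun e => [M e] :=
        fun M => List.map_eq_flatMap
      have hs : ∀ (F F' : Q × Q → List (M4 × Q × Q))
          (_ : ∀ e q, q ∈ supp (F e) → q ∈ [e.1, e.2]) (_ : ∀ e q, q ∈ supp (F' e) → q ∈ [e.1, e.2]),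
          (edges2 t.2).Pairwise fun s t => (supp (F s)).Disjoint (supp (F' t)) :=
        fun F F' hF hF' => hdj.imp fun {a b} hab q hq hq' => hab (hF _ _ hq) (hF' _ _ hq')
      simp only [g1, g2, g3, g4, hm]
      have e1 := act_flatMap_append (edges2 t.2) (fun e => [(condM (β e.1) xM, e)])
        (fun e => [(condM (β e.2) xM, e.2, e.1)]) (hs _ _ (by intro e q hq; simp [supp] at hq ⊢; tauto)
          (by intro e q hq; simp [supp] at hq ⊢; tauto))
      have e2 := act_flatMap_append (edges2 t.2) (fun e => [(proj1 (β e.1) ⊗ₖ proj1 (β e.2), e)])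
        (fun e => [(condM (β e.1) xM, e)] ++ [(condM (β e.2) xM, e.2, e.1)])
        (hs _ _ (by intro e q hq; simp [supp] at hq ⊢; tauto)
          (by intro e q hq; simp [supp] at hq ⊢; tauto))
      have e3 := act_flatMap_append (edges2 t.2) (fun e => [(bellM.conjTranspose, e)])
        (fun e => [(proj1 (β e.1) ⊗ₖ proj1 (β e.2), e)] ++ ([(condM (β e.1) xM, e)] ++
          [(condM (β e.2) xM, e.2, e.1)]))
        (hs _ _ (by intro e q hq; simp [supp] at hq ⊢; tauto)
          (by intro e q hq; simp [supp] at hq ⊢; tauto))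
      refine (e3 ψ).trans ?_
      rw [act_append, e2, act_append, e1]
      simp only [act_append]
    simp only [act_append] at step1 step2 ⊢
    rw [step1, step2]
  rw [act_congr_items L _ _ hpath ψ]
  have hd : ∀ (F F' : I × List (Q × Q × Q) → List (M4 × Q × Q))
      (_ : ∀ t ∈ L, ∀ q, q ∈ supp (F t) → q ∈ π t.1 :: cells t.2)
      (_ : ∀ t ∈ L, ∀ q, q ∈ supp (F' t) → q ∈ π t.1 :: cells t.2),
      L.Pairwise fun s t => (supp (F s)).Disjoint (supp (F' t)) :=
    fun F F' hF hF' => List.Pairwise.imp_of_mem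
      (fun {a b} ha hb hab q hq hq' => hab (hF a ha _ hq) (hF' b hb _ hq')) h.disj
  -- From here the layers are split off across the paths, the last one first, so that each statement
  -- can be applied to the tail left by the next one.
  have i6 := act_flatMap_append L (fun t => corrX β t.2) (fun t => corrZ β t.2)
    (hd _ _ (fun t ht q hq => hin t ht q (by tauto)) (fun t ht q hq => hin t ht q (by tauto)))
  have i5 := act_flatMap_append L g4 (fun t => corrX β t.2 ++ corrZ β t.2)
    (hd _ _ (fun t ht q hq => hin t ht q (by simp only [supp_append, List.mem_append] at hq; tauto)) (fun t ht q hq => hin t ht q (by tauto)))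
  have i4 := act_flatMap_append L g3 (fun t => g4 t ++ (corrX β t.2 ++ corrZ β t.2))
    (hd _ _ (fun t ht q hq => hin t ht q (by simp only [supp_append, List.mem_append] at hq; tauto)) (fun t ht q hq => hin t ht q (by tauto)))
  have i3 := act_flatMap_append L g2 (fun t => g3 t ++ (g4 t ++ (corrX β t.2 ++ corrZ β t.2)))
    (hd _ _ (fun t ht q hq => hin t ht q (by simp only [supp_append, List.mem_append] at hq; tauto)) (fun t ht q hq => hin t ht q (by tauto)))
  have i2 := act_flatMap_append L g1 (fun t => g2 t ++ (g3 t ++ (g4 t ++ (corrX β t.2 ++ corrZ β t.2))))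
    (hd _ _ (fun t ht q hq => hin t ht q (by simp only [supp_append, List.mem_append] at hq; tauto)) (fun t ht q hq => hin t ht q (by tauto)))
  have i1 := act_flatMap_append L f1 (fun t => g1 t ++ (g2 t ++ (g3 t ++ (g4 t ++ (corrX β t.2 ++ corrZ β t.2)))))
    (hd _ _ (fun t ht q hq => hin t ht q (by simp only [supp_append, List.mem_append] at hq; tauto)) (fun t ht q hq => hin t ht q (by tauto)))
  rw [i1, act_append, i2, act_append, i3, act_append, i4, act_append, i5, act_append, i6]
  simp only [transportOps, act_append, List.map_flatMap]
  rfl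

/-! ### Exchanging qubits with neighbours -/

/-- The exchanges `L` move qubit `i` from `π i` to `π' i`. -/
structure Swaps (π π' : I → Q) (L : List (I × Q × Q)) : Prop where
  keys : (L.map Prod.fst).Nodup
  ends : ∀ t ∈ L, π t.1 = t.2.1 ∧ π' t.1 = t.2.2
  fix : ∀ i ∉ L.map Prod.fst, π i = π' i
  fresh : ∀ t ∈ L, t.2.2 ∉ Set.range π
  disj : L.Pairwise fun s t => s.2.2 ≠ t.2.2

/-- The targets are distinct and initially empty, so each exchange leaves the conditions for the
others intact. No measurement is involved, hence no scalar appears. -/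
theorem Swaps.place (L : List (I × Q × Q)) (π' : I → Q) : ∀ (π : I → Q)
    (_ : Function.Injective π) (_ : Swaps π π' L), Function.Injective π' ∧
    ∀ φ : (I → Bool) → ℂ, act (L.map fun t => (swapM, t.2)) (place π φ) = place π' φ := by
  induction L with
  | nil =>
    intro π hπ h
    have : π = π' := funext fun i => h.fix i (by simp)
    subst this
    exact ⟨hπ, fun φ => by simp⟩
  | cons t L ih =>
    intro π hπ h
    have hk := List.nodup_cons.1 (by simpa using h.keys : (t.1 :: L.map Prod.fst).Nodup)
    have hd := List.pairwise_cons.1 h.disj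
    have ht := List.mem_cons_self (a := t) (l := L)
    have hfresh := h.fresh t ht
    have hup : ∀ t' ∈ L, Function.update π t.1 t.2.2 t'.1 = π t'.1 := fun t' ht' =>
      Function.update_of_ne (fun he : t'.1 = t.1 => hk.1 (he ▸ List.mem_map_of_mem ht')) _ _
    have hr : Swaps (Function.update π t.1 t.2.2) π' L := by
      refine ⟨hk.2, fun t' ht' => ?_, fun i hi => ?_, fun t' ht' => ?_, hd.2⟩
      · rw [hup t' ht']; exact h.ends t' (List.mem_cons_of_mem _ ht')
      · by_cases hit : i = t.1
        · simp [hit, (h.ends t ht).2]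
        · rw [Function.update_of_ne hit]
          exact h.fix i (by simpa [hit] using hi)
      · rw [not_mem_range_update hπ]
        exact ⟨(hd.1 t' ht').symm, Or.inr (h.fresh t' (List.mem_cons_of_mem _ ht'))⟩
    obtain ⟨hinj, ih⟩ := ih _ (update_injective hπ t.1 hfresh) hr
    refine ⟨hinj, fun φ => ?_⟩
    rw [List.map_cons, act_cons, ← (h.ends t ht).1]
    dsimp only
    rw [swap_place hπ _ hfresh, ih]

theorem Swaps.rev {π π' : I → Q} {L : List (I × Q × Q)} (hπ : Function.Injective π)
    (h : Swaps π π' L) : Swaps π' π (L.map fun t => (t.1, t.2.2, t.2.1)) := by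
  have hkeys : (L.map fun t => (t.1, t.2.2, t.2.1)).map Prod.fst = L.map Prod.fst := by
    simp [Function.comp_def]
  refine ⟨by rw [hkeys]; exact h.keys, ?_, ?_, ?_, ?_⟩
  · intro t' ht'
    obtain ⟨t, ht, rfl⟩ := List.mem_map.1 ht'
    exact (h.ends t ht).symm
  · intro i hi
    rw [hkeys] at hi
    exact (h.fix i hi).symm
  · intro t' ht'
    obtain ⟨t, ht, rfl⟩ := List.mem_map.1 ht'
    rintro ⟨j, hj⟩
    dsimp only at hj
    by_cases hjk : j ∈ L.map Prod.fst
    · obtain ⟨s, hs, rfl⟩ := List.mem_map.1 hjk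
      rw [(h.ends s hs).2] at hj
      exact h.fresh s hs ⟨t.1, by rw [(h.ends t ht).1, hj]⟩
    · rw [← h.fix j hjk, ← (h.ends t ht).1] at hj
      exact hjk (hπ hj ▸ List.mem_map_of_mem ht)
  · rw [List.pairwise_map]
    have hk : L.Pairwise fun s t => s.1 ≠ t.1 := List.pairwise_map.1 h.keys
    refine List.Pairwise.imp_of_mem ?_ hk
    intro a b ha hb hab he
    dsimp only at he
    rw [← (h.ends a ha).1, ← (h.ends b hb).1] at he
    exact hab (hπ he)

end Paths
end QArch

namespace QArch
set_option linter.unusedSectionVars false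
set_option linter.unusedSimpArgs false

/-! ## Sequences of timesteps -/

/-- Value at a key in an association list. -/
def lookupD {K V : Type} [DecidableEq K] (l : List (K × V)) (k : K) (d : V) : V :=
  l.foldr (fun p acc => if p.1 = k then p.2 else acc) d

theorem lookupD_of_not_mem {K V : Type} [DecidableEq K] {l : List (K × V)} {k : K} (d : V)
    (h : k ∉ l.map Prod.fst) : lookupD l k d = d := by
  induction l with
  | nil => rfl
  | cons p l ih =>
    simp only [List.map_cons, List.mem_cons, not_or] at h
    simp only [lookupD, List.foldr_cons] at ih ⊢
    rw [if_neg (Ne.symm h.1), ih h.2]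

theorem lookupD_of_mem {K V : Type} [DecidableEq K] {l : List (K × V)} {p : K × V} (d : V)
    (hn : (l.map Prod.fst).Nodup) (h : p ∈ l) : lookupD l p.1 d = p.2 := by
  induction l with
  | nil => simp at h
  | cons p' l ih =>
    simp only [List.map_cons, List.nodup_cons] at hn
    simp only [lookupD, List.foldr_cons] at ih ⊢
    rcases List.mem_cons.1 h with rfl | h
    · simp
    · rw [if_neg, ih hn.2 h]
      intro he
      exact hn.1 (he ▸ List.mem_map_of_mem h)

/-- Allows a list of outcomes to be replaced by a function on the measured qubits. -/
theorem map_lookupD_zip {K V : Type} [DecidableEq K] {ks : List K} {vs : List V} (d : V)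
    (hn : ks.Nodup) (h : vs.length = ks.length) :
    (ks.map fun k => lookupD (ks.zip vs) k d) = vs := by
  refine List.ext_getElem (by simp [h]) fun i h1 h2 => ?_
  rw [List.getElem_map]
  have hi : i < (ks.zip vs).length := by simp at h1 ⊢; omega
  have hk : (ks.zip vs).map Prod.fst = ks := List.map_fst_zip (by omega)
  have := lookupD_of_mem (l := ks.zip vs) (p := (ks.zip vs)[i]) d (by rw [hk]; exact hn)
    (List.getElem_mem hi)
  simpa using this

section

variable {Q : Type} [DecidableEq Q] [Coded Q] {G : GateSet} (C : Circuit Q G)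

/-! ### Sequences of timesteps and the matrices they apply. -/

/-- Number of measurements among some operations. -/
def numMeas {Q : Type} : List (Op Q) → ℕ
  | [] => 0
  | Op.meas _ :: l => numMeas l + 1
  | Op.gate1 _ _ :: l => numMeas l
  | Op.gate2 _ _ _ :: l => numMeas l

@[simp] theorem applyOps_nil_nil (ψ : (Q → Bool) → ℂ) : C.applyOps [] [] ψ = ψ := rfl

theorem applyOps_meas (q : Q) (l : List (Op Q)) (b : Bool) (o : List Bool) (ψ : (Q → Bool) → ℂ) :
    C.applyOps (Op.meas q :: l) (b :: o) ψ = C.applyOps l o (project q b ψ) := rfl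

theorem applyOps_gate1 {g : GateRef} {U : G.one} (hg : C.gate1 g = some U) (q : Q)
    (l : List (Op Q)) (o : List Bool) (ψ : (Q → Bool) → ℂ) :
    C.applyOps (Op.gate1 g q :: l) o ψ = C.applyOps l o (apply1 (U.val : Matrix Bool Bool ℂ) q ψ) := by
  simp only [Circuit.applyOps, hg]

theorem applyOps_gate2 {g : GateRef} {U : G.two} (hg : C.gate2 g = some U) (p q : Q)
    (l : List (Op Q)) (o : List Bool) (ψ : (Q → Bool) → ℂ) :
    C.applyOps (Op.gate2 g p q :: l) o ψ = C.applyOps l o (apply2 (U.val : M4) p q ψ) := by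
  simp only [Circuit.applyOps, hg]

theorem applyOps_of_length_ne (l : List (Op Q)) : ∀ (o : List Bool) (ψ : (Q → Bool) → ℂ),
    o.length ≠ numMeas l → C.applyOps l o ψ = 0 := by
  induction l with
  | nil =>
    intro o ψ h
    cases o with
    | nil => simp [numMeas] at h
    | cons b o => rfl
  | cons x l ih =>
    intro o ψ h
    cases x with
    | meas q =>
      cases o with
      | nil => rfl
      | cons b o => rw [applyOps_meas]; exact ih _ _ (by simpa [numMeas] using h)
    | gate1 g q => simp only [Circuit.applyOps]; exact ih _ _ h
    | gate2 g p q => simp only [Circuit.applyOps]; exact ih _ _ h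

theorem applyOps_smul (a : ℂ) (l : List (Op Q)) : ∀ (o : List Bool) (ψ : (Q → Bool) → ℂ),
    C.applyOps l o (a • ψ) = a • C.applyOps l o ψ := by
  induction l with
  | nil =>
    intro o ψ
    cases o with
    | nil => rfl
    | cons b o => simp [Circuit.applyOps]
  | cons x l ih =>
    intro o ψ
    cases x with
    | meas q =>
      cases o with
      | nil => simp [Circuit.applyOps]
      | cons b o => rw [applyOps_meas, applyOps_meas, project_smul, ih]
    | gate1 g q =>
      simp only [Circuit.applyOps]
      cases C.gate1 g with
      | none => exact ih _ _
      | some U => simp only [apply1_smul, ih]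
    | gate2 g p q =>
      simp only [Circuit.applyOps]
      cases C.gate2 g with
      | none => exact ih _ _
      | some U => simp only [apply2_smul, ih]

theorem applyOps_zero (l : List (Op Q)) (o : List Bool) :
    C.applyOps l o (0 : (Q → Bool) → ℂ) = 0 := by
  have := applyOps_smul C 0 l o 0
  simpa using this

/-- Unnormalised state after the timesteps `fs` with outcomes `os`, where the operations of a timestep
may depend on the outcomes before it (`p` being those before the first timestep, the last one first). -/
def run : List (List (List Bool) → List (Op Q)) → List (List Bool) → List (List Bool) →
    ((Q → Bool) → ℂ) → ((Q → Bool) → ℂ)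
  | [], _, _, ψ => ψ
  | _ :: _, _, [], _ => 0
  | f :: fs, p, o :: os, ψ => run fs (o :: p) os (C.applyOps (f p) o ψ)

theorem run_append (fs fs' : List (List (List Bool) → List (Op Q))) : ∀ (p os os' : List (List Bool))
    (ψ : (Q → Bool) → ℂ) (_ : os.length = fs.length),
    run C (fs ++ fs') p (os ++ os') ψ = run C fs' (os.reverse ++ p) os' (run C fs p os ψ) := by
  induction fs with
  | nil =>
    intro p os os' ψ h
    obtain rfl := List.length_eq_zero_iff.1 h
    rfl
  | cons f fs ih =>
    intro p os os' ψ h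
    cases os with
    | nil => simp at h
    | cons o os =>
      simp only [List.cons_append, run]
      rw [ih _ _ _ _ (by simpa using h)]
      simp

theorem run_smul (a : ℂ) (fs : List (List (List Bool) → List (Op Q))) : ∀ (p os : List (List Bool))
    (ψ : (Q → Bool) → ℂ), run C fs p os (a • ψ) = a • run C fs p os ψ := by
  induction fs with
  | nil => intro p os ψ; rfl
  | cons f fs ih =>
    intro p os ψ
    cases os with
    | nil => simp [run]
    | cons o os => simp only [run, applyOps_smul, ih]

theorem run_zero (fs : List (List (List Bool) → List (Op Q))) (p os : List (List Bool)) :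
    run C fs p os (0 : (Q → Bool) → ℂ) = 0 := by
  have := run_smul C 0 fs p os 0
  simpa using this

/-- The timesteps `fs` have outcome lists of the lengths `prof`, and with outcomes `os` they apply the
matrices `T os`, up to a phase. -/
def Sem (fs : List (List (List Bool) → List (Op Q))) (prof : List ℕ) (p : List (List Bool))
    (T : List (List Bool) → List (M4 × Q × Q)) : Prop :=
  fs.length = prof.length ∧ ∀ os : List (List Bool), os.length = fs.length →
    (os.map List.length = prof → ∃ s : ℂ, ‖s‖ = 1 ∧ ∀ ψ, run C fs p os ψ = s • act (T os) ψ) ∧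
    (os.map List.length ≠ prof → ∀ ψ, run C fs p os ψ = 0)

variable {C}

/-- The matrices of the first part must not depend on its outcomes; the second part may use them
freely. Outcomes of the wrong shape annihilate the state in whichever part they occur. -/
theorem Sem.append {fs fs' : List (List (List Bool) → List (Op Q))} {prof prof' : List ℕ}
    {p : List (List Bool)} {A : List (M4 × Q × Q)} {T : List (List Bool) → List (M4 × Q × Q)}
    (h : Sem C fs prof p fun _ => A)
    (h' : ∀ os : List (List Bool), os.length = fs.length → Sem C fs' prof' (os.reverse ++ p) T) :
    Sem C (fs ++ fs') (prof ++ prof') p fun os => A ++ T (os.drop fs.length) := by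
  have hl' := (h' (List.replicate fs.length []) (by simp)).1
  refine ⟨by simp [h.1, hl'], fun os hos => ?_⟩
  obtain ⟨os1, os2, rfl, h1⟩ : ∃ os1 os2, os = os1 ++ os2 ∧ os1.length = fs.length :=
    ⟨os.take fs.length, os.drop fs.length, (List.take_append_drop _ _).symm, by
      simp at hos ⊢; omega⟩
  have h2 : os2.length = fs'.length := by simp [h1] at hos; exact hos
  have hd : (os1 ++ os2).drop fs.length = os2 := by rw [← h1]; simp
  have hA := h.2 os1 h1
  have hB := (h' os1 h1).2 os2 h2
  dsimp only
  rw [List.map_append, hd]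
  constructor
  · intro hm
    obtain ⟨e1, e2⟩ := List.append_inj hm (by simp [h1, h.1])
    obtain ⟨s, hs, hA⟩ := hA.1 e1
    obtain ⟨s', hs', hB⟩ := hB.1 e2
    refine ⟨s * s', by rw [norm_mul, hs, hs', one_mul], fun ψ => ?_⟩
    rw [run_append C _ _ _ _ _ _ h1, hA, run_smul, hB, act_append, smul_smul]
  · intro hm ψ
    rw [run_append C _ _ _ _ _ _ h1]
    by_cases e1 : os1.map List.length = prof
    · exact hB.2 (fun e2 => hm (by rw [e1, e2])) _
    · rw [hA.2 e1, run_zero]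

theorem Sem.append' {fs fs' : List (List (List Bool) → List (Op Q))} {prof prof' : List ℕ}
    {p : List (List Bool)} {A B : List (M4 × Q × Q)} (h : Sem C fs prof p fun _ => A)
    (h' : ∀ os : List (List Bool), os.length = fs.length →
      Sem C fs' prof' (os.reverse ++ p) fun _ => B) :
    Sem C (fs ++ fs') (prof ++ prof') p fun _ => A ++ B := Sem.append h h'

/-- Covers the one timestep with measurements: its outcome `o` determines both the projections `A o`
and all the later corrections `T o`. -/
theorem Sem.cons {f : List (List Bool) → List (Op Q)} {fs : List (List (List Bool) → List (Op Q))}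
    {m : ℕ} {prof : List ℕ} {p : List (List Bool)} {A : List Bool → List (M4 × Q × Q)}
    {T : List Bool → List (M4 × Q × Q)} (hm : numMeas (f p) = m) (hlen : fs.length = prof.length)
    (h : ∀ o : List Bool, o.length = m → ∀ ψ, C.applyOps (f p) o ψ = act (A o) ψ)
    (h' : ∀ o : List Bool, Sem C fs prof (o :: p) fun _ => T o) :
    Sem C (f :: fs) (m :: prof) p fun os => A (os.headD []) ++ T (os.headD []) := by
  refine ⟨by simp [hlen], fun os hos => ?_⟩
  cases os with
  | nil => simp at hos
  | cons o os =>
    have hos' : os.length = fs.length := by simpa using hos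
    have h2 := (h' o).2 os hos'
    simp only [List.map_cons, run, List.headD_cons]
    constructor
    · intro he
      obtain ⟨e1, e2⟩ := List.cons.inj he
      obtain ⟨s, hs, h2⟩ := h2.1 e2
      exact ⟨s, hs, fun ψ => by rw [h2, h o e1, act_append]⟩
    · intro he ψ
      by_cases e1 : o.length = m
      · exact h2.2 (fun e2 => he (by rw [e1, e2])) _
      · rw [applyOps_of_length_ne C _ _ _ (by rw [hm]; exact e1), run_zero]

/-! ### Words of basic gates on pairs of qubits -/

/-- A wired-in gate applied to a pair of qubits: a one-qubit gate on the first or second of them, or a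
two-qubit gate in one of the two orientations. -/
inductive PRef : Type
  | fst : ℕ → PRef
  | snd : ℕ → PRef
  | fwd : ℕ → PRef
  | bwd : ℕ → PRef

/-- The operation on a given pair. -/
def PRef.op {Q : Type} : PRef → Q × Q → Op Q
  | fst i, e => Op.gate1 (GateRef.wired i) e.1
  | snd i, e => Op.gate1 (GateRef.wired i) e.2
  | fwd i, e => Op.gate2 (GateRef.wired i) e.1 e.2
  | bwd i, e => Op.gate2 (GateRef.wired i) e.2 e.1

/-- The matrix of a wired-in gate applied to a pair. -/
def Means (w1 : List G.one) (w2 : List G.two) : PRef → M4 → Prop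
  | .fst i, V => ∃ U, w1[i]? = some U ∧
      V = (U.val : Matrix Bool Bool ℂ) ⊗ₖ (1 : Matrix Bool Bool ℂ)
  | .snd i, V => ∃ U, w1[i]? = some U ∧
      V = (1 : Matrix Bool Bool ℂ) ⊗ₖ (U.val : Matrix Bool Bool ℂ)
  | .fwd i, V => ∃ U, w2[i]? = some U ∧ V = (U.val : M4)
  | .bwd i, V => ∃ U, w2[i]? = some U ∧ V = (U.val : M4).submatrix Prod.swap Prod.swap

/-- The matrix of a word of gates, the first of which is applied first. -/
inductive WordMat (w1 : List G.one) (w2 : List G.two) : List PRef → M4 → Prop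
  | nil : WordMat w1 w2 [] 1
  | cons {r : PRef} {V W : M4} {wd : List PRef} : Means w1 w2 r V → WordMat w1 w2 wd W →
      WordMat w1 w2 (r :: wd) (W * V)

/-- The word implements the matrix up to a phase. -/
def IsWord (w1 : List G.one) (w2 : List G.two) (wd : List PRef) (U : M4) : Prop :=
  ∃ c : ℂ, ‖c‖ = 1 ∧ WordMat w1 w2 wd (c • U)

theorem Means.mono {w1 w1' : List G.one} {w2 w2' : List G.two} (h1 : w1 <+: w1') (h2 : w2 <+: w2')
    {r : PRef} {V : M4} (h : Means w1 w2 r V) : Means w1' w2' r V := by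
  obtain ⟨t1, rfl⟩ := h1
  obtain ⟨t2, rfl⟩ := h2
  have k : ∀ {α : Type} {l t : List α} {i : ℕ} {a : α}, l[i]? = some a → (l ++ t)[i]? = some a := by
    intro α l t i a h
    rw [List.getElem?_append_left (List.getElem?_eq_some_iff.1 h).1, h]
  cases r <;> (obtain ⟨U, h, rfl⟩ := h; exact ⟨U, k h, rfl⟩)

theorem WordMat.mono {w1 w1' : List G.one} {w2 w2' : List G.two} (h1 : w1 <+: w1') (h2 : w2 <+: w2')
    {wd : List PRef} {W : M4} (h : WordMat w1 w2 wd W) : WordMat w1' w2' wd W := by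
  induction h with
  | nil => exact .nil
  | cons hr _ ih => exact .cons (hr.mono h1 h2) ih

theorem IsWord.mono {w1 w1' : List G.one} {w2 w2' : List G.two} (h1 : w1 <+: w1') (h2 : w2 <+: w2')
    {wd : List PRef} {U : M4} (h : IsWord w1 w2 wd U) : IsWord w1' w2' wd U :=
  let ⟨c, hc, h⟩ := h
  ⟨c, hc, h.mono h1 h2⟩

/-- A new gate is appended at the end of a list of wired-in gates, so all references made before
keep their meaning. Words can therefore be found one after another. -/
theorem exists_means (w1 : List G.one) (w2 : List G.two) {V : M4} (hV : V ∈ G.onPair) :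
    ∃ w1' w2' r, w1 <+: w1' ∧ w2 <+: w2' ∧ Means w1' w2' r V := by
  rcases hV with ⟨g, hg, rfl⟩ | ⟨g, hg, rfl⟩ | ⟨g, hg, rfl⟩ | ⟨g, hg, rfl⟩
  · exact ⟨w1 ++ [⟨g, hg⟩], w2, .fst w1.length, ⟨_, rfl⟩, List.prefix_rfl, ⟨g, hg⟩, by simp, rfl⟩
  · exact ⟨w1 ++ [⟨g, hg⟩], w2, .snd w1.length, ⟨_, rfl⟩, List.prefix_rfl, ⟨g, hg⟩, by simp, rfl⟩
  · exact ⟨w1, w2 ++ [⟨g, hg⟩], .fwd w2.length, List.prefix_rfl, ⟨_, rfl⟩, ⟨g, hg⟩, by simp, rfl⟩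
  · exact ⟨w1, w2 ++ [⟨g, hg⟩], .bwd w2.length, List.prefix_rfl, ⟨_, rfl⟩, ⟨g, hg⟩, by simp, rfl⟩

theorem WordMat.snoc {w1 : List G.one} {w2 : List G.two} {wd : List PRef} {W : M4}
    (h : WordMat w1 w2 wd W) {r : PRef} {V : M4} (hr : Means w1 w2 r V) :
    WordMat w1 w2 (wd ++ [r]) (V * W) := by
  induction h with
  | nil => simpa using WordMat.cons hr WordMat.nil
  | cons h' _ ih => rw [← mul_assoc]; exact .cons h' ih

theorem exists_wordMat (w1 : List G.one) (w2 : List G.two) (l : List M4) (hl : ∀ V ∈ l, V ∈ G.onPair) :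
    ∃ w1' w2' wd, w1 <+: w1' ∧ w2 <+: w2' ∧ WordMat w1' w2' wd l.prod := by
  induction l with
  | nil => exact ⟨w1, w2, [], List.prefix_rfl, List.prefix_rfl, .nil⟩
  | cons V l ih =>
    obtain ⟨w1', w2', wd, h1, h2, h⟩ := ih fun V hV => hl V (List.mem_cons_of_mem _ hV)
    obtain ⟨w1'', w2'', r, h1', h2', hr⟩ := exists_means w1' w2' (hl V List.mem_cons_self)
    exact ⟨w1'', w2'', wd ++ [r], h1.trans h1', h2.trans h2', by
      rw [List.prod_cons]; exact (h.mono h1' h2').snoc hr⟩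

theorem exists_isWord (hG : G.Universal) (w1 : List G.one) (w2 : List G.two)
    (U : Matrix.unitaryGroup (Bool × Bool) ℂ) :
    ∃ w1' w2' wd, w1 <+: w1' ∧ w2 <+: w2' ∧ IsWord w1' w2' wd (U : M4) := by
  obtain ⟨l, hl, c, hc, hU⟩ := hG U
  obtain ⟨w1', w2', wd, h1, h2, h⟩ := exists_wordMat w1 w2 l hl
  refine ⟨w1', w2', wd, h1, h2, c⁻¹, by rw [norm_inv, hc, inv_one], ?_⟩
  have hc0 : c ≠ 0 := by rintro rfl; simp at hc
  rw [hU, smul_smul, inv_mul_cancel₀ hc0, one_smul]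
  exact h

/-! ### Layers -/

/-- The qubits of a list of pairs. -/
def pairQubits {Q : Type} (E : List (Q × Q)) : List Q := E.flatMap fun e => [e.1, e.2]

theorem ne_of_nodup {E : List (Q × Q)} (h : (pairQubits E).Nodup) : ∀ e ∈ E, e.1 ≠ e.2 := by
  intro e he
  have := (List.nodup_flatMap.1 h).1 e he
  simpa using this

theorem act_map_mul {E : List (Q × Q)} (h : (pairQubits E).Nodup) (V W : M4)
    (ψ : (Q → Bool) → ℂ) :
    act (E.map fun e => (W, e)) (act (E.map fun e => (V, e)) ψ) =
      act (E.map fun e => (W * V, e)) ψ := by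
  have hd : E.Pairwise fun s t : Q × Q => ([s.1, s.2] : List Q).Disjoint [t.1, t.2] :=
    (List.nodup_flatMap.1 h).2
  have := act_flatMap_append E (fun e => [(V, e)]) (fun e => [(W, e)])
    (hd.imp fun {a b} hab q hq hq' => @hab q (by simpa [supp] using hq) (by simpa [supp] using hq')) ψ
  rw [← act_append, List.map_eq_flatMap, List.map_eq_flatMap, ← this, List.map_eq_flatMap]
  refine act_congr_items _ _ _ (fun e he ψ => ?_) ψ
  simp only [List.singleton_append, act_cons, act_nil]
  exact apply2_apply2 _ _ (ne_of_nodup h e he) ψ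

theorem act_map_one (E : List (Q × Q)) (ψ : (Q → Bool) → ℂ) :
    act (E.map fun e => ((1 : M4), e)) ψ = ψ := by
  induction E with
  | nil => rfl
  | cons e E ih => rw [List.map_cons, act_cons, apply2_one, ih]

theorem act_map_smul (c : ℂ) (U : M4) (E : List (Q × Q)) (ψ : (Q → Bool) → ℂ) :
    act (E.map fun e => (c • U, e)) ψ = c ^ E.length • act (E.map fun e => (U, e)) ψ := by
  induction E generalizing ψ with
  | nil => simp
  | cons e E ih =>
    rw [List.map_cons, act_cons, apply2_smul_matrix, act_smul, ih, List.map_cons, act_cons, smul_smul,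
      List.length_cons, pow_succ']

theorem numMeas_map_op (r : PRef) (E : List (Q × Q)) : numMeas (E.map r.op) = 0 := by
  induction E with
  | nil => rfl
  | cons e E ih => cases r <;> simpa [numMeas, PRef.op] using ih

theorem applyOps_map_op {r : PRef} {V : M4} (hr : Means C.wired1 C.wired2 r V) {E : List (Q × Q)}
    (h : ∀ e ∈ E, e.1 ≠ e.2) (ψ : (Q → Bool) → ℂ) :
    C.applyOps (E.map r.op) [] ψ = act (E.map fun e => (V, e)) ψ := by
  induction E generalizing ψ with
  | nil => rfl
  | cons e E ih =>
    have he := h e List.mem_cons_self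
    rw [List.map_cons, List.map_cons, act_cons, ← ih fun e he => h e (List.mem_cons_of_mem _ he)]
    cases r with
    | fst i =>
      obtain ⟨U, hU, rfl⟩ := hr
      rw [PRef.op, applyOps_gate1 C (g := .wired i) (U := U) hU, apply1_eq_apply2_left _ he]
    | snd i =>
      obtain ⟨U, hU, rfl⟩ := hr
      rw [PRef.op, applyOps_gate1 C (g := .wired i) (U := U) hU, apply1_eq_apply2_right _ he]
    | fwd i =>
      obtain ⟨U, hU, rfl⟩ := hr
      rw [PRef.op, applyOps_gate2 C (g := .wired i) (U := U) hU]
    | bwd i =>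
      obtain ⟨U, hU, rfl⟩ := hr
      rw [PRef.op, applyOps_gate2 C (g := .wired i) (U := U) hU, apply2_swap _ he]

/-- The timesteps that apply a word to all pairs of a list, which may depend on the outcomes before
the first of these timesteps. -/
def layer {Q : Type} : List PRef → (List (List Bool) → List (Q × Q)) →
    List (List (List Bool) → List (Op Q))
  | [], _ => []
  | r :: wd, E => (fun p => (E p).map r.op) :: layer wd fun p => E p.tail

theorem length_layer {Q : Type} (wd : List PRef) : ∀ E : List (List Bool) → List (Q × Q),
    (layer wd E).length = wd.length := by
  induction wd with
  | nil => intro E; rfl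
  | cons r wd ih => intro E; simp [layer, ih]

/-- Without measurements only empty outcome lists have nonzero amplitude. Each timestep nevertheless
adds one list to the history, and passing `fun p => E p.tail` to the recursion strips it, so all
timesteps of the layer use the same pairs. -/
theorem sem_layer_aux {wd : List PRef} {W : M4} (hw : WordMat C.wired1 C.wired2 wd W) :
    ∀ (E : List (List Bool) → List (Q × Q)) (p : List (List Bool)), (pairQubits (E p)).Nodup →
      ∀ os : List (List Bool), os.length = wd.length →
      (os.map List.length = List.replicate wd.length 0 →
        ∀ ψ, run C (layer wd E) p os ψ = act ((E p).map fun e => (W, e)) ψ) ∧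
      (os.map List.length ≠ List.replicate wd.length 0 → ∀ ψ, run C (layer wd E) p os ψ = 0) := by
  induction hw with
  | nil =>
    intro E p h os hos
    obtain rfl := List.length_eq_zero_iff.1 hos
    exact ⟨fun _ ψ => (act_map_one _ _).symm, fun h => absurd rfl h⟩
  | @cons r V W wd hr hw ih =>
    intro E p h os hos
    cases os with
    | nil => simp at hos
    | cons o os =>
      obtain ⟨ih1, ih2⟩ := ih (fun p => E p.tail) (o :: p) h os (by simpa using hos)
      simp only [List.map_cons, List.length_cons, List.replicate_succ, layer, run]
      constructor
      · intro hm ψ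
        obtain ⟨e1, e2⟩ := List.cons.inj hm
        obtain rfl := List.length_eq_zero_iff.1 e1
        rw [applyOps_map_op hr (ne_of_nodup h), ih1 e2]
        exact act_map_mul h _ _ _
      · intro hm ψ
        by_cases e1 : o.length = 0
        · exact ih2 (fun e2 => hm (by rw [e1, e2])) _
        · rw [applyOps_of_length_ne C _ _ _ (by rw [numMeas_map_op]; exact e1), run_zero]

theorem sem_layer {wd : List PRef} {U : M4} (hw : IsWord C.wired1 C.wired2 wd U)
    (E : List (List Bool) → List (Q × Q)) (p : List (List Bool)) (h : (pairQubits (E p)).Nodup) :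
    Sem C (layer wd E) (List.replicate wd.length 0) p fun _ => (E p).map fun e => (U, e) := by
  obtain ⟨c, hc, hw⟩ := hw
  refine ⟨by rw [length_layer, List.length_replicate], fun os hos => ?_⟩
  rw [length_layer] at hos
  obtain ⟨h1, h2⟩ := sem_layer_aux hw E p h os hos
  exact ⟨fun hm => ⟨c ^ (E p).length, by rw [norm_pow, hc, one_pow], fun ψ => by
    rw [h1 hm, act_map_smul]⟩, h2⟩

/-! ### Measurement of pairs -/

def measOps {Q : Type} (E : List (Q × Q)) : List (Op Q) := (pairQubits E).map Op.meas

/-- The outcome of each measured qubit. -/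
def bits (E : List (Q × Q)) (o : List Bool) (q : Q) : Bool := lookupD ((pairQubits E).zip o) q false

theorem numMeas_measOps (E : List (Q × Q)) : numMeas (measOps E) = 2 * E.length := by
  induction E with
  | nil => rfl
  | cons e E ih =>
    have : measOps (e :: E) = Op.meas e.1 :: Op.meas e.2 :: measOps E := rfl
    simp only [this, numMeas, ih, List.length_cons]; omega

theorem applyOps_measOps_aux (β : Q → Bool) {E : List (Q × Q)} (h : ∀ e ∈ E, e.1 ≠ e.2)
    (ψ : (Q → Bool) → ℂ) : C.applyOps (measOps E) ((pairQubits E).map β) ψ =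
      act (E.map fun e => (proj1 (β e.1) ⊗ₖ proj1 (β e.2), e)) ψ := by
  induction E generalizing ψ with
  | nil => rfl
  | cons e E ih =>
    have he := h e List.mem_cons_self
    rw [List.map_cons, act_cons, ← ih fun e he => h e (List.mem_cons_of_mem _ he)]
    have e1 : measOps (e :: E) = Op.meas e.1 :: Op.meas e.2 :: measOps E := rfl
    have e2 : (pairQubits (e :: E)).map β = β e.1 :: β e.2 :: (pairQubits E).map β := rfl
    rw [e1, e2, applyOps_meas, applyOps_meas, project_eq_apply1, project_eq_apply1,
      apply1_eq_apply2_left _ he, apply1_eq_apply2_right _ he, apply2_apply2 _ _ he,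
      ← Matrix.mul_kronecker_mul, Matrix.one_mul, Matrix.mul_one]

theorem applyOps_measOps {E : List (Q × Q)} (h : (pairQubits E).Nodup) {o : List Bool}
    (ho : o.length = 2 * E.length) (ψ : (Q → Bool) → ℂ) : C.applyOps (measOps E) o ψ =
      act (E.map fun e => (proj1 (bits E o e.1) ⊗ₖ proj1 (bits E o e.2), e)) ψ := by
  have hl : (pairQubits E).length = 2 * E.length := by
    rw [← numMeas_measOps]
    have : ∀ l : List Q, l.length = numMeas (l.map Op.meas) := fun l => by
      induction l with
      | nil => rfl
      | cons a l ih => simp [numMeas, ih]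
    unfold measOps
    exact this _
  rw [← applyOps_measOps_aux (bits E o) (ne_of_nodup h)]
  congr 1
  exact (map_lookupD_zip false h (by omega)).symm

/-- Applying a gate only where the outcomes call for it is the same as applying everywhere either
the gate or the identity. -/
theorem act_filter_map {T : Type} (L : List T) (b : T → Bool) (U : M4) (g : T → List (Q × Q))
    (ψ : (Q → Bool) → ℂ) :
    act (((L.filter b).flatMap g).map fun e => (U, e)) ψ =
      act (L.flatMap fun t => (g t).map fun e => (condM (b t) U, e)) ψ := by
  induction L generalizing ψ with
  | nil => rfl
  | cons t L ih =>
    rw [List.flatMap_cons, act_append, List.filter_cons]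
    cases hb : b t with
    | false => simp only [condM, Bool.false_eq_true, if_false]; rw [act_map_one, ih]; rfl
    | true => simp only [condM, if_true, List.flatMap_cons, List.map_append, act_append]; rw [ih]; rfl

end
end QArch

namespace QArch
set_option linter.unusedSectionVars false
set_option linter.unusedSimpArgs false

/-! ## Blocks of timesteps that move qubits -/

section

variable {I Q : Type} [DecidableEq I] [DecidableEq Q] [Coded Q] {G : GateSet}

/-- The timesteps `fs` move a register from the places `π` to the places `π'`. -/
def Block (C : Circuit Q G) (fs : List (List (List Bool) → List (Op Q))) (prof : List ℕ)
    (π π' : I → Q) : Prop :=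
  fs.length = prof.length ∧ ∀ p os : List (List Bool), os.length = fs.length →
    (os.map List.length = prof → ∃ s : ℂ, ‖s‖ ^ 2 = (1 / 2) ^ prof.sum ∧
      ∀ φ : (I → Bool) → ℂ, run C fs p os (place π φ) = s • place π' φ) ∧
    (os.map List.length ≠ prof → ∀ φ : (I → Bool) → ℂ, run C fs p os (place π φ) = 0)

/-- The weight `‖s‖ ^ 2` is one factor `1 / 2` for each outcome bit, independently of the
transported state, so weights of consecutive blocks multiply as the numbers of bits add. -/
theorem Block.append {C : Circuit Q G} {fs fs' : List (List (List Bool) → List (Op Q))}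
    {prof prof' : List ℕ} {π π' π'' : I → Q} (h : Block C fs prof π π')
    (h' : Block C fs' prof' π' π'') : Block C (fs ++ fs') (prof ++ prof') π π'' := by
  refine ⟨by simp [h.1, h'.1], fun p os hos => ?_⟩
  obtain ⟨os1, os2, rfl, h1⟩ : ∃ os1 os2, os = os1 ++ os2 ∧ os1.length = fs.length :=
    ⟨os.take fs.length, os.drop fs.length, (List.take_append_drop _ _).symm, by
      simp at hos ⊢; omega⟩
  have h2 : os2.length = fs'.length := by simp [h1] at hos; exact hos
  have hA := h.2 p os1 h1
  have hB := h'.2 (os1.reverse ++ p) os2 h2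
  rw [List.map_append]
  constructor
  · intro hm
    obtain ⟨e1, e2⟩ := List.append_inj hm (by simp [h1, h.1])
    obtain ⟨s, hs, hA⟩ := hA.1 e1
    obtain ⟨s', hs', hB⟩ := hB.1 e2
    refine ⟨s * s', by rw [norm_mul, mul_pow, hs, hs', List.sum_append, pow_add], fun φ => ?_⟩
    rw [run_append C _ _ _ _ _ _ h1, hA, run_smul, hB, smul_smul]
  · intro hm φ
    rw [run_append C _ _ _ _ _ _ h1]
    by_cases e1 : os1.map List.length = prof
    · obtain ⟨s, hs, hA⟩ := hA.1 e1
      rw [hA, run_smul, hB.2 (fun e2 => hm (by rw [e1, e2])), smul_zero]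
    · rw [hA.2 e1, run_zero]

theorem Sem.block {C : Circuit Q G} {fs : List (List (List Bool) → List (Op Q))} {prof : List ℕ}
    {π π' : I → Q} {T : List (List Bool) → List (List Bool) → List (M4 × Q × Q)}
    (h : ∀ p, Sem C fs prof p (T p))
    (hT : ∀ p os, os.map List.length = prof → ∃ s : ℂ, ‖s‖ ^ 2 = (1 / 2) ^ prof.sum ∧
      ∀ φ : (I → Bool) → ℂ, act (T p os) (place π φ) = s • place π' φ) :
    Block C fs prof π π' := by
  refine ⟨(h []).1, fun p os hos => ⟨fun hm => ?_, fun hm φ => ((h p).2 os hos).2 hm _⟩⟩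
  obtain ⟨s, hs, h1⟩ := ((h p).2 os hos).1 hm
  obtain ⟨s', hs', h2⟩ := hT p os hm
  exact ⟨s * s', by rw [norm_mul, hs, one_mul, hs'], fun φ => by rw [h1, h2, smul_smul]⟩

/-- The words for the unitaries used to move qubits. -/
structure Words where
  bell : List PRef
  bell' : List PRef
  flip : List PRef
  phase : List PRef
  swap : List PRef

structure Words.Ok (W : Words) (w1 : List G.one) (w2 : List G.two) : Prop where
  bell : IsWord w1 w2 W.bell bellM
  bell' : IsWord w1 w2 W.bell' bellM.conjTranspose
  flip : IsWord w1 w2 W.flip xM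
  phase : IsWord w1 w2 W.phase zM
  swap : IsWord w1 w2 W.swap swapM

abbrev Paths (Q : Type) : Type := List (ℕ × List (Q × Q × Q))

def prepEdges (L : Paths Q) : List (Q × Q) := L.flatMap fun t => edges1 t.2

def measEdges (L : Paths Q) : List (Q × Q) := L.flatMap fun t => edges2 t.2

/-- The pairs whose first, resp. second, qubit has to be reset after measurement outcomes `o`. -/
def resetEdges (L : Paths Q) (o : List Bool) : List (Q × Q) :=
  (measEdges L).filter fun e => bits (measEdges L) o e.1

def resetEdges' (L : Paths Q) (o : List Bool) : List (Q × Q) :=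
  ((measEdges L).filter fun e => bits (measEdges L) o e.2).flatMap fun e => [(e.2, e.1)]

/-- The ends of paths that need a bit flip, resp. a phase flip, after measurement outcomes `o`. -/
def flipEdges (L : Paths Q) (o : List Bool) : List (Q × Q) :=
  (L.filter fun t => xorOn (fun h => bits (measEdges L) o h.2.1) t.2).flatMap fun t => lastEdge t.2

def phaseEdges (L : Paths Q) (o : List Bool) : List (Q × Q) :=
  (L.filter fun t => xorOn (fun h => bits (measEdges L) o h.1) t.2).flatMap fun t => lastEdge t.2

/-- Teleportation along all paths in parallel. -/
def transport (W : Words) (L : Paths Q) : List (List (List Bool) → List (Op Q)) :=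
  layer W.bell (fun _ => prepEdges L) ++ (layer W.bell' (fun _ => measEdges L) ++
  ((fun _ => measOps (measEdges L)) ::
  (layer W.flip (fun p => resetEdges L (p.headD [])) ++
  (layer W.flip (fun p => resetEdges' L ((p.drop W.flip.length).headD [])) ++
  (layer W.flip (fun p => flipEdges L ((p.drop (W.flip.length + W.flip.length)).headD [])) ++
  layer W.phase (fun p =>
    phaseEdges L ((p.drop (W.flip.length + W.flip.length + W.flip.length)).headD [])))))))

/-- Only the measurement timestep has outcomes, namely two bits for each hop. -/
def transportProf (W : Words) (L : Paths Q) : List ℕ :=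
  List.replicate W.bell.length 0 ++ (List.replicate W.bell'.length 0 ++
    (2 * (measEdges L).length :: (List.replicate W.flip.length 0 ++ (List.replicate W.flip.length 0 ++
      (List.replicate W.flip.length 0 ++ List.replicate W.phase.length 0)))))

theorem pairQubits_sublist {E E' : List (Q × Q)} (h : E.Sublist E') :
    (pairQubits E).Sublist (pairQubits E') := by
  induction h with
  | slnil => exact List.Sublist.refl _
  | cons a _ ih => exact (ih.cons _).cons _
  | cons_cons a _ ih => exact (ih.cons_cons _).cons_cons _

theorem pairQubits_swap (E : List (Q × Q)) :
    (pairQubits (E.flatMap fun e => [(e.2, e.1)])).Perm (pairQubits E) := by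
  induction E with
  | nil => exact List.Perm.refl _
  | cons e E ih => exact (List.Perm.swap _ _ _).trans ((ih.cons _).cons _)

theorem pairQubits_flatMap {T : Type} (L : List T) (f : T → List (Q × Q)) :
    pairQubits (L.flatMap f) = L.flatMap fun t => pairQubits (f t) := by
  simp [pairQubits, List.flatMap_assoc]

theorem flatMap_filter_sublist {T : Type} (L : List T) (b : T → Bool) (f : T → List (Q × Q)) :
    ((L.filter b).flatMap f).Sublist (L.flatMap f) := List.Sublist.flatMap List.filter_sublist f

/-- Pairs belonging to different routes lie on disjoint tracks, so disjointness has to be checked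
only within single paths. -/
theorem nodup_of_routes {π π' : ℕ → Q} {L : Paths Q} (h : Routes π π' L)
    (f : List (Q × Q × Q) → List (Q × Q)) (hf : ∀ t ∈ L, (pairQubits (f t.2)).Nodup)
    (hsub : ∀ t ∈ L, ∀ q ∈ pairQubits (f t.2), q ∈ π t.1 :: cells t.2) :
    (pairQubits (L.flatMap fun t => f t.2)).Nodup := by
  rw [pairQubits_flatMap, List.nodup_flatMap]
  refine ⟨hf, List.Pairwise.imp_of_mem ?_ h.disj⟩
  intro a b ha hb hab q hq hq'
  exact hab (hsub a ha q hq) (hsub b hb q hq')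

theorem prepEdges_nodup {π π' : ℕ → Q} {L : Paths Q} (h : Routes π π' L) :
    (pairQubits (prepEdges L)).Nodup := by
  have e : ∀ P : List (Q × Q × Q), pairQubits (edges1 P) = cells P := fun P => by
    simp [pairQubits, edges1, List.flatMap_map, cells]
  refine nodup_of_routes h edges1 (fun t ht => ?_) fun t ht q hq => ?_
  · rw [e]; exact (List.nodup_cons.1 (h.nodup t ht)).2
  · rw [e] at hq; exact List.mem_cons_of_mem _ hq

theorem measEdges_nodup {π π' : ℕ → Q} {L : Paths Q} (h : Routes π π' L) :
    (pairQubits (measEdges L)).Nodup := by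
  refine nodup_of_routes h edges2 (fun t ht => edges2_nodup (h.path t ht) (h.nodup t ht))
    fun t ht q hq => ?_
  rw [← edges2_cells (h.path t ht)]
  refine List.mem_append_left _ ?_
  simpa [pairQubits, edges2, List.flatMap_map] using hq

theorem lastEdges_nodup {π π' : ℕ → Q} {L : Paths Q} (h : Routes π π' L) :
    (pairQubits (L.flatMap fun t => lastEdge t.2)).Nodup := by
  refine nodup_of_routes h lastEdge (fun t ht => ?_) fun t ht q hq => ?_
  · by_cases h0 : t.2 = []
    · rw [h0]; exact List.nodup_nil
    · obtain ⟨v, h1, h2, _⟩ := lastEdge_of_isPath (h.path t ht) h0 (h.nodup t ht)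
      rw [h1]; simpa [pairQubits] using h2
  · by_cases h0 : t.2 = []
    · rw [h0] at hq; simp [pairQubits, lastEdge] at hq
    · obtain ⟨v, h1, _, h3, h4⟩ := lastEdge_of_isPath (h.path t ht) h0 (h.nodup t ht)
      rw [h1] at hq
      simp only [pairQubits, List.flatMap_cons, List.flatMap_nil, List.mem_append, List.mem_cons,
        List.not_mem_nil, or_false] at hq
      rcases hq with rfl | rfl
      · exact List.mem_cons_of_mem _ h4
      · exact List.mem_cons_of_mem _ h3

theorem resetEdges_nodup {π π' : ℕ → Q} {L : Paths Q} (h : Routes π π' L) (o : List Bool) :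
    (pairQubits (resetEdges L o)).Nodup :=
  (measEdges_nodup h).sublist (pairQubits_sublist List.filter_sublist)

theorem resetEdges'_nodup {π π' : ℕ → Q} {L : Paths Q} (h : Routes π π' L) (o : List Bool) :
    (pairQubits (resetEdges' L o)).Nodup :=
  (pairQubits_swap _).nodup_iff.2
    ((measEdges_nodup h).sublist (pairQubits_sublist List.filter_sublist))

theorem flipEdges_nodup {π π' : ℕ → Q} {L : Paths Q} (h : Routes π π' L) (o : List Bool) :
    (pairQubits (flipEdges L o)).Nodup :=
  (lastEdges_nodup h).sublist (pairQubits_sublist (flatMap_filter_sublist _ _ _))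

theorem phaseEdges_nodup {π π' : ℕ → Q} {L : Paths Q} (h : Routes π π' L) (o : List Bool) :
    (pairQubits (phaseEdges L o)).Nodup :=
  (lastEdges_nodup h).sublist (pairQubits_sublist (flatMap_filter_sublist _ _ _))

theorem length_measEdges (L : Paths Q) : (measEdges L).length = (L.map fun t => t.2.length).sum := by
  induction L with
  | nil => rfl
  | cons t L ih =>
    have : measEdges (t :: L) = edges2 t.2 ++ measEdges L := rfl
    rw [this, List.length_append, ih]; simp [edges2]

theorem length_prepEdges (L : Paths Q) : (prepEdges L).length = (L.map fun t => t.2.length).sum := by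
  induction L with
  | nil => rfl
  | cons t L ih =>
    have : prepEdges (t :: L) = edges1 t.2 ++ prepEdges L := rfl
    rw [this, List.length_append, ih]; simp [edges1]

theorem length_lastEdges (L : Paths Q) :
    (L.flatMap fun t => lastEdge t.2).length ≤ (L.map fun t => t.2.length).sum := by
  induction L with
  | nil => exact le_rfl
  | cons t L ih =>
    rw [List.flatMap_cons, List.length_append, List.map_cons, List.sum_cons]
    refine add_le_add ?_ ih
    unfold lastEdge
    rw [List.length_map]
    cases t.2 with
    | nil => simp
    | cons a l => cases h : (a :: l).getLast? <;> simp

/-- Combines the semantics of the layers with the algebra of teleportation: the layers apply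
`transportOps` for the outcome function read off from the measurement timestep, and this amounts to
moving the register. -/
theorem transport_block {C : Circuit Q G} {W : Words} (hW : W.Ok C.wired1 C.wired2) {π π' : ℕ → Q}
    (hπ : Function.Injective π) {L : Paths Q} (h : Routes π π' L) :
    Block C (transport W L) (transportProf W L) π π' := by
  let β : List Bool → Q → Bool := bits (measEdges L)
  let T : List Bool → List (M4 × Q × Q) := fun o =>
    (resetEdges L o).map (fun e => (xM, e)) ++ ((resetEdges' L o).map (fun e => (xM, e)) ++
      ((flipEdges L o).map (fun e => (xM, e)) ++ (phaseEdges L o).map fun e => (zM, e)))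
  let M : List Bool → List (M4 × Q × Q) := fun o =>
    (measEdges L).map fun e => (proj1 (β o e.1) ⊗ₖ proj1 (β o e.2), e)
  -- The outcome lists of the correction layers pile up in front of `o`; dropping as many lists as
  -- these layers have timesteps makes `o` the head again.
  have hT : ∀ (o : List Bool) (p : List (List Bool)), Sem C
      (layer W.flip (fun p => resetEdges L (p.headD [])) ++
      (layer W.flip (fun p => resetEdges' L ((p.drop W.flip.length).headD [])) ++
      (layer W.flip (fun p => flipEdges L ((p.drop (W.flip.length + W.flip.length)).headD [])) ++
      layer W.phase (fun p =>
        phaseEdges L ((p.drop (W.flip.length + W.flip.length + W.flip.length)).headD [])))))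
      (List.replicate W.flip.length 0 ++ (List.replicate W.flip.length 0 ++
      (List.replicate W.flip.length 0 ++ List.replicate W.phase.length 0))) (o :: p) fun _ => T o := by
    intro o p
    refine Sem.append' (sem_layer hW.flip _ _ (by exact resetEdges_nodup h _)) fun os1 h1 =>
      Sem.append' ?_ fun os2 h2 => Sem.append' ?_ fun os3 h3 => ?_
    all_goals rw [length_layer] at h1
    · have := sem_layer hW.flip (fun p => resetEdges' L ((p.drop W.flip.length).headD []))
        (os1.reverse ++ o :: p) (resetEdges'_nodup h _)
      simpa [← h1, List.drop_left'] using this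
    · rw [length_layer] at h2
      have := sem_layer hW.flip (fun p => flipEdges L ((p.drop (W.flip.length + W.flip.length)).headD []))
        (os2.reverse ++ (os1.reverse ++ o :: p)) (flipEdges_nodup h _)
      have e : ((os2.reverse ++ (os1.reverse ++ o :: p)).drop (W.flip.length + W.flip.length)) = o :: p := by
        rw [← List.append_assoc]
        exact List.drop_left' (by simp [h1, h2])
      simpa only [e, List.headD_cons] using this
    · rw [length_layer] at h2 h3
      have := sem_layer hW.phase (fun p =>
          phaseEdges L ((p.drop (W.flip.length + W.flip.length + W.flip.length)).headD []))
        (os3.reverse ++ (os2.reverse ++ (os1.reverse ++ o :: p))) (phaseEdges_nodup h _)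
      have e : ((os3.reverse ++ (os2.reverse ++ (os1.reverse ++ o :: p))).drop
          (W.flip.length + W.flip.length + W.flip.length)) = o :: p := by
        rw [← List.append_assoc, ← List.append_assoc]
        exact List.drop_left' (by simp [h1, h2, h3]; omega)
      simpa only [e, List.headD_cons] using this
  have hM : ∀ p : List (List Bool), Sem C _ _ p _ := fun p =>
    Sem.cons (C := C) (p := p) (f := fun _ => measOps (measEdges L)) (numMeas_measOps (measEdges L))
      (hT [] []).1 (A := M) (fun o ho ψ => applyOps_measOps (measEdges_nodup h) ho ψ)
      (fun o => hT o p)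
  have hall : ∀ p, Sem C (transport W L) (transportProf W L) p _ := fun p =>
    Sem.append (sem_layer hW.bell (fun _ => prepEdges L) p (prepEdges_nodup h)) fun os1 _ =>
      Sem.append (sem_layer hW.bell' (fun _ => measEdges L) _ (measEdges_nodup h)) fun os2 _ => hM _
  refine Sem.block hall fun p os hm => ?_
  generalize ((os.drop (layer W.bell fun _ => prepEdges L).length).drop
    (layer W.bell' fun _ => measEdges L).length).headD [] = o
  obtain ⟨s, hs, hp⟩ := (Routes.place (β o) L π' π hπ h).2
  refine ⟨s, ?_, fun φ => ?_⟩
  -- Each hop contributes `1 / 2` to the norm of the scalar and two outcome bits, so the squared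
  -- norm is one factor `1 / 2` per bit.
  · have hsum : (transportProf W L).sum = (L.map fun t => t.2.length).sum * 2 := by
      simp only [transportProf, List.sum_append, List.sum_cons, List.sum_replicate, smul_zero,
        length_measEdges]
      omega
    rw [hs, hsum, ← pow_mul]
  · rw [← hp, ← act_transportOps (β o) h]
    have e2 : ∀ ψ, act ((resetEdges L o).map fun e => (xM, e)) ψ =
        act ((measEdges L).map fun e => (condM (β o e.1) xM, e)) ψ := fun ψ => by
      have := act_filter_map (measEdges L) (fun e => β o e.1) xM (fun e => [e]) ψ
      simp only [List.flatMap_singleton', List.map_cons, List.map_nil, ← List.map_eq_flatMap] at this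
      exact this
    have e3 : ∀ ψ, act ((resetEdges' L o).map fun e => (xM, e)) ψ =
        act ((measEdges L).map fun e => (condM (β o e.2) xM, e.2, e.1)) ψ := fun ψ => by
      have := act_filter_map (measEdges L) (fun e => β o e.2) xM (fun e => [(e.2, e.1)]) ψ
      rw [List.map_eq_flatMap (l := measEdges L)]
      exact this
    have e4 : ∀ ψ, act ((flipEdges L o).map fun e => (xM, e)) ψ =
        act (L.flatMap fun t => corrX (β o) t.2) ψ := fun ψ => act_filter_map L _ xM _ ψ
    have e5 : ∀ ψ, act ((phaseEdges L o).map fun e => (zM, e)) ψ =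
        act (L.flatMap fun t => corrZ (β o) t.2) ψ := fun ψ => act_filter_map L _ zM _ ψ
    simp only [transportOps, act_append, T, M, e2, e3, e4, e5]
    rfl

/-- Exchange of the pairs of `L`. -/
def exchange (W : Words) (L : List (ℕ × Q × Q)) : List (List (List Bool) → List (Op Q)) :=
  layer W.swap fun _ => L.map Prod.snd

theorem exchange_block {C : Circuit Q G} {W : Words} (hW : W.Ok C.wired1 C.wired2) {π π' : ℕ → Q}
    (hπ : Function.Injective π) {L : List (ℕ × Q × Q)} (h : Swaps π π' L)
    (hn : (pairQubits (L.map Prod.snd)).Nodup) :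
    Block C (exchange W L) (List.replicate W.swap.length 0) π π' := by
  refine Sem.block (fun p => sem_layer hW.swap (fun _ => L.map Prod.snd) p hn) fun p os _ => ?_
  refine ⟨1, by simp, fun φ => ?_⟩
  rw [List.map_map, one_smul]
  exact (Swaps.place L π' π hπ h).2 φ

/-! ### Legality and resources -/

/-- The operations form a legal timestep on `A`, act inside `S`, and are at most `b` in number. -/
structure OpsOk (C : Circuit Q G) (A : Architecture Q) (S : Set Q) (b : ℕ) (l : List (Op Q)) :
    Prop where
  nodup : (l.flatMap Op.qubits).Nodup
  allowed : ∀ o ∈ l, C.Allowed A o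
  region : ∀ o ∈ l, ∀ q ∈ o.qubits, q ∈ S
  length : l.length ≤ b

/-- Adjacency is required in both directions because a word may use two-qubit gates in both
orientations. -/
structure EdgesOk (A : Architecture Q) (S : Set Q) (b : ℕ) (E : List (Q × Q)) : Prop where
  nodup : (pairQubits E).Nodup
  adj : ∀ e ∈ E, A.adj e.1 e.2 ∧ A.adj e.2 e.1
  region : ∀ e ∈ E, e.1 ∈ S ∧ e.2 ∈ S
  length : E.length ≤ b

theorem EdgesOk.opsOk {C : Circuit Q G} {A : Architecture Q} {S : Set Q} {b : ℕ} {E : List (Q × Q)}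
    (h : EdgesOk A S b E) {r : PRef} {V : M4} (hr : Means C.wired1 C.wired2 r V) :
    OpsOk C A S b (E.map r.op) := by
  have hsub : ∀ e : Q × Q, ∀ q ∈ (r.op e).qubits, q ∈ [e.1, e.2] := by
    intro e q hq
    cases r <;> simp [PRef.op, Op.qubits] at hq ⊢ <;> tauto
  have hnd := List.nodup_flatMap.1 h.nodup
  refine ⟨?_, ?_, ?_, by simpa using h.length⟩
  · rw [List.flatMap_map, List.nodup_flatMap]
    refine ⟨fun e he => ?_, hnd.2.imp fun {a b} hab q hq hq' =>
      @hab q (hsub _ _ hq) (hsub _ _ hq')⟩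
    have := hnd.1 e he
    cases r <;> simp [PRef.op, Op.qubits] at this ⊢
    · exact this
    · exact Ne.symm this
  · intro o ho
    obtain ⟨e, he, rfl⟩ := List.mem_map.1 ho
    cases r <;> obtain ⟨U, hU, _⟩ := hr
    · exact Option.isSome_iff_exists.2 ⟨U, hU⟩
    · exact Option.isSome_iff_exists.2 ⟨U, hU⟩
    · exact ⟨Option.isSome_iff_exists.2 ⟨U, hU⟩, (h.adj e he).1⟩
    · exact ⟨Option.isSome_iff_exists.2 ⟨U, hU⟩, (h.adj e he).2⟩
  · intro o ho q hq
    obtain ⟨e, he, rfl⟩ := List.mem_map.1 ho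
    have := hsub e q hq
    simp only [List.mem_cons, List.not_mem_nil, or_false] at this
    rcases this with rfl | rfl
    · exact (h.region e he).1
    · exact (h.region e he).2

theorem EdgesOk.measOps {C : Circuit Q G} {A : Architecture Q} {S : Set Q} {b : ℕ} {E : List (Q × Q)}
    (h : EdgesOk A S b E) : OpsOk C A S (2 * b) (measOps E) := by
  refine ⟨?_, ?_, ?_, ?_⟩
  · have : (QArch.measOps E).flatMap Op.qubits = pairQubits E := by
      unfold QArch.measOps
      induction pairQubits E with
      | nil => rfl
      | cons a l ih => simp [Op.qubits, ih]
    rw [this]; exact h.nodup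
  · intro o ho
    obtain ⟨q, _, rfl⟩ := List.mem_map.1 ho
    trivial
  · intro o ho q' hq'
    obtain ⟨q, hq, rfl⟩ := List.mem_map.1 ho
    obtain rfl : q' = q := by simpa [Op.qubits] using hq'
    obtain ⟨e, he, hq⟩ := List.mem_flatMap.1 hq
    simp only [List.mem_cons, List.not_mem_nil, or_false] at hq
    rcases hq with rfl | rfl
    · exact (h.region e he).1
    · exact (h.region e he).2
  · have h1 : (QArch.measOps E).length = 2 * E.length := by
      rw [QArch.measOps, List.length_map]
      induction E with
      | nil => rfl
      | cons e E ih =>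
        have : pairQubits (e :: E) = e.1 :: e.2 :: pairQubits E := rfl
        rw [this]
        have := ih ⟨(h.nodup.sublist (pairQubits_sublist (List.sublist_cons_self _ _))),
          fun e he => h.adj e (List.mem_cons_of_mem _ he),
          fun e he => h.region e (List.mem_cons_of_mem _ he), by
            have := h.length; simp at this; omega⟩
        simp [this]; omega
    have := h.length
    omega

theorem EdgesOk.sublist {A : Architecture Q} {S : Set Q} {b : ℕ} {E E' : List (Q × Q)}
    (h : EdgesOk A S b E) (hs : E'.Sublist E) : EdgesOk A S b E' :=
  ⟨h.nodup.sublist (pairQubits_sublist hs), fun e he => h.adj e (hs.subset he),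
    fun e he => h.region e (hs.subset he), hs.length_le.trans h.length⟩

theorem EdgesOk.swap {A : Architecture Q} {S : Set Q} {b : ℕ} {E : List (Q × Q)}
    (h : EdgesOk A S b E) : EdgesOk A S b (E.flatMap fun e => [(e.2, e.1)]) := by
  have hm : ∀ e ∈ E.flatMap (fun e => [(e.2, e.1)]), (e.2, e.1) ∈ E := by
    intro e he
    obtain ⟨e', he', h1⟩ := List.mem_flatMap.1 he
    obtain rfl : e = (e'.2, e'.1) := by simpa using h1
    exact he'
  refine ⟨(pairQubits_swap _).nodup_iff.2 h.nodup, fun e he => (h.adj _ (hm e he)).symm,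
    fun e he => (h.region _ (hm e he)).symm, ?_⟩
  rw [← List.map_eq_flatMap, List.length_map]
  exact h.length

theorem OpsOk.mono {C : Circuit Q G} {A : Architecture Q} {S : Set Q} {b b' : ℕ} {l : List (Op Q)}
    (h : OpsOk C A S b l) (hb : b ≤ b') : OpsOk C A S b' l :=
  ⟨h.nodup, h.allowed, h.region, h.length.trans hb⟩

theorem layer_opsOk {C : Circuit Q G} {A : Architecture Q} {S : Set Q} {b : ℕ} {wd : List PRef}
    {U : M4} (hw : IsWord C.wired1 C.wired2 wd U) : ∀ E : List (List Bool) → List (Q × Q),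
    (∀ p, EdgesOk A S b (E p)) → ∀ f ∈ layer wd E, ∀ p, OpsOk C A S b (f p) := by
  obtain ⟨c, _, hw⟩ := hw
  generalize c • U = V at hw
  induction hw with
  | nil => intro E _ f hf; simp [layer] at hf
  | cons hr _ ih =>
    intro E hE f hf p
    rcases List.mem_cons.1 hf with rfl | hf
    · exact (hE p).opsOk hr
    · exact ih (fun p => E p.tail) (fun p => hE _) f hf p

/-- The factor `2` is due to the measurement timestep, with two operations per hop; all other
timesteps have at most one operation per hop. -/
theorem transport_opsOk {C : Circuit Q G} {W : Words} (hW : W.Ok C.wired1 C.wired2) {π π' : ℕ → Q}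
    {L : Paths Q} (h : Routes π π' L) {A : Architecture Q} {S : Set Q}
    (hadj : ∀ t ∈ L, ∀ e ∈ t.2, (A.adj e.1 e.2.1 ∧ A.adj e.2.1 e.1) ∧
      (A.adj e.2.1 e.2.2 ∧ A.adj e.2.2 e.2.1))
    (hS : ∀ t ∈ L, ∀ e ∈ t.2, e.1 ∈ S ∧ e.2.1 ∈ S ∧ e.2.2 ∈ S) :
    ∀ f ∈ transport W L, ∀ p, OpsOk C A S (2 * (L.map fun t => t.2.length).sum) (f p) := by
  have h1 : EdgesOk A S (L.map fun t => t.2.length).sum (prepEdges L) := by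
    refine ⟨prepEdges_nodup h, ?_, ?_, (length_prepEdges L).le⟩ <;> intro e he <;>
      obtain ⟨t, ht, he⟩ := List.mem_flatMap.1 he <;> obtain ⟨x, hx, rfl⟩ := List.mem_map.1 he
    · exact (hadj t ht x hx).2
    · exact (hS t ht x hx).2
  have h2 : EdgesOk A S (L.map fun t => t.2.length).sum (measEdges L) := by
    refine ⟨measEdges_nodup h, ?_, ?_, (length_measEdges L).le⟩ <;> intro e he <;>
      obtain ⟨t, ht, he⟩ := List.mem_flatMap.1 he <;> obtain ⟨x, hx, rfl⟩ := List.mem_map.1 he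
    · exact (hadj t ht x hx).1
    · exact ⟨(hS t ht x hx).1, (hS t ht x hx).2.1⟩
  have h3 : EdgesOk A S (L.map fun t => t.2.length).sum (L.flatMap fun t => lastEdge t.2) := by
    refine ⟨lastEdges_nodup h, ?_, ?_, length_lastEdges L⟩ <;> intro e he <;>
      obtain ⟨t, ht, he⟩ := List.mem_flatMap.1 he <;> obtain ⟨x, hx, rfl⟩ := List.mem_map.1 he <;>
      have hx := List.mem_of_mem_getLast? (Option.mem_toList.1 hx)
    · exact (hadj t ht x hx).2.symm
    · exact (hS t ht x hx).2.symm
  intro f hf p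
  simp only [transport, List.mem_append, List.mem_cons] at hf
  rcases hf with hf | hf | hf | hf | hf | hf | hf
  · exact (layer_opsOk hW.bell _ (fun _ => h1) f hf p).mono (by omega)
  · exact (layer_opsOk hW.bell' _ (fun _ => h2) f hf p).mono (by omega)
  · rw [hf]; exact h2.measOps
  · exact (layer_opsOk hW.flip _ (fun _ => h2.sublist List.filter_sublist) f hf p).mono (by omega)
  · exact (layer_opsOk hW.flip _ (fun _ => (h2.sublist List.filter_sublist).swap) f hf p).mono (by omega)
  · exact (layer_opsOk hW.flip _ (fun _ => h3.sublist (flatMap_filter_sublist _ _ _)) f hf p).mono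
      (by omega)
  · exact (layer_opsOk hW.phase _ (fun _ => h3.sublist (flatMap_filter_sublist _ _ _)) f hf p).mono
      (by omega)

end
end QArch

namespace QArch
set_option linter.unusedSectionVars false
set_option linter.unusedSimpArgs false

/-! ## Simulation of one circuit by another, round by round -/

/-- Splits an outcome history (last outcomes first) into rounds of `K` timesteps: the outcomes at
position `b` of each complete round, and the outcomes of the incomplete last round. -/
def dec (b K : ℕ) : List (List Bool) → List (List Bool) × List (List Bool)
  | [] => ([], [])
  | o :: h => if (dec b K h).2.length + 1 = K then ((o :: (dec b K h).2).getD b [] :: (dec b K h).1, [])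
      else ((dec b K h).1, o :: (dec b K h).2)

theorem dec_append {b K : ℕ} {h₀ h : List (List Bool)} (h0 : dec b K h₀ = (h, []))
    (p : List (List Bool)) (hp : p.length < K) : dec b K (p ++ h₀) = (h, p) := by
  induction p with
  | nil => exact h0
  | cons o p ih =>
    simp only [List.length_cons] at hp
    rw [List.cons_append, dec, ih (by omega), if_neg (by dsimp only; omega)]

theorem dec_full {b K : ℕ} {h₀ h : List (List Bool)} (h0 : dec b K h₀ = (h, []))
    (p : List (List Bool)) (hp : p.length = K) (hK : 0 < K) :
    dec b K (p ++ h₀) = (p.getD b [] :: h, []) := by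
  cases p with
  | nil => simp at hp; omega
  | cons o p =>
    simp only [List.length_cons] at hp
    rw [List.cons_append, dec, dec_append h0 p (by omega), if_pos hp]

theorem dec_spec {b K : ℕ} (hK : 0 < K) (h' : List (List Bool)) :
    (dec b K h').2.length < K ∧ ∃ h₀, h' = (dec b K h').2 ++ h₀ ∧ dec b K h₀ = ((dec b K h').1, []) := by
  induction h' with
  | nil => exact ⟨hK, [], rfl, rfl⟩
  | cons o h' ih =>
    obtain ⟨h1, h₀, h2, h3⟩ := ih
    rw [dec]
    split
    · rename_i hl
      refine ⟨hK, o :: h', rfl, ?_⟩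
      rw [dec, if_pos hl]
    · rename_i hl
      refine ⟨by simp only [List.length_cons]; omega, h₀, ?_, h3⟩
      rw [List.cons_append, ← h2]

theorem dec_cons_inv {b K : ℕ} (hK : 0 < K) {h' h : List (List Bool)} {o : List Bool}
    (hd : dec b K h' = (o :: h, [])) :
    ∃ p h₀, h' = p ++ h₀ ∧ p.length = K ∧ dec b K h₀ = (h, []) ∧ p.getD b [] = o := by
  cases h' with
  | nil => simp [dec] at hd
  | cons o' h' =>
    obtain ⟨h1, h₀, h2, h3⟩ := dec_spec (b := b) hK h'
    rw [dec] at hd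
    split at hd
    · rename_i hl
      simp only [Prod.mk.injEq, List.cons.injEq, and_true] at hd
      exact ⟨o' :: (dec b K h').2, h₀, by rw [List.cons_append, ← h2], hl, by rw [h3, hd.2], hd.1⟩
    · simp at hd

theorem dec_nil_inv {b K : ℕ} {h' : List (List Bool)} (hd : dec b K h' = ([], [])) : h' = [] := by
  cases h' with
  | nil => rfl
  | cons o' h' =>
    rw [dec] at hd
    split at hd <;> simp at hd

theorem length_dec {b K : ℕ} (h' : List (List Bool)) :
    h'.length = K * (dec b K h').1.length + (dec b K h').2.length := by
  induction h' with
  | nil => rfl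
  | cons o h' ih =>
    rw [dec]
    split
    · simp only [List.length_cons, List.length_nil, mul_add, mul_one] at *; omega
    · simp only [List.length_cons] at *; omega

/-- Rounds of a single timestep are used for relabelling, where histories need no decoding. -/
theorem dec_one (h : List (List Bool)) : dec 0 1 h = (h, []) := by
  induction h with
  | nil => rfl
  | cons o h ih => rw [dec, ih]; simp

/-! ### Counting outcome lists. -/

/-- The lists of a given length, and the lists with given lengths of entries. -/
theorem exists_bits_finset (m : ℕ) : ∃ F : Finset (List Bool), (∀ o, o ∈ F ↔ o.length = m) ∧
    F.card = 2 ^ m := by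
  induction m with
  | zero => exact ⟨{[]}, fun o => by simp, rfl⟩
  | succ m ih =>
    obtain ⟨F, h1, h2⟩ := ih
    refine ⟨(Finset.univ ×ˢ F).image fun x : Bool × List Bool => x.1 :: x.2, fun o => ?_, ?_⟩
    · simp only [Finset.mem_image, Finset.mem_product, Finset.mem_univ, true_and, Prod.exists, h1]
      constructor
      · rintro ⟨b, o, h, rfl⟩; simp [h]
      · intro h
        cases o with
        | nil => simp at h
        | cons b o => exact ⟨b, o, by simpa using h, rfl⟩
    · rw [Finset.card_image_of_injective, Finset.card_product, h2, pow_succ']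
      · rfl
      · rintro ⟨b, o⟩ ⟨b', o'⟩ h; simpa using h

theorem exists_prof_finset (L : List ℕ) : ∃ F : Finset (List (List Bool)),
    (∀ os, os ∈ F ↔ os.map List.length = L) ∧ F.card = 2 ^ L.sum := by
  induction L with
  | nil => exact ⟨{[]}, fun o => by simp, rfl⟩
  | cons m L ih =>
    obtain ⟨F, h1, h2⟩ := ih
    obtain ⟨E, h3, h4⟩ := exists_bits_finset m
    refine ⟨(E ×ˢ F).image fun x : List Bool × List (List Bool) => x.1 :: x.2, fun o => ?_, ?_⟩
    · simp only [Finset.mem_image, Finset.mem_product, Prod.exists, h1, h3]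
      constructor
      · rintro ⟨b, o, ⟨h, h'⟩, rfl⟩; simp [h, h']
      · intro h
        cases o with
        | nil => simp at h
        | cons b o => exact ⟨b, o, by simpa using h, rfl⟩
    · rw [Finset.card_image_of_injective, Finset.card_product, h2, h4, List.sum_cons, pow_add]
      rintro ⟨b, o⟩ ⟨b', o'⟩ h; simpa using h

section

variable {Q : Type} [DecidableEq Q] [Coded Q] {G : GateSet}

/-! ### Amplitudes and possible histories. -/

theorem amp_cons_some {C : Circuit Q G} {A : Architecture Q} {xs rs : List Bool} {n : ℕ}
    {d : Fin n → Bool} {h : List (List Bool)} {o : List Bool} {l : List (Op Q)}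
    (hl : C.next xs rs h = some l) :
    C.amp A xs rs d (o :: h) = C.applyOps l o (C.amp A xs rs d h) := by
  simp only [Circuit.amp, hl]

theorem amp_cons_none {C : Circuit Q G} {A : Architecture Q} {xs rs : List Bool} {n : ℕ}
    {d : Fin n → Bool} {h : List (List Bool)} {o : List Bool} (hl : C.next xs rs h = none) :
    C.amp A xs rs d (o :: h) = 0 := by
  simp only [Circuit.amp, hl]

theorem amp_append_zero {C : Circuit Q G} {A : Architecture Q} {xs rs : List Bool} {n : ℕ}
    {d : Fin n → Bool} {h : List (List Bool)} (h0 : C.amp A xs rs d h = 0) (p : List (List Bool)) :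
    C.amp A xs rs d (p ++ h) = 0 := by
  induction p with
  | nil => exact h0
  | cons o p ih =>
    rw [List.cons_append]
    cases hn : C.next xs rs (p ++ h) with
    | none => exact amp_cons_none hn
    | some l => rw [amp_cons_some hn, ih, applyOps_zero]

theorem Possible.of_cons {C : Circuit Q G} {A : Architecture Q} {xs rs : List Bool} {n : ℕ}
    {h : List (List Bool)} {o : List Bool} (hp : C.Possible A n xs rs (o :: h)) :
    C.Possible A n xs rs h := by
  obtain ⟨d, hd⟩ := hp
  exact ⟨d, fun h0 => hd (amp_append_zero h0 [o])⟩

theorem unitary_apply1_ne_zero (U : Matrix.unitaryGroup Bool ℂ) (q : Q) {ψ : (Q → Bool) → ℂ}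
    (h : ψ ≠ 0) : apply1 (U.val : Matrix Bool Bool ℂ) q ψ ≠ 0 := by
  intro h0
  apply h
  have h1 : apply1 (star (U.val : Matrix Bool Bool ℂ)) q (apply1 (U.val : Matrix Bool Bool ℂ) q ψ) = ψ := by
    rw [apply1_apply1, Matrix.mem_unitaryGroup_iff'.1 U.2, apply1_one]
  rw [← h1, h0]
  simpa using apply1_smul 0 (star (U.val : Matrix Bool Bool ℂ)) q (0 : (Q → Bool) → ℂ)

theorem unitary_apply2_ne_zero (U : Matrix.unitaryGroup (Bool × Bool) ℂ) {p q : Q} (hpq : p ≠ q)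
    {ψ : (Q → Bool) → ℂ} (h : ψ ≠ 0) : apply2 (U.val : M4) p q ψ ≠ 0 := by
  intro h0
  apply h
  have h1 : apply2 (star (U.val : M4)) p q (apply2 (U.val : M4) p q ψ) = ψ := by
    rw [apply2_apply2 _ _ hpq, Matrix.mem_unitaryGroup_iff'.1 U.2, apply2_one]
  rw [← h1, h0]
  simpa using apply2_smul 0 (star (U.val : M4)) p q (0 : (Q → Bool) → ℂ)

/-- Some outcome has a nonzero amplitude. -/
theorem exists_outcome (C : Circuit Q G) (A : Architecture Q) (l : List (Op Q))
    (hn : (l.flatMap Op.qubits).Nodup) (ha : ∀ o ∈ l, C.Allowed A o) :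
    ∀ ψ : (Q → Bool) → ℂ, ψ ≠ 0 → ∃ o, C.applyOps l o ψ ≠ 0 := by
  induction l with
  | nil => intro ψ h; exact ⟨[], h⟩
  | cons x l ih =>
    rw [List.flatMap_cons, List.nodup_append] at hn
    have ih := ih hn.2.1 fun o ho => ha o (List.mem_cons_of_mem _ ho)
    have hx := ha x List.mem_cons_self
    intro ψ h
    cases x with
    | meas q =>
      have : ∃ b, project q b ψ ≠ 0 := by
        by_contra hc
        push Not at hc
        apply h
        funext c
        have := congrFun (hc (c q)) c
        simpa [project] using this
      obtain ⟨b, hb⟩ := this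
      obtain ⟨o, ho⟩ := ih _ hb
      exact ⟨b :: o, ho⟩
    | gate1 g q =>
      obtain ⟨U, hU⟩ := Option.isSome_iff_exists.1 hx
      obtain ⟨o, ho⟩ := ih _ (unitary_apply1_ne_zero U.val q h)
      exact ⟨o, by rw [applyOps_gate1 C hU]; exact ho⟩
    | gate2 g p q =>
      obtain ⟨U, hU⟩ := Option.isSome_iff_exists.1 hx.1
      have hpq : p ≠ q := by
        have := hn.1
        simpa [Op.qubits] using this
      obtain ⟨o, ho⟩ := ih _ (unitary_apply2_ne_zero U.val hpq h)
      exact ⟨o, by rw [applyOps_gate2 C hU]; exact ho⟩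

/-- The histories of bounded length that can occur are finitely many. -/
theorem finite_possible (C : Circuit Q G) (A : Architecture Q) (n : ℕ) (xs rs : List Bool) (D : ℕ)
    (hD : ∀ h, C.Possible A n xs rs h → h.length ≤ D) : {h | C.Possible A n xs rs h}.Finite := by
  have key : ∀ t : ℕ, {h | C.Possible A n xs rs h ∧ h.length = t}.Finite := by
    intro t
    induction t with
    | zero => exact (Set.finite_singleton []).subset fun h hh => List.length_eq_zero_iff.1 hh.2
    | succ t ih =>
      refine (ih.biUnion (t := fun h => (fun o => o :: h) ''
        {o : List Bool | o.length = numMeas ((C.next xs rs h).getD [])}) fun h _ =>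
          ((List.finite_length_eq Bool _).image _)).subset ?_
      rintro h ⟨hp, hl⟩
      cases h with
      | nil => simp at hl
      | cons o h =>
        refine Set.mem_biUnion (x := h) ⟨Possible.of_cons hp, by simpa using hl⟩ ⟨o, ?_, rfl⟩
        obtain ⟨d, hd⟩ := hp
        by_contra hne
        apply hd
        cases hn : C.next xs rs h with
        | none => exact amp_cons_none hn
        | some l =>
          rw [amp_cons_some hn, applyOps_of_length_ne]
          simpa [hn] using hne
  refine ((Set.finite_le_nat D).biUnion fun t _ => key t).subset fun h hh => ?_
  exact Set.mem_biUnion (x := h.length) (hD h hh) ⟨hh, rfl⟩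

/-- The contribution of an outcome history to a matrix entry of the channel. -/
noncomputable def channelTerm (C : Circuit Q G) (A : Architecture Q) {n : ℕ} (xs rs : List Bool)
    (ρ : Matrix (Fin n → Bool) (Fin n → Bool) ℂ) (b b' : Fin n → Bool) (h : List (List Bool)) : ℂ :=
  ∑ᶠ (e : Q → Bool) (_ : ∀ i, e (A.data n i) = false), ∑ a : Fin n → Bool, ∑ a' : Fin n → Bool,
    C.amp A xs rs a h (Function.extend (A.data n) b e) * ρ a a' *
      star (C.amp A xs rs a' h (Function.extend (A.data n) b' e))

/-- Confines sums over histories to the possible ones, which are finitely many when the depth is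
bounded. This matters because `finsum` is `0` by convention on an infinite support. -/
theorem channelTerm_eq_zero {C : Circuit Q G} {A : Architecture Q} {n : ℕ} {xs rs : List Bool}
    {h : List (List Bool)} (hp : ¬ C.Possible A n xs rs h)
    (ρ : Matrix (Fin n → Bool) (Fin n → Bool) ℂ) (b b' : Fin n → Bool) :
    channelTerm C A xs rs ρ b b' h = 0 := by
  have h0 : ∀ d : Fin n → Bool, C.amp A xs rs d h = 0 := by
    intro d; by_contra hd; exact hp ⟨d, hd⟩
  unfold channelTerm
  simp [h0]

end

section

variable {Q Q' : Type} [DecidableEq Q] [Coded Q] [DecidableEq Q'] [Coded Q'] {G : GateSet}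

/-! ### The channel under an embedding of registers. -/

theorem extend_comp {n : ℕ} {π : Q → Q'} (hπ : Function.Injective π) {δ : Fin n → Q}
    {δ' : Fin n → Q'} (hδ : Function.Injective δ) (hd : ∀ i, π (δ i) = δ' i) (b : Fin n → Bool)
    (e : Q' → Bool) : Function.extend δ' b e ∘ π = Function.extend δ b (e ∘ π) := by
  have hδ' : Function.Injective δ' := fun i j hij => hδ (hπ (by rw [hd, hd, hij]))
  funext q
  by_cases hq : ∃ i, δ i = q
  · obtain ⟨i, rfl⟩ := hq
    rw [Function.comp, hd, hδ'.extend_apply, hδ.extend_apply]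
  · rw [Function.extend_apply' _ _ _ hq, Function.comp, Function.extend_apply']
    · rfl
    · rintro ⟨i, hi⟩
      exact hq ⟨i, hπ (by rw [hd, hi])⟩

theorem extend_off_range {n : ℕ} {π : Q → Q'} {δ : Fin n → Q}
    {δ' : Fin n → Q'} (hd : ∀ i, π (δ i) = δ' i) (b : Fin n → Bool)
    (e : Q' → Bool) : (∀ q ∉ Set.range π, Function.extend δ' b e q = false) ↔
      ∀ q ∉ Set.range π, e q = false := by
  refine forall₂_congr fun q hq => ?_
  rw [Function.extend_apply']
  rintro ⟨i, hi⟩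
  exact hq ⟨δ i, by rw [hd, hi]⟩

theorem place_initial {A : Architecture Q} {A' : Architecture Q'} {n : ℕ} {π : Q → Q'}
    (hπ : Function.Injective π) (hδ : Function.Injective (A.data n))
    (hd : ∀ i, π (A.data n i) = A'.data n i) (d : Fin n → Bool) :
    Circuit.initial A' n d = place π (Circuit.initial A n d) := by
  classical
  funext c
  have h1 := extend_comp hπ hδ hd d (fun _ => false)
  have h2 := (extend_off_range hd d (fun _ => false)).2 fun _ _ => rfl
  rw [place_eq Iff.rfl]
  simp only [Circuit.initial]
  by_cases hc : c = Function.extend (A'.data n) d fun _ => false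
  · rw [if_pos hc, hc, if_pos h2, h1]
    exact (if_pos rfl).symm
  · rw [if_neg hc]
    split
    · rename_i h3
      rw [if_neg]
      intro h4
      apply hc
      funext q
      by_cases hq : q ∈ Set.range π
      · obtain ⟨q, rfl⟩ := hq
        exact (congrFun h4 q).trans (congrFun h1 q).symm
      · rw [h3 q hq, h2 q hq]
    · rfl

/-- In the partial trace only those environment configurations contribute that vanish outside the
range of `π`, and they correspond bijectively to environment configurations of the smaller register.
The scalar enters once itself and once conjugated, hence the factor `‖s‖ ^ 2`. -/
theorem channelTerm_place {C : Circuit Q G} {A : Architecture Q} {C' : Circuit Q' G}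
    {A' : Architecture Q'} {n : ℕ} {xs rs : List Bool} {π : Q → Q'}
    (hπ : Function.Injective π) (hδ : Function.Injective (A.data n))
    (hd : ∀ i, π (A.data n i) = A'.data n i) {h h' : List (List Bool)} {s : ℂ}
    (hs : ∀ d : Fin n → Bool, C'.amp A' xs rs d h' = s • place π (C.amp A xs rs d h))
    (ρ : Matrix (Fin n → Bool) (Fin n → Bool) ℂ) (b b' : Fin n → Bool) :
    channelTerm C' A' xs rs ρ b b' h' = (‖s‖ ^ 2 : ℝ) • channelTerm C A xs rs ρ b b' h := by
  classical
  have e1 : channelTerm C' A' xs rs ρ b b' h' = ∑ᶠ e ∈ {e : Q' → Bool | (∀ i, e (A'.data n i) = false) ∧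
      ∀ q ∉ Set.range π, e q = false}, (‖s‖ ^ 2 : ℝ) • ∑ a : Fin n → Bool, ∑ a' : Fin n → Bool,
        C.amp A xs rs a h (Function.extend (A.data n) b (e ∘ π)) * ρ a a' *
      star (C.amp A xs rs a' h (Function.extend (A.data n) b' (e ∘ π))) := by
    unfold channelTerm
    refine finsum_congr fun e => ?_
    have hpl : ∀ (b : Fin n → Bool) (ψ : (Q → Bool) → ℂ), place π ψ (Function.extend (A'.data n) b e) =
        if ∀ q ∉ Set.range π, e q = false then ψ (Function.extend (A.data n) b (e ∘ π)) else 0 := by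
      intro b ψ
      rw [place_eq (extend_off_range hd b e), extend_comp hπ hδ hd]
    by_cases h1 : ∀ i, e (A'.data n i) = false
    · by_cases h2 : ∀ q ∉ Set.range π, e q = false
      · rw [finsum_eq_if, if_pos h1, finsum_eq_if, if_pos (show e ∈ {e : Q' → Bool | (∀ i, e (A'.data n i) = false) ∧
          ∀ q ∉ Set.range π, e q = false} from ⟨h1, h2⟩)]
        simp only [hs, Pi.smul_apply, hpl, if_pos h2, smul_eq_mul, Finset.smul_sum, Complex.real_smul]
        refine Finset.sum_congr rfl fun a _ => Finset.sum_congr rfl fun a' _ => ?_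
        have : ((‖s‖ ^ 2 : ℝ) : ℂ) = s * star s := by
          rw [Complex.star_def, Complex.mul_conj, Complex.normSq_eq_norm_sq]
        rw [this, star_mul']
        ring
      · rw [finsum_eq_if, if_pos h1, finsum_eq_if, if_neg (fun hh : e ∈ {e | _} => h2 hh.2)]
        simp only [hs, Pi.smul_apply, hpl, if_neg h2, smul_eq_mul, mul_zero, zero_mul,
          Finset.sum_const_zero]
    · rw [finsum_eq_if, if_neg h1, finsum_eq_if, if_neg (fun hh : e ∈ {e | _} => h1 hh.1)]
  have e2 : ∑ᶠ e ∈ {e : Q' → Bool | (∀ i, e (A'.data n i) = false) ∧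
      ∀ q ∉ Set.range π, e q = false}, (‖s‖ ^ 2 : ℝ) • ∑ a : Fin n → Bool, ∑ a' : Fin n → Bool,
        C.amp A xs rs a h (Function.extend (A.data n) b (e ∘ π)) * ρ a a' *
      star (C.amp A xs rs a' h (Function.extend (A.data n) b' (e ∘ π))) =
      ∑ᶠ e ∈ {e : Q → Bool | ∀ i, e (A.data n i) = false}, (‖s‖ ^ 2 : ℝ) •
        ∑ a : Fin n → Bool, ∑ a' : Fin n → Bool,
        C.amp A xs rs a h (Function.extend (A.data n) b e) * ρ a a' *
      star (C.amp A xs rs a' h (Function.extend (A.data n) b' e)) := by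
    -- Restriction along `π` is the bijection, with extension by `false` as its inverse. Reindexing
    -- a `finsum` along a bijection needs no finiteness.
    refine finsum_mem_eq_of_bijOn (fun e => e ∘ π) ⟨?_, ?_, ?_⟩ fun e _ => rfl
    · rintro e ⟨h1, _⟩ i
      simp only [Function.comp, hd, h1]
    · rintro e ⟨_, h2⟩ e' ⟨_, h2'⟩ hee
      funext q
      by_cases hq : q ∈ Set.range π
      · obtain ⟨q, rfl⟩ := hq
        exact congrFun hee q
      · rw [h2 q hq, h2' q hq]
    · intro f hf
      refine ⟨Function.extend π f fun _ => false, ⟨fun i => ?_, fun q hq => ?_⟩, ?_⟩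
      · rw [← hd, hπ.extend_apply]; exact hf i
      · rw [Function.extend_apply']; rintro ⟨j, hj⟩; exact hq ⟨j, hj⟩
      · funext q; exact hπ.extend_apply _ _ _
  rw [e1, e2]
  unfold channelTerm
  rw [smul_finsum]
  refine finsum_congr fun e => ?_
  rw [smul_finsum]
  rfl

/-! ### Amplitudes, histories and resources under simulation in rounds. -/

/-- For one input and seed: every timestep of `C` is simulated by a round of timesteps of `C'`, in
which the qubits of `C` have the places `π`; `a` timesteps precede and `b` timesteps follow the one
that has the same outcomes as the timestep of `C`. -/
structure Rounds (C : Circuit Q G) (A : Architecture Q) (C' : Circuit Q' G) (A' : Architecture Q')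
    (a b n : ℕ) (xs rs : List Bool)
    (ph : List (List Bool) → List (Op Q) → List (List (List Bool) → List (Op Q')))
    (π : List (List Bool) → Q → Q') (w : ℕ) (S : Set Q') : Prop where
  next : ∀ h', C'.next xs rs h' = (C.next xs rs (dec b (a + 1 + b) h').1).map fun l =>
    (ph (dec b (a + 1 + b) h').1 l).getD (dec b (a + 1 + b) h').2.length (fun _ => [])
      (dec b (a + 1 + b) h').2
  len : ∀ h l, (ph h l).length = a + 1 + b
  inj : ∀ h, Function.Injective (π h)
  data : ∀ h i, π h (A.data n i) = A'.data n i
  round : ∀ h l, C.Possible A n xs rs h → C.next xs rs h = some l → ∃ L₁ L₂ : List ℕ,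
    L₁.length = a ∧ L₂.length = b ∧ ∀ os₁ o os₂, os₁.length = a → os₂.length = b →
      (os₁.map List.length = L₁ ∧ os₂.map List.length = L₂ →
        ∃ s : ℂ, ‖s‖ ^ 2 = (1 / 2) ^ (L₁.sum + L₂.sum) ∧ ∀ d : Fin n → Bool,
          run C' (ph h l) [] (os₁ ++ o :: os₂) (place (π h) (C.amp A xs rs d h)) =
            s • place (π (o :: h)) (C.amp A xs rs d (o :: h))) ∧
      (¬ (os₁.map List.length = L₁ ∧ os₂.map List.length = L₂) → ∀ d : Fin n → Bool,
          run C' (ph h l) [] (os₁ ++ o :: os₂) (place (π h) (C.amp A xs rs d h)) = 0)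
  ok : ∀ h l, C.Possible A n xs rs h → C.next xs rs h = some l → ∀ f ∈ ph h l, ∀ p,
    OpsOk C' A' S (w * l.length) (f p)

variable {C : Circuit Q G} {A : Architecture Q} {C' : Circuit Q' G} {A' : Architecture Q'}
  {a b n : ℕ} {xs rs : List Bool}
  {ph : List (List Bool) → List (Op Q) → List (List (List Bool) → List (Op Q'))}
  {π : List (List Bool) → Q → Q'} {w : ℕ} {S : Set Q'}

/-- During a round the decoded history stays equal to `h`, so the controller plays the fixed list
`ph h l`. The outcomes `os` are in chronological order, whereas histories have the latest outcome
first; hence the reversal. -/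
theorem Rounds.amp_round (H : Rounds C A C' A' a b n xs rs ph π w S) {h₀ h : List (List Bool)}
    (h0 : dec b (a + 1 + b) h₀ = (h, [])) {l : List (Op Q)} (hl : C.next xs rs h = some l)
    (d : Fin n → Bool) (os : List (List Bool)) (hos : os.length ≤ a + 1 + b) :
    C'.amp A' xs rs d (os.reverse ++ h₀) =
      run C' ((ph h l).take os.length) [] os (C'.amp A' xs rs d h₀) := by
  induction os using List.reverseRecOn with
  | nil => rfl
  | append_singleton os o ih =>
    simp only [List.length_append, List.length_cons, List.length_nil, zero_add] at hos
    have hd := dec_append h0 os.reverse (by rw [List.length_reverse]; omega)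
    have hn := H.next (os.reverse ++ h₀)
    rw [hd, hl] at hn
    simp only [Option.map_some, List.length_reverse] at hn
    have hlt : os.length < (ph h l).length := by rw [H.len]; omega
    rw [List.reverse_append, List.reverse_singleton, List.singleton_append, List.cons_append,
      amp_cons_some hn, ih (by omega), List.length_append, List.length_singleton,
      List.take_succ_eq_append_getElem hlt, run_append C' _ _ _ _ _ _ (by simp [hlt.le])]
    simp only [run, List.append_nil]
    rw [List.getD_eq_getElem _ _ hlt]

theorem Rounds.amp_none (H : Rounds C A C' A' a b n xs rs ph π w S) {h₀ h : List (List Bool)}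
    (h0 : dec b (a + 1 + b) h₀ = (h, [])) (hl : C.next xs rs h = none)
    (d : Fin n → Bool) (p : List (List Bool)) (hp : p ≠ []) :
    C'.amp A' xs rs d (p ++ h₀) = 0 := by
  obtain ⟨p, o, rfl⟩ := List.eq_nil_or_concat p |>.resolve_left hp
  rw [List.concat_eq_append, List.append_assoc]
  refine amp_append_zero (amp_cons_none ?_) p
  have := H.next h₀
  rwa [h0, hl] at this

/-- The histories of `C'` that belong to a history of `C`, all of the same weight. -/
theorem Rounds.exists_fiber (H : Rounds C A C' A' a b n xs rs ph π w S)
    (hδ : Function.Injective (A.data n)) (h : List (List Bool)) :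
    ∃ F : Finset (List (List Bool)), F.Nonempty ∧
      (∀ h' ∈ F, dec b (a + 1 + b) h' = (h, []) ∧ ∃ s : ℂ, ‖s‖ ^ 2 * F.card = 1 ∧
        ∀ d : Fin n → Bool, C'.amp A' xs rs d h' = s • place (π h) (C.amp A xs rs d h)) ∧
      ∀ h', dec b (a + 1 + b) h' = (h, []) → h' ∉ F → ∀ d : Fin n → Bool, C'.amp A' xs rs d h' = 0 := by
  classical
  have hK : 0 < a + 1 + b := by omega
  induction h with
  | nil =>
    refine ⟨{[]}, by simp, ?_, ?_⟩
    · intro h' hh'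
      rw [Finset.mem_singleton] at hh'
      subst hh'
      refine ⟨rfl, 1, by simp, fun d => ?_⟩
      rw [one_smul]
      exact place_initial (H.inj []) hδ (H.data []) d
    · intro h' hd hh'
      exact absurd (dec_nil_inv hd) (by simpa using hh')
  | cons o h ih =>
    obtain ⟨F, hF, h1, h2⟩ := ih
    by_cases hcase : C.Possible A n xs rs h ∧ ∃ l, C.next xs rs h = some l
    · obtain ⟨hp, l, hl⟩ := hcase
      obtain ⟨L₁, L₂, hL1, hL2, hr⟩ := H.round h l hp hl
      obtain ⟨F₁, hF1, hc1⟩ := exists_prof_finset L₁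
      obtain ⟨F₂, hF2, hc2⟩ := exists_prof_finset L₂
      have hlen1 : ∀ os ∈ F₁, os.length = a := fun os hos => by
        rw [← hL1, ← (hF1 os).1 hos, List.length_map]
      have hlen2 : ∀ os ∈ F₂, os.length = b := fun os hos => by
        rw [← hL2, ← (hF2 os).1 hos, List.length_map]
      -- A history over `o :: h` is a history over `h` followed by a round with outcomes `os₁`, `o`,
      -- `os₂`, where `os₁` and `os₂` range over all lists of the shapes `L₁` and `L₂`.
      let Φ : List (List Bool) × List (List Bool) × List (List Bool) → List (List Bool) :=
        fun t => (t.2.1 ++ o :: t.2.2).reverse ++ t.1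
      have hΦ : Set.InjOn Φ (F ×ˢ F₁ ×ˢ F₂ : Finset _) := by
        rintro ⟨h₁, p₁, q₁⟩ hm ⟨h₂, p₂, q₂⟩ hm' he
        simp only [Finset.coe_product, Set.mem_prod, Finset.mem_coe] at hm hm'
        have e1 := hlen1 _ hm.2.1
        have e2 := hlen2 _ hm.2.2
        have e3 := hlen1 _ hm'.2.1
        have e4 := hlen2 _ hm'.2.2
        obtain ⟨e5, rfl⟩ := List.append_inj he (by simp [e1, e2, e3, e4])
        have e6 := List.reverse_injective e5
        obtain ⟨rfl, e7⟩ := List.append_inj e6 (by rw [e1, e3])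
        obtain ⟨_, rfl⟩ := List.cons.inj e7
        rfl
      have hcard : ((F ×ˢ F₁ ×ˢ F₂).image Φ).card = F.card * 2 ^ (L₁.sum + L₂.sum) := by
        rw [Finset.card_image_of_injOn hΦ, Finset.card_product, Finset.card_product, hc1, hc2, pow_add]
      have hget : ∀ os₁ os₂ : List (List Bool), os₂.length = b →
          (os₁ ++ o :: os₂).reverse.getD b [] = o := by
        intro os₁ os₂ h2
        simp [List.getD_eq_getElem?_getD, List.getElem?_append, h2]
      have hamp : ∀ h₀, dec b (a + 1 + b) h₀ = (h, []) → ∀ os₁ os₂ : List (List Bool), os₁.length = a →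
          os₂.length = b → ∀ d : Fin n → Bool, C'.amp A' xs rs d ((os₁ ++ o :: os₂).reverse ++ h₀) =
            run C' (ph h l) [] (os₁ ++ o :: os₂) (C'.amp A' xs rs d h₀) := by
        intro h₀ hd0 os₁ os₂ e1 e2 d
        rw [H.amp_round hd0 hl d _ (by simp [e1, e2]; omega), List.take_of_length_le]
        rw [H.len]; simp [e1, e2]; omega
      refine ⟨(F ×ˢ F₁ ×ˢ F₂).image Φ, ?_, ?_, ?_⟩
      · rw [← Finset.card_pos, hcard]
        exact Nat.mul_pos hF.card_pos (by positivity)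
      · intro h' hh'
        obtain ⟨⟨h₀, os₁, os₂⟩, hm, rfl⟩ := Finset.mem_image.1 hh'
        simp only [Finset.mem_product] at hm
        have e1 := hlen1 _ hm.2.1
        have e2 := hlen2 _ hm.2.2
        obtain ⟨hd0, s, hs, hsA⟩ := h1 h₀ hm.1
        refine ⟨?_, ?_⟩
        · have := dec_full hd0 (os₁ ++ o :: os₂).reverse (by simp [e1, e2]; omega) hK
          rwa [hget _ _ e2] at this
        · obtain ⟨s', hs', hr⟩ := (hr os₁ o os₂ e1 e2).1 ⟨(hF1 _).1 hm.2.1, (hF2 _).1 hm.2.2⟩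
          refine ⟨s * s', ?_, fun d => ?_⟩
          · rw [hcard, norm_mul, mul_pow, hs']
            push_cast
            -- The number of histories is multiplied by a power of two and each weight is divided by
            -- the same power.
            calc ‖s‖ ^ 2 * (1 / 2) ^ (L₁.sum + L₂.sum) * (F.card * 2 ^ (L₁.sum + L₂.sum))
                = (‖s‖ ^ 2 * F.card) * ((1 / 2) * 2) ^ (L₁.sum + L₂.sum) := by rw [mul_pow]; ring
              _ = 1 := by rw [hs]; norm_num
          · simp only [Φ]
            rw [hamp h₀ hd0 _ _ e1 e2, hsA, run_smul, hr, smul_smul]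
      · intro h' hd hh' d
        obtain ⟨p, h₀, rfl, hpl, hd0, hpo⟩ := dec_cons_inv hK hd
        obtain ⟨os₁, os₂, rfl, e1, e2⟩ : ∃ os₁ os₂, p = (os₁ ++ o :: os₂).reverse ∧
            os₁.length = a ∧ os₂.length = b := by
          refine ⟨p.reverse.take a, p.reverse.drop (a + 1), ?_, by simp; omega, by simp; omega⟩
          rw [← List.reverse_inj, List.reverse_reverse]
          have hlt : a < p.reverse.length := by simp; omega
          have : p.reverse[a] = o := by
            rw [List.getElem_reverse, ← hpo, List.getD_eq_getElem _ _ (by omega)]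
            congr 1; omega
          rw [← this, ← List.drop_eq_getElem_cons hlt, List.take_append_drop]
        rw [hamp h₀ hd0 _ _ e1 e2]
        by_cases hm0 : h₀ ∈ F
        · obtain ⟨_, s, _, hsA⟩ := h1 h₀ hm0
          rw [hsA, run_smul, (hr os₁ o os₂ e1 e2).2, smul_zero]
          rintro ⟨e3, e4⟩
          exact hh' (Finset.mem_image.2 ⟨(h₀, os₁, os₂), by
            simp [hm0, (hF1 _).2 e3, (hF2 _).2 e4], rfl⟩)
        · rw [h2 h₀ hd0 hm0, run_zero]
    · -- neither history occurs
      have hz : ∀ d : Fin n → Bool, C.amp A xs rs d (o :: h) = 0 := by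
        intro d
        by_cases hp : C.Possible A n xs rs h
        · cases hn : C.next xs rs h with
          | none => exact amp_cons_none hn
          | some l => exact absurd ⟨hp, l, hn⟩ hcase
        · refine amp_append_zero (p := [o]) ?_
          by_contra hd; exact hp ⟨d, hd⟩
      have hz' : ∀ h', dec b (a + 1 + b) h' = (o :: h, []) → ∀ d : Fin n → Bool,
          C'.amp A' xs rs d h' = 0 := by
        intro h' hd d
        obtain ⟨p, h₀, rfl, hpl, hd0, hpo⟩ := dec_cons_inv hK hd
        by_cases hp : C.Possible A n xs rs h
        · cases hn : C.next xs rs h with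
          | none => exact H.amp_none hd0 hn d p (by rintro rfl; simp at hpl; omega)
          | some l => exact absurd ⟨hp, l, hn⟩ hcase
        · refine amp_append_zero ?_ p
          have h0 : C.amp A xs rs d h = 0 := by
            by_contra hd; exact hp ⟨d, hd⟩
          by_cases hm0 : h₀ ∈ F
          · obtain ⟨_, s, _, hsA⟩ := h1 h₀ hm0
            rw [hsA, h0, place_zero, smul_zero]
          · exact h2 h₀ hd0 hm0 d
      obtain ⟨h₀, hm0⟩ := hF
      -- All amplitudes vanish on both sides, so a single history with scalar `1` will do. The
      -- padding by empty lists only serves to put `o` at position `b` of its round.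
      refine ⟨{(List.replicate b [] ++ o :: List.replicate a []) ++ h₀}, by simp, ?_, fun h' hd _ => hz' h' hd⟩
      intro h' hh'
      rw [Finset.mem_singleton] at hh'
      have hd : dec b (a + 1 + b) h' = (o :: h, []) := by
        rw [hh', dec_full (h1 h₀ hm0).1 _ (by simp; omega) hK]
        congr 2
        simp [List.getD_eq_getElem?_getD, List.getElem?_append]
      exact ⟨hd, 1, by simp, fun d => by rw [hz' h' hd, hz, place_zero, smul_zero]⟩

/-- Zero amplitude of the decoded history passes to all histories above it and to all their
continuations. Once `C` has stopped, `C'` stops as well, so no incomplete round can have begun. -/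
theorem Rounds.possible (H : Rounds C A C' A' a b n xs rs ph π w S)
    (hδ : Function.Injective (A.data n)) {h' : List (List Bool)} (hp : C'.Possible A' n xs rs h') :
    C.Possible A n xs rs (dec b (a + 1 + b) h').1 ∧ ((dec b (a + 1 + b) h').2 ≠ [] →
      ∃ l, C.next xs rs (dec b (a + 1 + b) h').1 = some l) ∧
      ∃ h₀, h' = (dec b (a + 1 + b) h').2 ++ h₀ ∧
        dec b (a + 1 + b) h₀ = ((dec b (a + 1 + b) h').1, []) := by
  obtain ⟨_, h₀, e1, e2⟩ := dec_spec (b := b) (K := a + 1 + b) (by omega) h'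
  obtain ⟨d, hd⟩ := hp
  refine ⟨⟨d, fun h0 => hd ?_⟩, fun hne => ?_, h₀, e1, e2⟩
  · obtain ⟨F, _, h1, h2⟩ := H.exists_fiber hδ (dec b (a + 1 + b) h').1
    rw [e1]
    refine amp_append_zero ?_ _
    by_cases hm : h₀ ∈ F
    · obtain ⟨_, s, _, hsA⟩ := h1 h₀ hm
      rw [hsA, h0, place_zero, smul_zero]
    · exact h2 h₀ e2 hm d
  · cases hn : C.next xs rs (dec b (a + 1 + b) h').1 with
    | none => exact absurd (by rw [e1]; exact H.amp_none e2 hn d _ hne) hd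
    | some l => exact ⟨l, rfl⟩

theorem Rounds.opsOk (H : Rounds C A C' A' a b n xs rs ph π w S)
    (hδ : Function.Injective (A.data n)) {h' : List (List Bool)} (hp : C'.Possible A' n xs rs h')
    {l' : List (Op Q')} (hl' : C'.next xs rs h' = some l') :
    OpsOk C' A' S (w * ((C.next xs rs (dec b (a + 1 + b) h').1).getD []).length) l' := by
  have hn := H.next h'
  cases hl : C.next xs rs (dec b (a + 1 + b) h').1 with
  | none => rw [hl, hl'] at hn; simp at hn
  | some l =>
    rw [hl, hl'] at hn
    simp only [Option.map_some, Option.some.injEq] at hn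
    rw [hn, Option.getD_some]
    refine H.ok _ l (H.possible hδ hp).1 hl _ ?_ _
    have := (dec_spec (b := b) (K := a + 1 + b) (by omega) h').1
    rw [List.getD_eq_getElem _ _ (by rw [H.len]; exact this)]
    exact List.getElem_mem _

/-- An incomplete round is charged as a complete one: it shows that `C` has a further timestep, and
by `exists_outcome` the history of `C` then has a possible extension, whose length is still at most
`D`. -/
theorem Rounds.length_le (H : Rounds C A C' A' a b n xs rs ph π w S)
    (hδ : Function.Injective (A.data n)) {D : ℕ} (hD : ∀ h, C.Possible A n xs rs h → h.length ≤ D)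
    (hleg : ∀ h l, C.Possible A n xs rs h → C.next xs rs h = some l →
      (l.flatMap Op.qubits).Nodup ∧ ∀ o ∈ l, C.Allowed A o)
    {h' : List (List Bool)} (hp : C'.Possible A' n xs rs h') : h'.length ≤ (a + 1 + b) * D := by
  obtain ⟨h1, h2, _⟩ := H.possible hδ hp
  rw [length_dec (b := b) (K := a + 1 + b) h']
  by_cases h3 : (dec b (a + 1 + b) h').2 = []
  · rw [h3, List.length_nil, add_zero]
    exact Nat.mul_le_mul_left _ (hD _ h1)
  · obtain ⟨l, hl⟩ := h2 h3
    obtain ⟨d, hd⟩ := h1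
    obtain ⟨o, ho⟩ := exists_outcome C A l (hleg _ l ⟨d, hd⟩ hl).1 (hleg _ l ⟨d, hd⟩ hl).2 _ hd
    have := hD (o :: (dec b (a + 1 + b) h').1) ⟨d, by rw [amp_cons_some hl]; exact ho⟩
    have h4 := (dec_spec (b := b) (K := a + 1 + b) (by omega) h').1
    rw [List.length_cons] at this
    have h5 := Nat.mul_le_mul_left (a + 1 + b) this
    rw [mul_add, mul_one] at h5
    omega

/-- The bound keeps track of incomplete rounds so that the induction can proceed by single timesteps
of `C'`. -/
theorem Rounds.opCount_le_aux (H : Rounds C A C' A' a b n xs rs ph π w S)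
    (hδ : Function.Injective (A.data n)) {h' : List (List Bool)} (hp : C'.Possible A' n xs rs h') :
    C'.opCount xs rs h' ≤ w * ((a + 1 + b) * C.opCount xs rs (dec b (a + 1 + b) h').1 +
      (dec b (a + 1 + b) h').2.length * ((C.next xs rs (dec b (a + 1 + b) h').1).getD []).length) := by
  induction h' with
  | nil => simp [Circuit.opCount]
  | cons o h' ih =>
    have hp' := Possible.of_cons hp
    have ih := ih hp'
    have h1 : ((C'.next xs rs h').getD []).length ≤
        w * ((C.next xs rs (dec b (a + 1 + b) h').1).getD []).length := by
      cases hn : C'.next xs rs h' with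
      | none => simp
      | some l' => exact (H.opsOk hδ hp' hn).length
    rw [Circuit.opCount, dec]
    split
    · rename_i hl
      rw [Circuit.opCount]
      simp only [List.length_nil, zero_mul, add_zero]
      have : (dec b (a + 1 + b) h').2.length = a + b := by omega
      rw [this] at ih
      refine (add_le_add ih h1).trans (le_of_eq ?_)
      ring
    · simp only [List.length_cons]
      refine (add_le_add ih h1).trans (le_of_eq ?_)
      ring

theorem Rounds.opCount_le (H : Rounds C A C' A' a b n xs rs ph π w S)
    (hδ : Function.Injective (A.data n)) {P : ℕ}
    (hP : ∀ h, C.Possible A n xs rs h → C.opCount xs rs h ≤ P)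
    (hleg : ∀ h l, C.Possible A n xs rs h → C.next xs rs h = some l →
      (l.flatMap Op.qubits).Nodup ∧ ∀ o ∈ l, C.Allowed A o)
    {h' : List (List Bool)} (hp : C'.Possible A' n xs rs h') :
    C'.opCount xs rs h' ≤ w * ((a + 1 + b) * P) := by
  refine (H.opCount_le_aux hδ hp).trans (Nat.mul_le_mul_left _ ?_)
  obtain ⟨h1, h2, _⟩ := H.possible hδ hp
  by_cases h3 : (dec b (a + 1 + b) h').2 = []
  · rw [h3, List.length_nil, zero_mul, add_zero]
    exact Nat.mul_le_mul_left _ (hP _ h1)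
  · obtain ⟨l, hl⟩ := h2 h3
    obtain ⟨d, hd⟩ := h1
    obtain ⟨o, ho⟩ := exists_outcome C A l (hleg _ l ⟨d, hd⟩ hl).1 (hleg _ l ⟨d, hd⟩ hl).2 _ hd
    have := hP (o :: (dec b (a + 1 + b) h').1) ⟨d, by rw [amp_cons_some hl]; exact ho⟩
    have h4 := (dec_spec (b := b) (K := a + 1 + b) (by omega) h').1
    rw [Circuit.opCount] at this
    refine le_trans ?_ (Nat.mul_le_mul_left (a + 1 + b) this)
    rw [mul_add]
    exact Nat.add_le_add_left (Nat.mul_le_mul_right _ h4.le) _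

/-- The final histories of `C'` are grouped by the histories of `C` that they decode to. Each group
consists of equally weighted copies of one term, with total weight one; all other histories
contribute zero. -/
theorem Rounds.sum_channelTerm (H : Rounds C A C' A' a b n xs rs ph π w S)
    (hδ : Function.Injective (A.data n)) (hfin : {h | C.Possible A n xs rs h}.Finite)
    (ρ : Matrix (Fin n → Bool) (Fin n → Bool) ℂ) (c c' : Fin n → Bool) :
    ∑ᶠ (h' : List (List Bool)) (_ : C'.next xs rs h' = none), channelTerm C' A' xs rs ρ c c' h' =
      ∑ᶠ (h : List (List Bool)) (_ : C.next xs rs h = none), channelTerm C A xs rs ρ c c' h := by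
  classical
  choose F _ hF hF' using H.exists_fiber hδ
  let T : Finset (List (List Bool)) := hfin.toFinset.filter fun h => C.next xs rs h = none
  have e1 : ∑ᶠ (h : List (List Bool)) (_ : C.next xs rs h = none), channelTerm C A xs rs ρ c c' h =
      ∑ h ∈ T, channelTerm C A xs rs ρ c c' h := by
    refine finsum_mem_eq_sum_of_inter_support_eq (s := {h | C.next xs rs h = none}) _ ?_
    ext h
    simp only [Set.mem_inter_iff, Set.mem_ofPred_eq, Function.mem_support, T, Finset.mem_coe,
      Finset.mem_filter, Set.Finite.mem_toFinset]
    constructor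
    · rintro ⟨h1, h2⟩
      refine ⟨⟨?_, h1⟩, h2⟩
      by_contra h3
      exact h2 (channelTerm_eq_zero h3 _ _ _)
    · rintro ⟨⟨_, h1⟩, h2⟩
      exact ⟨h1, h2⟩
  have e2 : ∑ᶠ (h' : List (List Bool)) (_ : C'.next xs rs h' = none),
      channelTerm C' A' xs rs ρ c c' h' = ∑ h' ∈ T.biUnion F, channelTerm C' A' xs rs ρ c c' h' := by
    refine finsum_mem_eq_sum_of_inter_support_eq (s := {h' | C'.next xs rs h' = none}) _ ?_
    ext h'
    simp only [Set.mem_inter_iff, Set.mem_ofPred_eq, Function.mem_support, T, Finset.mem_coe,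
      Finset.mem_biUnion, Finset.mem_filter, Set.Finite.mem_toFinset]
    constructor
    · rintro ⟨h1, h2⟩
      refine ⟨⟨(dec b (a + 1 + b) h').1, ?_, ?_⟩, h2⟩
      all_goals
        have hp : C'.Possible A' n xs rs h' := by
          by_contra h3
          exact h2 (channelTerm_eq_zero h3 _ _ _)
        obtain ⟨hp1, hp2, _⟩ := H.possible hδ hp
        have hn := H.next h'
        rw [h1] at hn
        have hn : C.next xs rs (dec b (a + 1 + b) h').1 = none := by
          cases h : C.next xs rs (dec b (a + 1 + b) h').1 with
          | none => rfl
          | some l => rw [h] at hn; simp at hn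
      · exact ⟨hp1, hn⟩
      · have h3 : (dec b (a + 1 + b) h').2 = [] := by
          by_contra h3
          obtain ⟨l, hl⟩ := hp2 h3
          rw [hn] at hl
          simp at hl
        by_contra h4
        obtain ⟨d, hd⟩ := hp
        exact hd (hF' _ h' (by rw [← h3]) h4 d)
    · rintro ⟨⟨h, ⟨_, hn⟩, hm⟩, h2⟩
      refine ⟨?_, h2⟩
      rw [H.next, (hF h h' hm).1, hn, Option.map_none]
  rw [e1, e2, Finset.sum_biUnion]
  · refine Finset.sum_congr rfl fun h _ => ?_
    -- The condition `‖s‖ ^ 2 * card = 1` makes each weight the reciprocal of the size of the group.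
    have : ∀ h' ∈ F h, channelTerm C' A' xs rs ρ c c' h' =
        ((F h).card : ℝ)⁻¹ • channelTerm C A xs rs ρ c c' h := by
      intro h' hm
      obtain ⟨_, s, hs, hsA⟩ := hF h h' hm
      rw [channelTerm_place (H.inj h) hδ (H.data h) hsA, eq_inv_of_mul_eq_one_left hs]
    rw [Finset.sum_congr rfl this, Finset.sum_const]
    by_cases h0 : (F h).card = 0
    · exfalso
      rename_i he _
      obtain ⟨h', hm⟩ := he h
      rw [Finset.card_eq_zero.1 h0] at hm
      simp at hm
    · rw [← Nat.cast_smul_eq_nsmul ℝ, smul_smul, mul_inv_cancel₀ (by exact_mod_cast h0), one_smul]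
  · intro h _ h₂ _ hne
    refine Finset.disjoint_left.2 fun h' hm hm' => hne ?_
    have e3 := (hF h h' hm).1
    have e4 := (hF h₂ h' hm').1
    rw [e3] at e4
    exact (Prod.mk.inj e4).1

end

section

/-! ### Comparison of the two circuits over all inputs and seeds. -/

theorem sum_ofFn_congr {m m' : ℕ} (h : m = m') (f : List Bool → ℂ) :
    ∑ r : Fin m → Bool, f (List.ofFn r) = ∑ r : Fin m' → Bool, f (List.ofFn r) := by
  subst h; rfl

theorem exists_ofFn_of_length {m : ℕ} {rs : List Bool} (h : rs.length = m) :
    ∃ r : Fin m → Bool, List.ofFn r = rs := by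
  subst h; exact ⟨rs.get, List.ofFn_get rs⟩

variable {Q Q' : Type} [DecidableEq Q] [Coded Q] [DecidableEq Q'] [Coded Q'] {G : GateSet}

/-- A circuit that simulates another one in rounds of bounded length computes the same channel, with
depth and size larger by the corresponding factors. -/
theorem simulation (C : Circuit Q G) (A : Architecture Q) (C' : Circuit Q' G) (A' : Architecture Q')
    (a b : ℕ) (w : ℕ → ℕ) (S : ℕ → Set Q') (hseed : C'.seedLen = C.seedLen)
    (hδ : ∀ n, Function.Injective (A.data n)) (hleg : C.Legal A) (D P : ℕ → ℕ)
    (hD : ∀ n, C.depth A n ≤ D n) (hP : ∀ n, C.size A n ≤ P n)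
    (H : ∀ n (xs rs : List Bool), xs.length = n → rs.length = C.seedLen.eval n →
      ∃ ph π, Rounds C A C' A' a b n xs rs ph π (w n) (S n)) :
    C'.Legal A' ∧ (∀ n, C'.depth A' n ≤ ((a + 1 + b) * D n : ℕ)) ∧
      (∀ n, C'.size A' n ≤ (w n * ((a + 1 + b) * P n) : ℕ)) ∧ (∀ n x, C'.acted A' n x ⊆ S n) ∧
      ∀ n x, C'.channel A' n x = C.channel A n x := by
  have hR : ∀ (n : ℕ) (x : Fin n → Bool) (r : C'.Seed n), ∃ ph π,
      Rounds C A C' A' a b n (List.ofFn x) (List.ofFn r) ph π (w n) (S n) := fun n x r =>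
    H n _ _ List.length_ofFn (by rw [List.length_ofFn, hseed])
  have hr : ∀ (n : ℕ) (r : C'.Seed n), ∃ r' : C.Seed n, List.ofFn r' = List.ofFn r := fun n r =>
    exists_ofFn_of_length (by rw [List.length_ofFn, hseed])
  have hlen : ∀ (n : ℕ) (x : Fin n → Bool) (r : C'.Seed n) h,
      C.Possible A n (List.ofFn x) (List.ofFn r) h → h.length ≤ D n := by
    intro n x r h hp
    obtain ⟨r', hr'⟩ := hr n r
    rw [← hr'] at hp
    have := hD n
    simp only [Circuit.depth, iSup_le_iff] at this
    exact_mod_cast this x r' h hp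
  have hcnt : ∀ (n : ℕ) (x : Fin n → Bool) (r : C'.Seed n) h,
      C.Possible A n (List.ofFn x) (List.ofFn r) h →
        C.opCount (List.ofFn x) (List.ofFn r) h ≤ P n := by
    intro n x r h hp
    obtain ⟨r', hr'⟩ := hr n r
    rw [← hr'] at hp ⊢
    have := hP n
    simp only [Circuit.size, iSup_le_iff] at this
    exact_mod_cast this x r' h hp
  have hleg' : ∀ (n : ℕ) (x : Fin n → Bool) (r : C'.Seed n) h l,
      C.Possible A n (List.ofFn x) (List.ofFn r) h → C.next (List.ofFn x) (List.ofFn r) h = some l →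
      (l.flatMap Op.qubits).Nodup ∧ ∀ o ∈ l, C.Allowed A o := by
    intro n x r h l hp hl
    obtain ⟨r', hr'⟩ := hr n r
    rw [← hr'] at hp hl
    exact hleg n x r' h hp l hl
  refine ⟨fun n x r h hp l hl => ?_, fun n => ?_, fun n => ?_, fun n x => ?_, fun n x => ?_⟩
  · obtain ⟨ph, π, hR⟩ := hR n x r
    have := hR.opsOk (hδ n) hp hl
    exact ⟨this.nodup, this.allowed⟩
  · simp only [Circuit.depth, iSup_le_iff]
    intro x r h hp
    obtain ⟨ph, π, hR⟩ := hR n x r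
    exact_mod_cast hR.length_le (hδ n) (hlen n x r) (hleg' n x r) hp
  · simp only [Circuit.size, iSup_le_iff]
    intro x r h hp
    obtain ⟨ph, π, hR⟩ := hR n x r
    exact_mod_cast hR.opCount_le (hδ n) (hcnt n x r) (hleg' n x r) hp
  · rintro q ⟨r, h, l, hp, hl, o, ho, hq⟩
    obtain ⟨ph, π, hR⟩ := hR n x r
    exact (hR.opsOk (hδ n) hp hl).region o ho q hq
  · funext ρ
    ext c c'
    simp only [Circuit.channel, Matrix.of_apply]
    have e : C'.seedLen.eval n = C.seedLen.eval n := by rw [hseed]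
    refine congrArg₂ (· * ·) (by rw [e]) ?_
    refine Eq.trans ?_ (sum_ofFn_congr e fun rs =>
      ∑ᶠ (h : List (List Bool)) (_ : C.next (List.ofFn x) rs h = none),
        channelTerm C A (List.ofFn x) rs ρ c c' h)
    refine Finset.sum_congr rfl fun r _ => ?_
    obtain ⟨ph, π, hR⟩ := hR n x r
    exact hR.sum_channelTerm (hδ n) (finite_possible C A n _ _ (D n) (hlen n x r)) ρ c c'

end
end QArch

namespace QArch
set_option linter.unusedSectionVars false
set_option linter.unusedSimpArgs false

/-! ## Operations as data -/

/-- The same operation on renamed qubits. -/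
def Op.map {Q Q' : Type} (f : Q → Q') : Op Q → Op Q'
  | Op.meas q => Op.meas (f q)
  | Op.gate1 g q => Op.gate1 g (f q)
  | Op.gate2 g p q => Op.gate2 g (f p) (f q)

theorem Op.qubits_map {Q Q' : Type} (f : Q → Q') (o : Op Q) : (o.map f).qubits = o.qubits.map f := by
  cases o <;> rfl

theorem flatMap_qubits_map {Q Q' : Type} (f : Q → Q') (l : List (Op Q)) :
    (l.map (Op.map f)).flatMap Op.qubits = (l.flatMap Op.qubits).map f := by
  induction l with
  | nil => rfl
  | cons o l ih => simp only [List.map_cons, List.flatMap_cons, ih, List.map_append, Op.qubits_map]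

theorem Op.map_congr {Q Q' : Type} {f f' : Q → Q'} {l : List (Op Q)}
    (h : ∀ q ∈ l.flatMap Op.qubits, f q = f' q) : l.map (Op.map f) = l.map (Op.map f') := by
  refine List.map_congr_left fun o ho => ?_
  have h' : ∀ q ∈ o.qubits, f q = f' q := fun q hq => h q (List.mem_flatMap.2 ⟨o, ho, hq⟩)
  cases o <;> simp_all [Op.map, Op.qubits]

/-- Encoding of operations. -/
def eOp {Q : Type} (e : Q → Data) : Op Q → Data
  | Op.meas q => Data.cons Data.nil (e q)
  | Op.gate1 g q => Data.cons (Data.cons Data.nil Data.nil) (eP Coded.enc e (g, q))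
  | Op.gate2 g p q =>
      Data.cons (Data.cons (Data.cons Data.nil Data.nil) Data.nil) (eP Coded.enc (eP e e) (g, p, q))

theorem enc_op {Q : Type} [Coded Q] : (Coded.enc : Op Q → Data) = eOp Coded.enc := by
  funext o; cases o <;> rfl

namespace PT

variable {α β γ Q Q' : Type} {ea : α → Data} {eb : β → Data} {eg : γ → Data} {e : Q → Data}
  {e' : Q' → Data}

theorem meas {q : γ → Q} (hq : PT eg e q) : PT eg (eOp e) fun c => Op.meas (q c) :=
  ((const (eb := fun d : Data => d) (ea := eg) Data.nil).pair hq).recode fun _ => rfl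

theorem gate1 {g : γ → GateRef} {q : γ → Q} (hg : PT eg Coded.enc g) (hq : PT eg e q) :
    PT eg (eOp e) fun c => Op.gate1 (g c) (q c) :=
  ((const (eb := fun d : Data => d) (ea := eg) (Data.cons Data.nil Data.nil)).pair
    (hg.pair hq)).recode fun _ => rfl

theorem gate2 {g : γ → GateRef} {p q : γ → Q} (hg : PT eg Coded.enc g) (hp : PT eg e p)
    (hq : PT eg e q) : PT eg (eOp e) fun c => Op.gate2 (g c) (p c) (q c) :=
  ((const (eb := fun d : Data => d) (ea := eg)
    (Data.cons (Data.cons Data.nil Data.nil) Data.nil)).pair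
    (hg.pair (hp.pair hq))).recode fun _ => rfl

/-- Case distinction on an operation. -/
theorem opCases {o : γ → Op Q} {f : γ → Q → β} {g : γ → GateRef → Q → β}
    {k : γ → GateRef → Q → Q → β} (ho : PT eg (eOp e) o)
    (hf : PT (eP eg e) eb fun x => f x.1 x.2)
    (hg : PT (eP eg (eP Coded.enc e)) eb fun x => g x.1 x.2.1 x.2.2)
    (hk : PT (eP eg (eP Coded.enc (eP e e))) eb fun x => k x.1 x.2.1 x.2.2.1 x.2.2.2) (b : β) :
    PT eg eb fun c => match o c with
      | Op.meas q => f c q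
      | Op.gate1 r q => g c r q
      | Op.gate2 r p q => k c r p q := by
  let eD : Data → Data := fun d => d
  have ht : PT eg eD fun c => (eOp e (o c)).hd :=
    comp (g := fun o => (eOp e o).hd) (of_hd fun _ => rfl) ho
  have hpl : PT eg eD fun c => (eOp e (o c)).tl :=
    comp (g := fun o => (eOp e o).tl) (of_tl fun _ => rfl) ho
  have ht' : PT eg eD fun c => (eOp e (o c)).hd.hd :=
    comp (ea := eD) (g := fun d : Data => d.hd) (of_hd fun _ => rfl) ht
  have hs : PT eg (eL eD) fun c => [(eOp e (o c)).tl] := hpl.cons (const [])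
  -- Each constructor is turned into a list that is nonempty exactly when the operation has this
  -- form, so that `listCases` can be used three times. The value `b` fills the branch that never
  -- occurs.
  have h1 : PT eg (eL e) fun c => match o c with
      | Op.meas q => [q]
      | _ => [] :=
    (ite_of (c := fun c => decide ((eOp e (o c)).hd ≠ Data.nil)) ht (fun c => by simp [eD])
      (const []) hs).recode fun c => by
        cases h : o c <;> simp [eOp, Data.hd, Data.tl, eL, eD]
  have h2 : PT eg (eL (eP Coded.enc e)) fun c => match o c with
      | Op.gate1 r q => [(r, q)]
      | _ => [] :=
    (ite_of (c := fun c => decide ((eOp e (o c)).hd ≠ Data.nil)) ht (fun c => by simp [eD])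
      (ite_of (c := fun c => decide ((eOp e (o c)).hd.hd ≠ Data.nil)) ht' (fun c => by simp [eD])
      (const []) hs) (const [])).recode fun c => by
        cases h : o c <;> simp [eOp, Data.hd, Data.tl, eL, eD]
  have h3 : PT eg (eL (eP Coded.enc (eP e e))) fun c => match o c with
      | Op.gate2 r p q => [(r, p, q)]
      | _ => [] :=
    (ite_of (c := fun c => decide ((eOp e (o c)).hd.hd ≠ Data.nil)) ht' (fun c => by simp [eD])
      hs (const [])).recode fun c => by
        cases h : o c <;> simp [eOp, Data.hd, Data.tl, eL, eD]
  refine (listCases (g := fun c q _ => f c q) h1 (listCases (g := fun c t _ => g c t.1 t.2) h2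
    (listCases (f := fun _ => b) (g := fun c t _ => k c t.1 t.2.1 t.2.2) h3 (const b) ?_) ?_) ?_).congr fun c => ?_
  · exact comp hk (PT.id.fst.pair PT.id.snd.fst)
  · exact comp hg (PT.id.fst.pair PT.id.snd.fst)
  · exact comp hf (PT.id.fst.pair PT.id.snd.fst)
  · cases o c <;> rfl

theorem opMap [Inhabited Q'] {f : γ → Q → Q'} {o : γ → Op Q} (hf : PT (eP eg e) e' fun x => f x.1 x.2)
    (ho : PT eg (eOp e) o) : PT eg (eOp e') fun c => (o c).map (f c) :=
  (opCases (f := fun c q => Op.meas (f c q)) (g := fun c r q => Op.gate1 r (f c q))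
    (k := fun c r p q => Op.gate2 r (f c p) (f c q)) ho
    (meas hf) (gate1 PT.id.snd.fst (comp hf (PT.id.fst.pair PT.id.snd.snd)))
    (gate2 PT.id.snd.fst (comp hf (PT.id.fst.pair PT.id.snd.snd.fst))
      (comp hf (PT.id.fst.pair PT.id.snd.snd.snd))) (Op.meas default)).congr fun c => by
    cases o c <;> rfl

theorem opQubits {o : γ → Op Q} (ho : PT eg (eOp e) o) : PT eg (eL e) fun c => (o c).qubits :=
  (opCases (f := fun _ q => [q]) (g := fun _ _ q => [q]) (k := fun _ _ p q => [p, q]) ho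
    (PT.id.snd.cons (const [])) (PT.id.snd.snd.cons (const []))
    (PT.id.snd.snd.fst.cons (PT.id.snd.snd.snd.cons (const []))) []).congr fun c => by
    cases o c <;> rfl

theorem idxOf [DecidableEq Q] (hi : Function.Injective e) {l : γ → List Q} {q : γ → Q}
    (hl : PT eg (eL e) l) (hq : PT eg e q) : PT eg eU fun c => (l c).idxOf (q c) := by
  have h : ∀ (q : Q) (l : List Q),
      l.foldr (fun t acc => if decide (t = q) then 0 else acc + 1) 0 = l.idxOf q := fun q l => by
    induction l with
    | nil => rfl
    | cons t l ih =>
      rw [List.foldr_cons, ih, List.idxOf_cons]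
      by_cases ht : t = q
      · simp [ht]
      · rw [show (t == q) = false by simpa using ht]; simp [ht]
  refine (foldr (F := fun c t acc => if decide (t = q c) then 0 else acc + 1) (b := fun _ => 0)
    (fun c => 2 * (eL e (l c)).size + 1) (PT.ite (beq hi PT.id.snd.fst (comp hq PT.id.fst)) (const 0)
      PT.id.snd.snd.succ) hl (const 0) (((PB.const 2).mul hl.pb).add (PB.const 1))
    fun c l₁ h₁ => ?_).congr fun c => (h _ _).symm
  rw [h, size_eU]
  have h2 := List.idxOf_le_length (a := q c) (l := l₁)
  have h3 := length_lt_size_eL (ea := e) (l c)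
  have h4 := h₁.length_le
  omega

end PT

/-- The proper suffixes of a list, shortest first. -/
def sufs {α : Type} : List α → List (List α)
  | [] => []
  | _ :: h => sufs h ++ [h]

/-- Lets a controller, which has no memory besides the history, recompute in each timestep what was
done in all earlier ones. -/
theorem PT.sufs {α γ : Type} {ea : α → Data} {eg : γ → Data} {l : γ → List α} (hl : PT eg (eL ea) l) :
    PT eg (eL (eL ea)) fun c => sufs (l c) := by
  have h : ∀ l : List α, l.foldr (fun o (s : List α × List (List α)) => (o :: s.1, s.2 ++ [s.1])) ([], []) =
      (l, QArch.sufs l) := fun l => by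
    induction l with
    | nil => rfl
    | cons o l ih => rw [List.foldr_cons, ih]; rfl
  have hs : ∀ l : List α, ∀ m ∈ QArch.sufs l, m <:+ l := fun l => by
    induction l with
    | nil => simp [QArch.sufs]
    | cons o l ih =>
      intro m hm
      rw [QArch.sufs, List.mem_append, List.mem_singleton] at hm
      rcases hm with hm | rfl
      · exact (ih m hm).trans (List.suffix_cons _ _)
      · exact List.suffix_cons _ _
  have hlen : ∀ l : List α, (QArch.sufs l).length = l.length := fun l => by
    induction l with
    | nil => rfl
    | cons o l ih => simp [QArch.sufs, ih]
  have h' := foldr (ea := ea) (eb := eP (eL ea) (eL (eL ea)))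
    (F := fun (_ : γ) o (s : List α × List (List α)) => (o :: s.1, s.2 ++ [s.1])) (l := l)
    (b := fun _ => ([], []))
    (fun c => 1 + (eL ea (l c)).size + (1 + (eL ea (l c)).size * (1 + (eL ea (l c)).size)))
    ((PT.id.snd.fst.cons PT.id.snd.snd.fst).pair
      (PT.id.snd.snd.snd.append (PT.id.snd.snd.fst.cons (const [])))) hl (const ([], []))
    (((PB.const 1).add hl.pb).add ((PB.const 1).add (hl.pb.mul ((PB.const 1).add hl.pb)))) ?_
  · exact h'.snd.congr fun c => by rw [h]
  · intro c l₁ h₁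
    rw [h, size_eP]
    have e1 := size_eL_sublist (ea := ea) h₁.sublist
    have e2 := size_eL_le (ea := eL ea) (QArch.sufs l₁) (eL ea (l c)).size fun m hm =>
      size_eL_sublist (((hs _ m hm).trans h₁).sublist)
    have e3 : (QArch.sufs l₁).length ≤ (eL ea (l c)).size := by
      rw [hlen]; exact h₁.length_le.trans (length_lt_size_eL _).le
    have e4 := Nat.mul_le_mul_right (1 + (eL ea (l c)).size) e3
    dsimp only
    omega

/-! ### Operations in an embedded register, and the qubits that may be nonzero. -/

section

variable {Q Q' : Type} [DecidableEq Q] [Coded Q] [DecidableEq Q'] [Coded Q'] {G : GateSet}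

/-- The gates of one circuit are available in another one, under the same references. -/
def Extends (C : Circuit Q G) (C' : Circuit Q' G) : Prop :=
  C.wired1 <+: C'.wired1 ∧ C.wired2 <+: C'.wired2

theorem Extends.gate1 {C : Circuit Q G} {C' : Circuit Q' G} (h : Extends C C') {g : GateRef} {U : G.one}
    (hU : C.gate1 g = some U) : C'.gate1 g = some U := by
  cases g with
  | named s => exact hU
  | wired i =>
    simp only [Circuit.gate1] at hU ⊢
    obtain ⟨hi, rfl⟩ := List.getElem?_eq_some_iff.1 hU
    exact (List.getElem?_eq_some_iff).2 ⟨hi.trans_le h.1.length_le, (h.1.getElem hi).symm⟩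

theorem Extends.gate2 {C : Circuit Q G} {C' : Circuit Q' G} (h : Extends C C') {g : GateRef} {U : G.two}
    (hU : C.gate2 g = some U) : C'.gate2 g = some U := by
  cases g with
  | named s => exact hU
  | wired i =>
    simp only [Circuit.gate2] at hU ⊢
    obtain ⟨hi, rfl⟩ := List.getElem?_eq_some_iff.1 hU
    exact (List.getElem?_eq_some_iff).2 ⟨hi.trans_le h.2.length_le, (h.2.getElem hi).symm⟩

/-- The operations have to be allowed: a reference without a gate acts as the identity in `C`, but
might name a gate in the longer lists of `C'`. -/
theorem applyOps_map_place {C : Circuit Q G} {C' : Circuit Q' G} (h : Extends C C') {A : Architecture Q}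
    {π : Q → Q'} (hπ : Function.Injective π) (l : List (Op Q)) (ha : ∀ o ∈ l, C.Allowed A o) :
    ∀ (o : List Bool) (ψ : (Q → Bool) → ℂ),
      C'.applyOps (l.map (Op.map π)) o (place π ψ) = place π (C.applyOps l o ψ) := by
  induction l with
  | nil =>
    intro o ψ
    cases o with
    | nil => rfl
    | cons b o => exact (place_zero π).symm
  | cons x l ih =>
    have ih := ih fun o ho => ha o (List.mem_cons_of_mem _ ho)
    have hx := ha x List.mem_cons_self
    intro o ψ
    rw [List.map_cons]
    cases x with
    | meas q =>
      cases o with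
      | nil => exact (place_zero π).symm
      | cons b o =>
        rw [Op.map, applyOps_meas, applyOps_meas, project_place, ih]
    | gate1 g q =>
      obtain ⟨U, hU⟩ := Option.isSome_iff_exists.1 hx
      rw [Op.map, applyOps_gate1 C hU, applyOps_gate1 C' (h.gate1 hU), apply1_place hπ, ih]
    | gate2 g p q =>
      obtain ⟨U, hU⟩ := Option.isSome_iff_exists.1 hx.1
      rw [Op.map, applyOps_gate2 C hU, applyOps_gate2 C' (h.gate2 hU), apply2_place hπ, ih]

/-- Outside `T` all qubits are `0`. -/
def ZeroOff (T : List Q) (ψ : (Q → Bool) → ℂ) : Prop := ∀ c, ψ c ≠ 0 → ∀ q ∉ T, c q = false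

theorem applyOps_zeroOff (C : Circuit Q G) {T : List Q} (l : List (Op Q))
    (hl : ∀ q ∈ l.flatMap Op.qubits, q ∈ T) : ∀ (o : List Bool) (ψ : (Q → Bool) → ℂ),
      ZeroOff T ψ → ZeroOff T (C.applyOps l o ψ) := by
  induction l with
  | nil =>
    intro o ψ h
    cases o with
    | nil => exact h
    | cons b o => intro c hc; exact absurd rfl hc
  | cons x l ih =>
    rw [List.flatMap_cons] at hl
    have ih := ih fun q hq => hl q (List.mem_append_right _ hq)
    have hx := fun q hq => hl q (List.mem_append_left _ hq)
    intro o ψ h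
    cases x with
    | meas q =>
      cases o with
      | nil => intro c hc; exact absurd rfl hc
      | cons b o =>
        refine ih o _ fun c hc => h c fun h0 => hc ?_
        simp [project, h0]
    | gate1 g q =>
      refine ih o _ ?_
      split
      · intro c hc q' hq'
        obtain ⟨b, _, hb⟩ := Finset.exists_ne_zero_of_sum_ne_zero hc
        have := h _ (right_ne_zero_of_mul hb) q' hq'
        rwa [Function.update_of_ne] at this
        rintro rfl
        exact hq' (hx q' (by simp [Op.qubits]))
      · exact h
    | gate2 g p q =>
      refine ih o _ ?_
      split
      · intro c hc q' hq'
        obtain ⟨b, _, hb⟩ := Finset.exists_ne_zero_of_sum_ne_zero hc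
        have := h _ (right_ne_zero_of_mul hb) q' hq'
        rwa [Function.update_of_ne, Function.update_of_ne] at this
        · rintro rfl
          exact hq' (hx q' (by simp [Op.qubits]))
        · rintro rfl
          exact hq' (hx q' (by simp [Op.qubits]))
      · exact h

/-! ## Relabelling the qubits in the order of their first use -/

/-- A numbering of all trees. -/
def Data.code : Data → ℕ
  | Data.nil => 0
  | Data.cons a b => Nat.pair a.code b.code + 1

theorem Data.code_injective : Function.Injective Data.code := by
  intro a
  induction a with
  | nil => intro b h; cases b <;> simp_all [Data.code]
  | cons a a' ih ih' =>
    intro b h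
    cases b with
    | nil => simp [Data.code] at h
    | cons b b' =>
      simp only [Data.code, Nat.add_right_cancel_iff, Nat.pair_eq_pair] at h
      rw [ih h.1, ih' h.2]

/-- The number of a qubit in a table. -/
def number (T : List Q) (q : Q) : ℕ :=
  if q ∈ T then T.idxOf q else T.length + (Coded.enc q).code

/-- Qubits outside the table get numbers beyond its length by means of an injective code. So the
numbering places the entire register, even when it is infinite, although only numbers from the table
are ever used in operations. -/
theorem number_injective (T : List Q) : Function.Injective (number T) := by
  intro p q h
  unfold number at h
  split_ifs at h with h1 h2 h2
  · exact (List.idxOf_inj h1).1 h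
  · have := List.idxOf_lt_length_iff.2 h1; omega
  · have := List.idxOf_lt_length_iff.2 h2; omega
  · exact Coded.enc_injective (Data.code_injective (by omega))

theorem number_append {T T' : List Q} {q : Q} (h : q ∈ T) : number (T ++ T') q = number T q := by
  rw [number, number, if_pos h, if_pos (List.mem_append_left _ h), List.idxOf_append_of_mem h]

/-- The data qubits and all qubits used during a history. -/
def used (C : Circuit Q G) (D : List Q) (xs rs : List Bool) (h : List (List Bool)) : List Q :=
  D ++ (sufs h).flatMap fun h => ((C.next xs rs h).getD []).flatMap Op.qubits

theorem used_cons (C : Circuit Q G) (D : List Q) (xs rs : List Bool) (o : List Bool)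
    (h : List (List Bool)) : used C D xs rs (o :: h) =
      used C D xs rs h ++ ((C.next xs rs h).getD []).flatMap Op.qubits := by
  simp [used, sufs, List.flatMap_append]

theorem length_qubits_le (l : List (Op Q)) : (l.flatMap Op.qubits).length ≤ 2 * l.length := by
  induction l with
  | nil => simp
  | cons o l ih =>
    rw [List.flatMap_cons, List.length_append, List.length_cons]
    have : o.qubits.length ≤ 2 := by cases o <;> simp [Op.qubits]
    omega

theorem length_used (C : Circuit Q G) (D : List Q) (xs rs : List Bool) (h : List (List Bool)) :
    (used C D xs rs h).length ≤ D.length + 2 * C.opCount xs rs h := by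
  induction h with
  | nil => simp [used, sufs, Circuit.opCount]
  | cons o h ih =>
    rw [used_cons, List.length_append, Circuit.opCount]
    have := length_qubits_le ((C.next xs rs h).getD [])
    omega

/-- The operations of the relabelled circuit. -/
def relabelNext (C : Circuit Q G) (D : List Bool → List Q) (xs rs : List Bool)
    (h : List (List Bool)) : Option (List (Op ℕ)) :=
  match C.next xs rs h with
  | none => none
  | some l => some (l.map (Op.map fun q =>
      (used C (D xs) xs rs h ++ l.flatMap Op.qubits).idxOf q))

/-- Positions in the table are bounded by its length, so they can be written in unary. This is
stronger than the binary statement, and the routing on the grid is computed from it. -/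
theorem relabelNext_polyTime (C : Circuit Q G) {D : List Bool → List Q} (hD : PT Coded.enc Coded.enc D) :
    PT Coded.enc (eO (eL (eOp eU))) fun i : List Bool × List Bool × List (List Bool) =>
      relabelNext C D i.1 i.2.1 i.2.2 := by
  have hn : PT (eP Coded.enc (eP Coded.enc Coded.enc)) (eO (eL (eOp Coded.enc)))
      fun i : List Bool × List Bool × List (List Bool) => C.next i.1 i.2.1 i.2.2 := by
    have := C.polyTime
    rw [← enc_op, ← enc_list, ← enc_option]
    exact this
  have hq : PT (eP Coded.enc (eP Coded.enc Coded.enc)) (eL Coded.enc)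
      fun i : List Bool × List Bool × List (List Bool) =>
        ((C.next i.1 i.2.1 i.2.2).getD []).flatMap Op.qubits :=
    PT.flatMap (g := fun _ o => Op.qubits o) (PT.opQubits PT.id.snd)
      ((PT.optionCases (f := fun _ => []) (g := fun _ l => l) hn (PT.const []) PT.id.snd).congr
        fun i => by cases C.next i.1 i.2.1 i.2.2 <;> rfl)
  have hu : PT (eP Coded.enc (eP Coded.enc Coded.enc)) (eL Coded.enc)
      fun i : List Bool × List Bool × List (List Bool) => used C (D i.1) i.1 i.2.1 i.2.2 := by
    refine PT.append (PT.comp (enc_list (α := Q) ▸ hD) PT.id.fst) (PT.flatMap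
      (g := fun (i : List Bool × List Bool × List (List Bool)) h =>
        ((C.next i.1 i.2.1 h).getD []).flatMap Op.qubits) (ea := Coded.enc) ?_ ?_)
    · exact PT.comp (g := fun i : List Bool × List Bool × List (List Bool) =>
        ((C.next i.1 i.2.1 i.2.2).getD []).flatMap Op.qubits) hq (PT.id.fst.fst.pair (PT.id.fst.snd.fst.pair PT.id.snd))
    · have : PT (eP Coded.enc (eP Coded.enc Coded.enc)) (eL Coded.enc)
        fun i : List Bool × List Bool × List (List Bool) => i.2.2 := by
        rw [← enc_list]; exact PT.id.snd.snd
      have := this.sufs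
      rwa [← enc_list] at this
  refine (PT.optionCases (f := fun _ => none) (g := fun i l => some (l.map (Op.map fun q =>
      (used C (D i.1) i.1 i.2.1 i.2.2 ++ l.flatMap Op.qubits).idxOf q))) hn (PT.const none)
      (PT.some (PT.map (g := fun (c : (List Bool × List Bool × List (List Bool)) × List (Op Q)) o => o.map fun q =>
        (used C (D c.1.1) c.1.1 c.1.2.1 c.1.2.2 ++ c.2.flatMap Op.qubits).idxOf q)
        (PT.opMap ?_ PT.id.snd) PT.id.snd))).congr fun i => ?_
  · exact PT.idxOf Coded.enc_injective ((PT.comp hu PT.id.fst.fst.fst).append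
      (PT.flatMap (g := fun _ o => Op.qubits o) (PT.opQubits PT.id.snd) PT.id.fst.fst.snd)) PT.id.snd
  · simp only [relabelNext]
    cases C.next i.1 i.2.1 i.2.2 <;> rfl

/-- The conversion from unary to binary. -/
theorem PT.unary_binary : PT eU Coded.enc fun n : ℕ => n := by
  -- Splits off the lowest binary digit and stays put at zero. Each effective step decreases the
  -- number, so `n` iterations are enough.
  let F : List Bool × ℕ → List Bool × ℕ := fun s =>
    if decide (s.2 = 0) then s else (s.1 ++ [!decide (s.2 % 2 = 0)], s.2 / 2)
  have hbits : ∀ m : ℕ, m ≠ 0 → Nat.bits m = (!decide (m % 2 = 0)) :: Nat.bits (m / 2) := fun m hm => by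
    have h1 : Nat.bit (!decide (m % 2 = 0)) (m / 2) = m := by
      rw [Nat.bit_val]
      rcases Nat.mod_two_eq_zero_or_one m with h | h <;> simp [h] <;> omega
    conv_lhs => rw [← h1]
    rw [Nat.bits_append_bit]
    intro h0
    have : m % 2 = 1 := by omega
    simp [this]
  have hF : ∀ (n i : ℕ), Nat.bits n = (F^[i] ([], n)).1 ++ Nat.bits (F^[i] ([], n)).2 ∧
      (F^[i] ([], n)).1.length ≤ i ∧ (F^[i] ([], n)).2 ≤ n - i := fun n i => by
    induction i with
    | zero => simp
    | succ i ih =>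
      rw [Function.iterate_succ_apply']
      generalize F^[i] ([], n) = s at *
      obtain ⟨h1, h2, h3⟩ := ih
      by_cases h0 : s.2 = 0
      · simp only [F, h0, decide_true, if_true]
        exact ⟨by rw [h1, h0], by omega, by omega⟩
      · simp only [F, h0, decide_false, Bool.false_eq_true, if_false]
        refine ⟨?_, by simp; omega, by omega⟩
        rw [h1, hbits _ h0, List.append_assoc, List.singleton_append]
  have hb : PT eU (eP (eL Data.ofBool) eU) fun n => F^[n] ([], n) := by
    refine PT.iterate (F := fun _ => F) (n := fun n => n) (b := fun n => ([], n))
      (fun n => 1 + (1 + (eU n).size * (1 + 3)) + (eU n).size) ?_ PT.id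
      ((PT.const []).pair PT.id) (((PB.const 1).add ((PB.const 1).add (PB.size.mul (PB.const _)))).add
        PB.size) fun n i hi => ?_
    · exact PT.ite (PT.beq eU_injective PT.id.snd.snd (PT.const 0)) PT.id.snd
        ((PT.id.snd.fst.append ((PT.even PT.id.snd.snd).not.cons (PT.const []))).pair
          (PT.half PT.id.snd.snd))
    · obtain ⟨_, h2, h3⟩ := hF n i
      rw [size_eP]
      have e1 := size_eL_le (ea := Data.ofBool) (F^[i] ([], n)).1 3 fun b _ => Data.size_ofBool_le b
      have e2 := Nat.mul_le_mul_right (1 + 3) (h2.trans hi)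
      simp only [size_eU] at *
      omega
  refine hb.fst.recode fun n => ?_
  obtain ⟨h1, _, h3⟩ := hF n n
  rw [Nat.sub_self, Nat.le_zero] at h3
  rw [h3, Nat.zero_bits, List.append_nil] at h1
  rw [← h1]
  exact congrFun enc_list _

theorem PT.binary_ops {γ : Type} {eg : γ → Data} {f : γ → Option (List (Op ℕ))}
    (h : PT eg (eO (eL (eOp eU))) f) : PT eg Coded.enc f := by
  rw [enc_option, enc_list, enc_op]
  refine (PT.optionCases (f := fun _ => none) (g := fun _ l => Option.some (l.map (Op.map fun q => q))) h
    (PT.const none) (PT.some (PT.map (g := fun _ (o : Op ℕ) => o.map fun q => q)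
      (PT.opMap (f := fun _ q => q) (PT.unary_binary.comp PT.id.snd) PT.id.snd) PT.id.snd))).congr fun c => ?_
  cases f c with
  | none => rfl
  | some l =>
    congr 1
    symm
    conv_rhs => rw [← List.map_id l]
    exact List.map_congr_left fun o _ => by cases o <;> rfl

/-- The circuit with its qubits relabelled. -/
def relabel (C : Circuit Q G) (D : List Bool → List Q) (hD : PT Coded.enc Coded.enc D) :
    Circuit ℕ G where
  seedLen := C.seedLen
  wired1 := C.wired1
  wired2 := C.wired2
  next := relabelNext C D
  polyTime := PT.binary_ops (relabelNext_polyTime C hD)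

/-- Qubits are initially `0` except for the data qubits, and an operation affects only the qubits on
which it acts. -/
theorem amp_zeroOff (C : Circuit Q G) (A : Architecture Q) (xs rs : List Bool) {n : ℕ}
    (d : Fin n → Bool) (h : List (List Bool)) :
    ZeroOff (used C (List.ofFn (A.data n)) xs rs h) (C.amp A xs rs d h) := by
  induction h with
  | nil =>
    intro c hc q hq
    simp only [Circuit.amp, Circuit.initial] at hc
    split_ifs at hc with h1
    · rw [h1, Function.extend_apply']
      rintro ⟨i, rfl⟩
      exact hq (by simp [used, sufs])
    · exact absurd rfl hc
  | cons o h ih =>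
    cases hn : C.next xs rs h with
    | none => rw [amp_cons_none hn]; intro c hc; exact absurd rfl hc
    | some l =>
      rw [amp_cons_some hn]
      refine applyOps_zeroOff C l (fun q hq => ?_) o _ fun c hc q hq => ih c hc q fun hm => hq ?_
      · rw [used_cons, hn]; exact List.mem_append_right _ hq
      · rw [used_cons]; exact List.mem_append_left _ hm

/-- Rounds have one timestep, but the placement changes with the history, since the table of used
qubits grows. This is harmless because qubits not yet in the table hold `0` and table entries keep
their positions. -/
theorem relabel_rounds (C : Circuit Q G) (A : Architecture Q) (D : List Bool → List Q)
    (hD : PT Coded.enc Coded.enc D) {n : ℕ} (hδ : Function.Injective (A.data n)) {xs rs : List Bool}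
    (hDA : D xs = List.ofFn (A.data n)) {P : ℕ}
    (hP : ∀ h, C.Possible A n xs rs h → C.opCount xs rs h ≤ P)
    (hleg : ∀ h l, C.Possible A n xs rs h → C.next xs rs h = some l →
      (l.flatMap Op.qubits).Nodup ∧ ∀ o ∈ l, C.Allowed A o) :
    Rounds C A (relabel C D hD) CCAC 0 0 n xs rs
      (fun h l => [fun _ => l.map (Op.map (number (used C (D xs) xs rs h ++ l.flatMap Op.qubits)))])
      (fun h => number (used C (D xs) xs rs h)) 1 {q | q < n + 2 * P} := by
  have hext : Extends C (relabel C D hD) := ⟨List.prefix_rfl, List.prefix_rfl⟩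
  refine ⟨fun h' => ?_, fun h l => rfl, fun h => number_injective _, fun h i => ?_, ?_, ?_⟩
  · simp only [Nat.zero_add, Nat.add_zero, dec_one]
    show relabelNext C D xs rs h' = _
    unfold relabelNext
    cases C.next xs rs h' with
    | none => rfl
    | some l =>
      simp only [Option.map_some, List.length_nil, List.getD_cons_zero, Option.some.injEq]
      refine Op.map_congr fun q hq => ?_
      rw [number, if_pos (List.mem_append_right _ hq)]
  · show number (used C (D xs) xs rs h) (A.data n i) = i
    have hm : A.data n i ∈ D xs := by rw [hDA]; exact List.mem_ofFn.2 ⟨i, rfl⟩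
    unfold used
    rw [number_append hm, number, if_pos hm, hDA]
    have hi : i.val < (List.ofFn (A.data n)).length := by rw [List.length_ofFn]; exact i.2
    have := (List.nodup_ofFn.2 hδ).idxOf_getElem i.val hi
    simpa using this
  · intro h l hp hl
    refine ⟨[], [], rfl, rfl, fun os₁ o os₂ h1 h2 => ?_⟩
    rw [List.length_eq_zero_iff] at h1 h2
    subst h1 h2
    refine ⟨fun _ => ⟨1, by simp, fun d => ?_⟩, fun hne => absurd ⟨rfl, rfl⟩ hne⟩
    have hu : used C (D xs) xs rs h ++ l.flatMap Op.qubits = used C (D xs) xs rs (o :: h) := by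
      rw [used_cons, hl]; rfl
    -- Before the timestep the placement is changed to that of the enlarged table; the two agree on
    -- the old table, outside of which the state is `0`.
    rw [one_smul, hu, amp_cons_some hl, List.nil_append,
      place_congr (number_injective (used C (D xs) xs rs h)) (number_injective (used C (D xs) xs rs (o :: h)))
        {q | q ∈ used C (D xs) xs rs h} _ _ (hDA ▸ amp_zeroOff C A xs rs d h)]
    · exact applyOps_map_place hext (number_injective _) l (hleg h l hp hl).2 o _
    · intro q hq
      rw [used_cons, number_append hq]
  · intro h l hp hl f hf p
    rw [List.mem_singleton] at hf
    subst hf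
    obtain ⟨hnd, hal⟩ := hleg h l hp hl
    have hnd' := flatMap_qubits_map (number (used C (D xs) xs rs h ++ l.flatMap Op.qubits)) l
    have hnd2 : ((l.map (Op.map (number (used C (D xs) xs rs h ++ l.flatMap Op.qubits)))).flatMap
        Op.qubits).Nodup := by
      rw [hnd']; exact hnd.map (number_injective _)
    refine ⟨hnd2, fun o ho => ?_, fun o ho q hq => ?_, by simp⟩
    · obtain ⟨o, hm, rfl⟩ := List.mem_map.1 ho
      have hx := hal o hm
      have hnq : (o.map (number (used C (D xs) xs rs h ++ l.flatMap Op.qubits))).qubits.Nodup :=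
        (List.nodup_flatMap.1 hnd2).1 _ (List.mem_map_of_mem hm)
      cases o with
      | meas q => trivial
      | gate1 g q =>
        obtain ⟨U, hU⟩ := Option.isSome_iff_exists.1 hx
        exact Option.isSome_iff_exists.2 ⟨U, hext.gate1 hU⟩
      | gate2 g p q =>
        obtain ⟨U, hU⟩ := Option.isSome_iff_exists.1 hx.1
        refine ⟨Option.isSome_iff_exists.2 ⟨U, hext.gate2 hU⟩, ?_⟩
        intro heq
        simp [Op.map, Op.qubits, heq] at hnq
    · have hmem : q ∈ (l.flatMap Op.qubits).map (number (used C (D xs) xs rs h ++ l.flatMap Op.qubits)) := by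
        rw [← hnd']; exact List.mem_flatMap.2 ⟨o, ho, hq⟩
      obtain ⟨q, hm, rfl⟩ := List.mem_map.1 hmem
      have hq' : q ∈ used C (D xs) xs rs h ++ l.flatMap Op.qubits := List.mem_append_right _ hm
      rw [number, if_pos hq']
      have h1 := List.idxOf_lt_length_iff.2 hq'
      -- The size bound counts only operations along possible histories, so `h` is extended by a
      -- possible outcome in order to include the present timestep. Each operation brings at most
      -- two qubits into the table.
      obtain ⟨d, hd⟩ := hp
      obtain ⟨o', ho'⟩ := exists_outcome C A l hnd hal _ hd
      have h2 := hP (o' :: h) ⟨d, by rw [amp_cons_some hl]; exact ho'⟩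
      have h3 := length_used C (D xs) xs rs (o' :: h)
      rw [used_cons, hl, Option.getD_some] at h3
      have h4 : (D xs).length = n := by rw [hDA, List.length_ofFn]
      show _ < n + 2 * P
      omega

/-- Every circuit is simulated, in the same time, by one that addresses its qubits by small numbers. -/
theorem exists_relabel (C : Circuit Q G) (A : Architecture Q) (D : List Bool → List Q)
    (hD : PT Coded.enc Coded.enc D) (hδ : ∀ n, Function.Injective (A.data n))
    (hDA : ∀ xs, D xs = List.ofFn (A.data xs.length)) (hleg : C.Legal A) (T P : ℕ → ℕ)
    (hT : ∀ n, C.depth A n ≤ T n) (hP : ∀ n, C.size A n ≤ P n) :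
    ∃ C₁ : Circuit ℕ G, PT Coded.enc (eO (eL (eOp eU))) (fun i : List Bool × List Bool × List (List Bool) =>
        C₁.next i.1 i.2.1 i.2.2) ∧ C₁.Legal CCAC ∧ (∀ n, C₁.depth CCAC n ≤ T n) ∧
      (∀ n, C₁.size CCAC n ≤ P n) ∧ (∀ n x, C₁.acted CCAC n x ⊆ {q | q < n + 2 * P n}) ∧
      ∀ n x, C₁.channel CCAC n x = C.channel A n x := by
  refine ⟨relabel C D hD, relabelNext_polyTime C hD, ?_⟩
  have := simulation C A (relabel C D hD) CCAC 0 0 (fun _ => 1) (fun n => {q | q < n + 2 * P n}) rfl hδ hleg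
    T P hT hP fun n xs rs hxs hrs => by
      have hd : D xs = List.ofFn (A.data n) := by subst hxs; exact hDA xs
      obtain ⟨x, rfl⟩ := exists_ofFn_of_length hxs
      obtain ⟨r, rfl⟩ := exists_ofFn_of_length hrs
      refine ⟨_, _, relabel_rounds C A D hD (hδ n) hd (fun h hp => ?_) fun h l hp hl => hleg n x r h hp l hl⟩
      · have := hP n
        simp only [Circuit.size, iSup_le_iff] at this
        exact_mod_cast this x r h hp
  simpa using this

end
end QArch

namespace QArch
set_option linter.unusedSectionVars false
set_option linter.unusedSimpArgs false

/-! ## Moving qubits on the grid -/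

/-- The point with first two coordinates `a` and `b`, and all others zero. -/
def gridPt (k : ℕ) (a b : ℕ) : Fin k → ℤ := fun j => if j.val = 0 then a else if j.val = 1 then b else 0

theorem gridPt_inj {k : ℕ} (hk : 2 ≤ k) {a b a' b' : ℕ} :
    gridPt k a b = gridPt k a' b' ↔ a = a' ∧ b = b' := by
  constructor
  · intro h
    have h0 := congrFun h ⟨0, by omega⟩
    have h1 := congrFun h ⟨1, by omega⟩
    simp only [gridPt, if_true, one_ne_zero, if_false] at h0 h1
    exact ⟨by exact_mod_cast h0, by exact_mod_cast h1⟩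
  · rintro ⟨rfl, rfl⟩; rfl

theorem gridPt_adj_right {k : ℕ} (hk : 2 ≤ k) (a b : ℕ) :
    (CCNTC k).adj (gridPt k a b) (gridPt k (a + 1) b) ∧ (CCNTC k).adj (gridPt k (a + 1) b) (gridPt k a b) := by
  constructor
  all_goals
    show ∑ i, |gridPt k _ _ i - gridPt k _ _ i| = 1
    rw [Finset.sum_eq_single ⟨0, by omega⟩]
    · simp [gridPt]
    · intro j _ hj
      have : j.val ≠ 0 := fun h => hj (Fin.ext h)
      simp [gridPt, this]
    · simp

theorem gridPt_adj_up {k : ℕ} (hk : 2 ≤ k) (a b : ℕ) :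
    (CCNTC k).adj (gridPt k a b) (gridPt k a (b + 1)) ∧ (CCNTC k).adj (gridPt k a (b + 1)) (gridPt k a b) := by
  constructor
  all_goals
    show ∑ i, |gridPt k _ _ i - gridPt k _ _ i| = 1
    rw [Finset.sum_eq_single ⟨1, by omega⟩]
    · simp [gridPt]
    · intro j _ hj
      have : j.val ≠ 1 := fun h => hj (Fin.ext h)
      simp [gridPt, this]
    · simp

/-! ### Straight paths of hops. -/

section

variable {Q : Type} [DecidableEq Q]

/-- The hops along a line of points. -/
def linePath (f : ℕ → Q) (m : ℕ) : List (Q × Q × Q) :=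
  (List.range m).map fun j => (f (2 * j), f (2 * j + 1), f (2 * j + 2))

theorem length_linePath (f : ℕ → Q) (m : ℕ) : (linePath f m).length = m := by simp [linePath]

theorem linePath_succ (f : ℕ → Q) (m : ℕ) :
    linePath f (m + 1) = linePath f m ++ [(f (2 * m), f (2 * m + 1), f (2 * m + 2))] := by
  simp [linePath, List.range_succ]

theorem linePath_isPath (f : ℕ → Q) (m : ℕ) : IsPath (f 0) (linePath f m) (f (2 * m)) := by
  induction m with
  | zero => rfl
  | succ m ih => rw [linePath_succ]; exact ih.append_hop _ _

theorem cells_linePath (f : ℕ → Q) (m : ℕ) :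
    f 0 :: cells (linePath f m) = (List.range (2 * m + 1)).map f := by
  induction m with
  | zero => rfl
  | succ m ih =>
    have : cells (linePath f (m + 1)) = cells (linePath f m) ++ [f (2 * m + 1), f (2 * m + 2)] := by
      rw [linePath_succ]; simp [cells]
    rw [this, ← List.cons_append, ih, show 2 * (m + 1) + 1 = 2 * m + 1 + 1 + 1 by ring,
      List.range_succ (n := 2 * m + 1 + 1), List.range_succ (n := 2 * m + 1)]
    simp only [List.map_append, List.append_assoc]
    rfl

theorem mem_cells_linePath {f : ℕ → Q} {m : ℕ} {q : Q} (h : q ∈ f 0 :: cells (linePath f m)) :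
    ∃ y ≤ 2 * m, q = f y := by
  rw [cells_linePath] at h
  obtain ⟨y, hy, rfl⟩ := List.mem_map.1 h
  exact ⟨y, by have := List.mem_range.1 hy; omega, rfl⟩

theorem mem_cells_linePath' {f : ℕ → Q} (hf : Function.Injective f) {m : ℕ} {q : Q}
    (h : q ∈ cells (linePath f m)) : ∃ y ≤ 2 * m, 1 ≤ y ∧ q = f y := by
  obtain ⟨y, hy, rfl⟩ := mem_cells_linePath (List.mem_cons_of_mem _ h)
  refine ⟨y, hy, Nat.one_le_iff_ne_zero.2 ?_, rfl⟩
  rintro rfl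
  have : (f 0 :: cells (linePath f m)).Nodup := by
    rw [cells_linePath]; exact List.nodup_range.map hf
  exact (List.nodup_cons.1 this).1 h

theorem linePath_nodup {f : ℕ → Q} (hf : Function.Injective f) (m : ℕ) :
    (f 0 :: cells (linePath f m)).Nodup := by
  rw [cells_linePath]; exact List.nodup_range.map hf

theorem mem_linePath {f : ℕ → Q} {m : ℕ} {e : Q × Q × Q} (h : e ∈ linePath f m) :
    ∃ y, y + 2 ≤ 2 * m ∧ e = (f y, f (y + 1), f (y + 2)) := by
  obtain ⟨j, hj, rfl⟩ := List.mem_map.1 h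
  exact ⟨2 * j, by have := List.mem_range.1 hj; omega, rfl⟩

end

/-! ### Two-qubit gates of a timestep and their rows. -/

/-- The pairs of qubits that two-qubit gates are to act on, smaller one first, each with a number. -/
def moves : List (Op ℕ) → List (ℕ × ℕ × ℕ)
  | [] => []
  | Op.gate2 _ p q :: l =>
    (if p < q then (p, q, (moves l).length + 1) else (q, p, (moves l).length + 1)) :: moves l
  | Op.meas _ :: l => moves l
  | Op.gate1 _ _ :: l => moves l

/-- The qubits to be moved, with the numbers of their moves. -/
def movers (ms : List (ℕ × ℕ × ℕ)) : List (ℕ × ℕ) := ms.flatMap fun m => [(m.1, m.2.2), (m.2.1, m.2.2)]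

/-- `N` bounds the qubits, that is, the columns, and `R` bounds the numbers of the moves. The
numbers start at `1`, which reserves row `0` for resting qubits. -/
structure MovesOk (N R : ℕ) (ms : List (ℕ × ℕ × ℕ)) : Prop where
  nodup : ((movers ms).map Prod.fst).Nodup
  lt : ∀ m ∈ ms, m.1 < m.2.1 ∧ m.2.1 < N
  row : ∀ m ∈ ms, 1 ≤ m.2.2 ∧ m.2.2 ≤ R
  rows : ms.Pairwise fun m m' => m.2.2 ≠ m'.2.2

theorem length_moves (l : List (Op ℕ)) : (moves l).length ≤ l.length := by
  induction l with
  | nil => exact le_rfl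
  | cons x l ih => cases x <;> simp only [moves, List.length_cons] <;> omega

theorem moves_row (l : List (Op ℕ)) : ∀ m ∈ moves l, 1 ≤ m.2.2 ∧ m.2.2 ≤ (moves l).length := by
  induction l with
  | nil => simp [moves]
  | cons x l ih =>
    cases x with
    | meas q => exact ih
    | gate1 g q => exact ih
    | gate2 g p q =>
      intro m hm
      simp only [moves, List.mem_cons, List.length_cons] at hm ⊢
      rcases hm with rfl | hm
      · split <;> simp
      · have := ih m hm; omega

theorem movers_subset (l : List (Op ℕ)) : ∀ i ∈ (movers (moves l)).map Prod.fst, i ∈ l.flatMap Op.qubits := by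
  induction l with
  | nil => simp [moves, movers]
  | cons x l ih =>
    intro i hi
    rw [List.flatMap_cons, List.mem_append]
    cases x with
    | meas q => exact Or.inr (ih i hi)
    | gate1 g q => exact Or.inr (ih i hi)
    | gate2 g p q =>
      simp only [moves, movers, List.flatMap_cons, List.map_append, List.mem_append] at hi
      rcases hi with hi | hi
      · left
        split at hi <;> simp [Op.qubits] at hi ⊢ <;> tauto
      · exact Or.inr (ih i hi)

theorem moves_ok {N : ℕ} {l : List (Op ℕ)} (hn : (l.flatMap Op.qubits).Nodup)
    (hN : ∀ q ∈ l.flatMap Op.qubits, q < N) : MovesOk N l.length (moves l) := by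
  refine ⟨?_, ?_, fun m hm => ⟨(moves_row l m hm).1, (moves_row l m hm).2.trans (length_moves l)⟩, ?_⟩
  · induction l with
    | nil => simp [moves, movers]
    | cons x l ih =>
      rw [List.flatMap_cons] at hn hN
      have hn' := List.nodup_append.1 hn
      have ih := ih hn'.2.1 fun q hq => hN q (List.mem_append_right _ hq)
      cases x with
      | meas q => exact ih
      | gate1 g q => exact ih
      | gate2 g p q =>
        simp only [moves, movers, List.flatMap_cons, List.map_append]
        refine List.nodup_append.2 ⟨?_, ih, fun i hi j hj => ?_⟩
        · have := hn'.1
          split <;> simp [Op.qubits] at this ⊢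
          · exact this
          · exact Ne.symm this
        · refine hn'.2.2 i ?_ j (movers_subset l j hj)
          split at hi <;> simp [Op.qubits] at hi ⊢ <;> tauto
  · induction l with
    | nil => simp [moves]
    | cons x l ih =>
      rw [List.flatMap_cons] at hn hN
      have hn' := List.nodup_append.1 hn
      have ih := ih hn'.2.1 fun q hq => hN q (List.mem_append_right _ hq)
      cases x with
      | meas q => exact ih
      | gate1 g q => exact ih
      | gate2 g p q =>
        intro m hm
        rcases List.mem_cons.1 hm with rfl | hm
        · have h1 : p ≠ q := by simpa [Op.qubits] using hn'.1
          have h2 := hN p (by simp [Op.qubits])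
          have h3 := hN q (by simp [Op.qubits])
          split <;> simp <;> omega
        · exact ih m hm
  · clear hn hN
    induction l with
    | nil => simp [moves]
    | cons x l ih =>
      cases x with
      | meas q => exact ih
      | gate1 g q => exact ih
      | gate2 g p q =>
        refine List.pairwise_cons.2 ⟨fun m hm => ?_, ih⟩
        have := moves_row l m hm
        split <;> simp <;> omega

theorem mem_moves_gate2 {l : List (Op ℕ)} {g : GateRef} {p q : ℕ} (h : Op.gate2 g p q ∈ l) :
    ∃ m ∈ moves l, (m.1 = p ∧ m.2.1 = q) ∨ (m.1 = q ∧ m.2.1 = p) := by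
  induction l with
  | nil => simp at h
  | cons x l ih =>
    rcases List.mem_cons.1 h with rfl | h
    · refine ⟨_, List.mem_cons_self, ?_⟩
      split <;> simp
    · obtain ⟨m, hm, h⟩ := ih h
      refine ⟨m, ?_, h⟩
      cases x with
      | meas q => exact hm
      | gate1 g q => exact hm
      | gate2 g p q => exact List.mem_cons_of_mem _ hm

section

variable {k : ℕ}

/-! ### Places during a round and the three stages of the motion. -/

/-- Places of the qubits, given for the smaller and the larger qubit of each move. -/
def places (k : ℕ) (F F' : ℕ × ℕ × ℕ → Fin k → ℤ) (ms : List (ℕ × ℕ × ℕ)) (i : ℕ) : Fin k → ℤ :=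
  lookupD (ms.flatMap fun m => [(m.1, F m), (m.2.1, F' m)]) i (gridPt k i 0)

theorem places_keys (F F' : ℕ × ℕ × ℕ → Fin k → ℤ) (ms : List (ℕ × ℕ × ℕ)) :
    (ms.flatMap fun m => [(m.1, F m), (m.2.1, F' m)]).map Prod.fst = (movers ms).map Prod.fst := by
  simp [movers, List.map_flatMap]

theorem places_lo {N R : ℕ} {ms : List (ℕ × ℕ × ℕ)} (h : MovesOk N R ms) (F F' : ℕ × ℕ × ℕ → Fin k → ℤ)
    {m : ℕ × ℕ × ℕ} (hm : m ∈ ms) : places k F F' ms m.1 = F m :=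
  lookupD_of_mem (p := (m.1, F m)) _ (by rw [places_keys]; exact h.nodup)
    (List.mem_flatMap.2 ⟨m, hm, by simp⟩)

theorem places_hi {N R : ℕ} {ms : List (ℕ × ℕ × ℕ)} (h : MovesOk N R ms) (F F' : ℕ × ℕ × ℕ → Fin k → ℤ)
    {m : ℕ × ℕ × ℕ} (hm : m ∈ ms) : places k F F' ms m.2.1 = F' m :=
  lookupD_of_mem (p := (m.2.1, F' m)) _ (by rw [places_keys]; exact h.nodup)
    (List.mem_flatMap.2 ⟨m, hm, by simp⟩)

theorem places_other {ms : List (ℕ × ℕ × ℕ)} (F F' : ℕ × ℕ × ℕ → Fin k → ℤ) {i : ℕ}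
    (hi : i ∉ (movers ms).map Prod.fst) : places k F F' ms i = gridPt k i 0 :=
  lookupD_of_not_mem _ (by rw [places_keys]; exact hi)

theorem mem_movers {ms : List (ℕ × ℕ × ℕ)} {i : ℕ} :
    i ∈ (movers ms).map Prod.fst ↔ ∃ m ∈ ms, i = m.1 ∨ i = m.2.1 := by
  simp only [movers, List.map_flatMap, List.mem_flatMap, List.map_cons, List.map_nil, List.mem_cons,
    List.not_mem_nil, or_false]

theorem places_range {N R : ℕ} {ms : List (ℕ × ℕ × ℕ)} (h : MovesOk N R ms)
    {F F' : ℕ × ℕ × ℕ → Fin k → ℤ} {q : Fin k → ℤ} (hq : q ∈ Set.range (places k F F' ms)) :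
    (∃ m ∈ ms, q = F m ∨ q = F' m) ∨ ∃ i, q = gridPt k i 0 := by
  obtain ⟨i, rfl⟩ := hq
  by_cases hi : i ∈ (movers ms).map Prod.fst
  · obtain ⟨m, hm, rfl | rfl⟩ := mem_movers.1 hi
    · exact Or.inl ⟨m, hm, Or.inl (places_lo h F F' hm)⟩
    · exact Or.inl ⟨m, hm, Or.inr (places_hi h F F' hm)⟩
  · exact Or.inr ⟨i, places_other F F' hi⟩

/-- Initial places. -/
def home (k : ℕ) (i : ℕ) : Fin k → ℤ := gridPt k i 0

/-- The move with number `r` owns two rows: row `2 * r` is its track and row `2 * r + 1` its siding.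
Even heights suit the hops, each of which covers two cells. -/
def loUp (k : ℕ) (m : ℕ × ℕ × ℕ) : Fin k → ℤ := gridPt k m.1 (2 * m.2.2)

def hiUp (k : ℕ) (m : ℕ × ℕ × ℕ) : Fin k → ℤ := gridPt k m.2.1 (2 * m.2.2)

/-- Hops cover even distances. If the gap is even, the smaller qubit will arrive in the column of
the larger one, which therefore moves to the siding; if it is odd, the smaller qubit stops one cell
short. -/
def hiOff (k : ℕ) (m : ℕ × ℕ × ℕ) : Fin k → ℤ :=
  if decide ((m.2.1 - m.1) % 2 = 0) then gridPt k m.2.1 (2 * m.2.2 + 1) else gridPt k m.2.1 (2 * m.2.2)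

def loEnd (k : ℕ) (m : ℕ × ℕ × ℕ) : Fin k → ℤ :=
  gridPt k (m.1 + 2 * ((m.2.1 - m.1) / 2)) (2 * m.2.2)

/-- The vertical paths. -/
def vertPaths (k : ℕ) (ms : List (ℕ × ℕ × ℕ)) : Paths (Fin k → ℤ) :=
  (movers ms).map fun t => (t.1, linePath (fun y => gridPt k t.1 y) t.2)

/-- The horizontal paths. -/
def horPaths (k : ℕ) (ms : List (ℕ × ℕ × ℕ)) : Paths (Fin k → ℤ) :=
  ms.map fun m => (m.1, linePath (fun x => gridPt k (m.1 + x) (2 * m.2.2)) ((m.2.1 - m.1) / 2))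

/-- The exchanges that make room for the horizontal paths. -/
def sideSteps (k : ℕ) (ms : List (ℕ × ℕ × ℕ)) : List (ℕ × (Fin k → ℤ) × (Fin k → ℤ)) :=
  (ms.filter fun m => decide ((m.2.1 - m.1) % 2 = 0)).map fun m =>
    (m.2.1, gridPt k m.2.1 (2 * m.2.2), gridPt k m.2.1 (2 * m.2.2 + 1))

theorem home_injective (hk : 2 ≤ k) : Function.Injective (home k) := fun _ _ h => ((gridPt_inj hk).1 h).1

theorem vert_injective (hk : 2 ≤ k) (c : ℕ) : Function.Injective fun y => gridPt k c y :=
  fun _ _ h => ((gridPt_inj hk).1 h).2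

theorem hor_injective (hk : 2 ≤ k) (a r : ℕ) : Function.Injective fun x => gridPt k (a + x) r :=
  fun _ _ h => by have := ((gridPt_inj hk).1 h).1; omega

variable {N R : ℕ} {ms : List (ℕ × ℕ × ℕ)}

theorem eq_of_row (h : MovesOk N R ms) {m m' : ℕ × ℕ × ℕ} (hm : m ∈ ms) (hm' : m' ∈ ms)
    (he : m.2.2 = m'.2.2) : m = m' := by
  by_contra hne
  have hs : Std.Symm fun m m' : ℕ × ℕ × ℕ => m.2.2 ≠ m'.2.2 := ⟨fun _ _ h => h.symm⟩
  exact h.rows.forall hm hm' hne he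

/-- Every moving qubit stays in its own column, and the paths leave at once row `0`, the only
occupied row. -/
theorem vert_routes (hk : 2 ≤ k) (h : MovesOk N R ms) :
    Routes (home k) (places k (loUp k) (hiUp k) ms) (vertPaths k ms) := by
  have hkeys : (vertPaths k ms).map Prod.fst = (movers ms).map Prod.fst := by
    simp [vertPaths, Function.comp_def]
  have hfr : ∀ t ∈ vertPaths k ms, ∀ q ∈ cells t.2, q ∉ Set.range (home k) := by
    rintro t ht q hq ⟨i, rfl⟩
    obtain ⟨c, hc, rfl⟩ := List.mem_map.1 ht
    obtain ⟨y, _, hy1, hy⟩ := mem_cells_linePath' (vert_injective hk c.1) hq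
    have := ((gridPt_inj hk).1 hy).2
    omega
  refine ⟨by rw [hkeys]; exact h.nodup, ?_, ?_, ?_, hfr, ?_⟩
  · intro t ht
    obtain ⟨c, hc, rfl⟩ := List.mem_map.1 ht
    have he : places k (loUp k) (hiUp k) ms c.1 = gridPt k c.1 (2 * c.2) := by
      obtain ⟨m, hm, hc⟩ := List.mem_flatMap.1 hc
      simp only [List.mem_cons, List.not_mem_nil, or_false] at hc
      rcases hc with rfl | rfl
      · exact places_lo h _ _ hm
      · exact places_hi h _ _ hm
    rw [he]
    exact linePath_isPath (fun y => gridPt k c.1 y) c.2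
  · intro i hi
    rw [hkeys] at hi
    exact (places_other _ _ hi).symm
  · intro t ht
    obtain ⟨c, hc, rfl⟩ := List.mem_map.1 ht
    exact linePath_nodup (vert_injective hk c.1) c.2
  · rw [vertPaths, List.pairwise_map]
    have := h.nodup
    rw [List.Nodup, List.pairwise_map] at this
    refine this.imp fun {c c'} hne q hq hq' => hne ?_
    obtain ⟨y, _, e⟩ := mem_cells_linePath (f := fun y => gridPt k c.1 y) hq
    obtain ⟨y', _, e'⟩ := mem_cells_linePath (f := fun y => gridPt k c'.1 y) hq'
    rw [e] at e'
    exact ((gridPt_inj hk).1 e').1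

/-- Nothing occupies an odd row before this stage, since the vertical stage ends in even rows. -/
theorem side_swaps (hk : 2 ≤ k) (h : MovesOk N R ms) :
    Swaps (places k (loUp k) (hiUp k) ms) (places k (loUp k) (hiOff k) ms) (sideSteps k ms) := by
  have hmem : ∀ t ∈ sideSteps k ms, ∃ m ∈ ms, (m.2.1 - m.1) % 2 = 0 ∧
      t = (m.2.1, gridPt k m.2.1 (2 * m.2.2), gridPt k m.2.1 (2 * m.2.2 + 1)) := by
    intro t ht
    obtain ⟨m, hm, rfl⟩ := List.mem_map.1 ht
    rw [List.mem_filter, decide_eq_true_iff] at hm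
    exact ⟨m, hm.1, hm.2, rfl⟩
  have hhi : (ms.map fun m => m.2.1).Nodup := by
    refine h.nodup.sublist ?_
    simp only [movers, List.map_flatMap]
    have : ∀ ms : List (ℕ × ℕ × ℕ), (ms.map fun m => m.2.1).Sublist
        (ms.flatMap fun m => [(m.1, m.2.2), (m.2.1, m.2.2)].map Prod.fst) := by
      intro ms
      induction ms with
      | nil => exact List.Sublist.refl _
      | cons m ms ih => exact (ih.cons_cons _).cons _
    exact this ms
  refine ⟨?_, ?_, ?_, ?_, ?_⟩
  · rw [sideSteps, List.map_map]
    exact hhi.sublist (List.filter_sublist.map _)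
  · intro t ht
    obtain ⟨m, hm, hev, rfl⟩ := hmem t ht
    exact ⟨places_hi h _ _ hm, (places_hi h _ _ hm).trans (by simp [hiOff, hev])⟩
  · intro i hi
    by_cases hi' : i ∈ (movers ms).map Prod.fst
    · obtain ⟨m, hm, rfl | rfl⟩ := mem_movers.1 hi'
      · rw [places_lo h _ _ hm, places_lo h _ _ hm]
      · rw [places_hi h _ _ hm, places_hi h _ _ hm, hiOff, if_neg]
        · rfl
        · intro hev
          apply hi
          rw [sideSteps, List.map_map]
          exact List.mem_map.2 ⟨m, List.mem_filter.2 ⟨hm, hev⟩, rfl⟩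
    · rw [places_other _ _ hi', places_other _ _ hi']
  · intro t ht hr
    obtain ⟨m, hm, hev, rfl⟩ := hmem t ht
    rcases places_range h hr with ⟨m', hm', hq | hq⟩ | ⟨i, hq⟩ <;>
      have := ((gridPt_inj hk).1 hq).2 <;> omega
  · rw [sideSteps, List.pairwise_map]
    have h1 := hhi.sublist ((List.filter_sublist (l := ms)
      (p := fun m => decide ((m.2.1 - m.1) % 2 = 0))).map _)
    rw [List.Nodup, List.pairwise_map] at h1
    exact h1.imp fun hne he => hne ((gridPt_inj hk).1 he).1

/-- Distinct moves use distinct rows, and the track of a move contains no qubits but its own two;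
the larger one is either on the siding or just beyond the end of the path. -/
theorem hor_routes (hk : 2 ≤ k) (h : MovesOk N R ms) :
    Routes (places k (loUp k) (hiOff k) ms) (places k (loEnd k) (hiOff k) ms) (horPaths k ms) := by
  have hkeys : (horPaths k ms).map Prod.fst = ms.map Prod.fst := by
    simp [horPaths, Function.comp_def]
  refine ⟨?_, ?_, ?_, ?_, ?_, ?_⟩
  · rw [hkeys]
    refine h.nodup.sublist ?_
    simp only [movers, List.map_flatMap]
    have : ∀ ms : List (ℕ × ℕ × ℕ), (ms.map Prod.fst).Sublist
        (ms.flatMap fun m => [(m.1, m.2.2), (m.2.1, m.2.2)].map Prod.fst) := by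
      intro ms
      induction ms with
      | nil => exact List.Sublist.refl _
      | cons m ms ih => exact (ih.cons _).cons_cons _
    exact this ms
  · intro t ht
    obtain ⟨m, hm, rfl⟩ := List.mem_map.1 ht
    dsimp only
    rw [places_lo h _ _ hm, places_lo h _ _ hm]
    exact linePath_isPath (fun x => gridPt k (m.1 + x) (2 * m.2.2)) _
  · intro i hi
    rw [hkeys] at hi
    by_cases hi' : i ∈ (movers ms).map Prod.fst
    · obtain ⟨m, hm, rfl | rfl⟩ := mem_movers.1 hi'
      · exact absurd (List.mem_map_of_mem hm) hi
      · rw [places_hi h _ _ hm, places_hi h _ _ hm]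
    · rw [places_other _ _ hi', places_other _ _ hi']
  · intro t ht
    obtain ⟨m, hm, rfl⟩ := List.mem_map.1 ht
    dsimp only
    rw [places_lo h _ _ hm]
    exact linePath_nodup (hor_injective hk m.1 (2 * m.2.2)) _
  · intro t ht q hq hr
    obtain ⟨m, hm, rfl⟩ := List.mem_map.1 ht
    obtain ⟨x, hx, hx1, rfl⟩ := mem_cells_linePath' (hor_injective hk m.1 (2 * m.2.2)) hq
    have hlt := h.lt m hm
    have hrow := h.row m hm
    rcases places_range h hr with ⟨m', hm', hq | hq⟩ | ⟨i, hq⟩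
    · obtain ⟨e1, e2⟩ := (gridPt_inj hk).1 hq
      obtain rfl := eq_of_row h hm hm' (by omega)
      omega
    · unfold hiOff at hq
      split at hq
      · have := ((gridPt_inj hk).1 hq).2
        omega
      -- For an odd gap the larger qubit is at distance `m.2.1 - m.1` from the start, strictly more
      -- than the length `2 * ((m.2.1 - m.1) / 2)` of the path.
      · rename_i hodd
        rw [decide_eq_true_iff] at hodd
        obtain ⟨e1, e2⟩ := (gridPt_inj hk).1 hq
        obtain rfl := eq_of_row h hm hm' (by omega)
        omega
    · have := ((gridPt_inj hk).1 hq).2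
      omega
  · rw [horPaths, List.pairwise_map]
    refine h.rows.imp_of_mem fun {m m'} hm hm' hne q hq hq' => hne ?_
    dsimp only at hq hq'
    rw [places_lo h _ _ hm] at hq
    rw [places_lo h _ _ hm'] at hq'
    obtain ⟨y, _, e⟩ := mem_cells_linePath (f := fun x => gridPt k (m.1 + x) (2 * m.2.2)) hq
    obtain ⟨y', _, e'⟩ := mem_cells_linePath (f := fun x => gridPt k (m'.1 + x) (2 * m'.2.2)) hq'
    rw [e] at e'
    have := ((gridPt_inj hk).1 e').2
    omega

/-- After the moves, the two qubits of a two-qubit gate are neighbours. -/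
theorem places_adj (hk : 2 ≤ k) (h : MovesOk N R ms) {m : ℕ × ℕ × ℕ} (hm : m ∈ ms) :
    (CCNTC k).adj (places k (loEnd k) (hiOff k) ms m.1) (places k (loEnd k) (hiOff k) ms m.2.1) ∧
      (CCNTC k).adj (places k (loEnd k) (hiOff k) ms m.2.1) (places k (loEnd k) (hiOff k) ms m.1) := by
  rw [places_lo h _ _ hm, places_hi h _ _ hm]
  have hlt := h.lt m hm
  unfold loEnd hiOff
  split
  · rename_i hev
    rw [decide_eq_true_iff] at hev
    have : m.1 + 2 * ((m.2.1 - m.1) / 2) = m.2.1 := by omega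
    rw [this]
    exact gridPt_adj_up hk _ _
  · rename_i hodd
    rw [decide_eq_true_iff] at hodd
    have : m.2.1 = m.1 + 2 * ((m.2.1 - m.1) / 2) + 1 := by omega
    have h2 := gridPt_adj_right hk (m.1 + 2 * ((m.2.1 - m.1) / 2)) (2 * m.2.2)
    rwa [← this] at h2

theorem sideSteps_nodup (hk : 2 ≤ k) (h : MovesOk N R ms) :
    (pairQubits ((sideSteps k ms).map Prod.snd)).Nodup := by
  rw [sideSteps, List.map_map, pairQubits, List.flatMap_map, List.nodup_flatMap]
  refine ⟨fun m _ => ?_, (h.rows.sublist List.filter_sublist).imp fun {m m'} hne q hq hq' => hne ?_⟩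
  · simp [gridPt_inj hk]
  · simp only [Function.comp, List.mem_cons, List.not_mem_nil, or_false] at hq hq'
    rcases hq with rfl | rfl <;> rcases hq' with h1 | h1 <;> have := ((gridPt_inj hk).1 h1).2 <;> omega

end

/-! ### Reversal, duration and legality of the stages. -/

section

variable {Q : Type} [DecidableEq Q] [Coded Q] {G : GateSet}

def revPaths (L : Paths Q) : Paths Q := L.map fun t => (t.1, revPath t.2)

def revSteps (L : List (ℕ × Q × Q)) : List (ℕ × Q × Q) := L.map fun t => (t.1, t.2.2, t.2.1)

theorem pairQubits_revSteps (L : List (ℕ × Q × Q)) :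
    (pairQubits ((revSteps L).map Prod.snd)).Perm (pairQubits (L.map Prod.snd)) := by
  induction L with
  | nil => exact List.Perm.refl _
  | cons e E ih => exact (List.Perm.swap _ _ _).trans ((ih.cons _).cons _)

/-- Number of timesteps of a teleportation. -/
def transportLen (W : Words) : ℕ :=
  W.bell.length + (W.bell'.length +
    (W.flip.length + (W.flip.length + (W.flip.length + W.phase.length)) + 1))

/-- The duration depends only on the lengths of the words, not on the number or the length of the
paths; this is the source of the constant slowdown. -/
theorem length_transport (W : Words) (L : Paths Q) : (transport W L).length = transportLen W := by
  simp [transport, length_layer, transportLen]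

/-- Both steps of a hop are allowed, and the hop stays in the region. -/
def HopOk (A : Architecture Q) (S : Set Q) (e : Q × Q × Q) : Prop :=
  ((A.adj e.1 e.2.1 ∧ A.adj e.2.1 e.1) ∧ (A.adj e.2.1 e.2.2 ∧ A.adj e.2.2 e.2.1)) ∧
    (e.1 ∈ S ∧ e.2.1 ∈ S ∧ e.2.2 ∈ S)

theorem transport_rev_opsOk {C : Circuit Q G} {W : Words} (hW : W.Ok C.wired1 C.wired2) {π π' : ℕ → Q}
    {L : Paths Q} (hπ : Function.Injective π) (h : Routes π π' L) {A : Architecture Q} {S : Set Q}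
    (hL : ∀ t ∈ L, ∀ e ∈ t.2, HopOk A S e) {b : ℕ} (hb : 2 * (L.map fun t => t.2.length).sum ≤ b) :
    (∀ f ∈ transport W L, ∀ p, OpsOk C A S b (f p)) ∧
      ∀ f ∈ transport W (revPaths L), ∀ p, OpsOk C A S b (f p) := by
  have hR : ∀ t ∈ revPaths L, ∀ e ∈ t.2, HopOk A S e := by
    intro t' ht' e he
    obtain ⟨t, ht, rfl⟩ := List.mem_map.1 ht'
    rw [revPath, List.mem_reverse, List.mem_map] at he
    obtain ⟨e, he, rfl⟩ := he
    have := hL t ht e he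
    exact ⟨⟨this.1.2.symm, this.1.1.symm⟩, this.2.2.2, this.2.2.1, this.2.1⟩
  have hlen : ((revPaths L).map fun t => t.2.length).sum = (L.map fun t => t.2.length).sum := by
    simp [revPaths, revPath, Function.comp_def]
  constructor
  · exact fun f hf p => (transport_opsOk hW h (fun t ht e he => (hL t ht e he).1)
      (fun t ht e he => (hL t ht e he).2) f hf p).mono hb
  · exact fun f hf p => (transport_opsOk hW (h.rev hπ) (fun t ht e he => (hR t ht e he).1)
      (fun t ht e he => (hR t ht e he).2) f hf p).mono (hlen ▸ hb)

theorem exchange_opsOk {C : Circuit Q G} {W : Words} (hW : W.Ok C.wired1 C.wired2)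
    {L : List (ℕ × Q × Q)} (hn : (pairQubits (L.map Prod.snd)).Nodup) {A : Architecture Q} {S : Set Q}
    (hL : ∀ t ∈ L, (A.adj t.2.1 t.2.2 ∧ A.adj t.2.2 t.2.1) ∧ t.2.1 ∈ S ∧ t.2.2 ∈ S) {b : ℕ}
    (hb : L.length ≤ b) : (∀ f ∈ exchange W L, ∀ p, OpsOk C A S b (f p)) ∧
      ∀ f ∈ exchange W (revSteps L), ∀ p, OpsOk C A S b (f p) := by
  constructor
  · refine layer_opsOk hW.swap (fun _ => L.map Prod.snd) fun _ => ⟨hn, ?_, ?_, by simpa using hb⟩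
    all_goals
      intro e he
      obtain ⟨t, ht, rfl⟩ := List.mem_map.1 he
    · exact (hL t ht).1
    · exact (hL t ht).2
  · refine layer_opsOk hW.swap (fun _ => (revSteps L).map Prod.snd) fun _ =>
      ⟨(pairQubits_revSteps L).nodup_iff.2 hn, ?_, ?_, by simpa [revSteps] using hb⟩
    all_goals
      intro e he
      obtain ⟨t', ht', rfl⟩ := List.mem_map.1 he
      obtain ⟨t, ht, rfl⟩ := List.mem_map.1 ht'
    · exact (hL t ht).1.symm
    · exact (hL t ht).2.symm

end

/-! ### A timestep on the grid -/

section

variable {k : ℕ} {G : GateSet}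

/-- The timesteps that bring together the qubits of each move. -/
def gather (k : ℕ) (W : Words) (ms : List (ℕ × ℕ × ℕ)) :
    List (List (List Bool) → List (Op (Fin k → ℤ))) :=
  transport W (vertPaths k ms) ++ (exchange W (sideSteps k ms) ++ transport W (horPaths k ms))

/-- The timesteps that bring them back. -/
def scatter (k : ℕ) (W : Words) (ms : List (ℕ × ℕ × ℕ)) :
    List (List (List Bool) → List (Op (Fin k → ℤ))) :=
  transport W (revPaths (horPaths k ms)) ++
    (exchange W (revSteps (sideSteps k ms)) ++ transport W (revPaths (vertPaths k ms)))

def gatherLen (W : Words) : ℕ := transportLen W + (W.swap.length + transportLen W)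

/-- The timesteps on the grid that simulate one timestep with operations `l`. -/
def phases (k : ℕ) (W : Words) (l : List (Op ℕ)) : List (List (List Bool) → List (Op (Fin k → ℤ))) :=
  gather k W (moves l) ++ (fun _ => l.map (Op.map (places k (loEnd k) (hiOff k) (moves l)))) ::
    scatter k W (moves l)

theorem length_gather (W : Words) (ms : List (ℕ × ℕ × ℕ)) : (gather k W ms).length = gatherLen W := by
  simp [gather, length_transport, exchange, length_layer, gatherLen]

theorem length_scatter (W : Words) (ms : List (ℕ × ℕ × ℕ)) : (scatter k W ms).length = gatherLen W := by
  simp [scatter, length_transport, exchange, length_layer, gatherLen]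

variable {N R : ℕ} {ms : List (ℕ × ℕ × ℕ)}

/-- A by-product of the routing lemmas; the outcomes fed into them are irrelevant here. -/
theorem places_injective (hk : 2 ≤ k) (h : MovesOk N R ms) :
    Function.Injective (places k (loUp k) (hiUp k) ms) ∧
      Function.Injective (places k (loUp k) (hiOff k) ms) ∧
      Function.Injective (places k (loEnd k) (hiOff k) ms) := by
  have h1 := (Routes.place (fun _ => false) _ _ _ (home_injective hk) (vert_routes hk h)).1
  have h2 := (Swaps.place _ _ _ h1 (side_swaps hk h)).1
  exact ⟨h1, h2, (Routes.place (fun _ => false) _ _ _ h2 (hor_routes hk h)).1⟩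

theorem gather_block (hk : 2 ≤ k) {C : Circuit (Fin k → ℤ) G} {W : Words}
    (hW : W.Ok C.wired1 C.wired2) (h : MovesOk N R ms) : ∃ prof,
    Block C (gather k W ms) prof (home k) (places k (loEnd k) (hiOff k) ms) := by
  obtain ⟨i1, i2, _⟩ := places_injective hk h
  exact ⟨_, (transport_block hW (home_injective hk) (vert_routes hk h)).append
    ((exchange_block hW i1 (side_swaps hk h) (sideSteps_nodup hk h)).append
      (transport_block hW i2 (hor_routes hk h)))⟩

theorem scatter_block (hk : 2 ≤ k) {C : Circuit (Fin k → ℤ) G} {W : Words}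
    (hW : W.Ok C.wired1 C.wired2) (h : MovesOk N R ms) : ∃ prof,
    Block C (scatter k W ms) prof (places k (loEnd k) (hiOff k) ms) (home k) := by
  obtain ⟨i1, i2, i3⟩ := places_injective hk h
  exact ⟨_, (transport_block hW i3 ((hor_routes hk h).rev i2)).append
    ((exchange_block hW i2 ((side_swaps hk h).rev i1)
      ((pairQubits_revSteps _).nodup_iff.2 (sideSteps_nodup hk h))).append
      (transport_block hW i1 ((vert_routes hk h).rev (home_injective hk))))⟩

/-- The cube with a corner at the origin. -/
def cube (k s : ℕ) : Set (Fin k → ℤ) := {z | ∀ i, 0 ≤ z i ∧ z i < s}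

theorem gridPt_mem_cube {s a b : ℕ} (ha : a < s) (hb : b < s) : gridPt k a b ∈ cube k s := by
  intro i
  unfold gridPt
  have : 0 < s := by omega
  split_ifs <;> constructor <;> first | positivity | exact_mod_cast ha | exact_mod_cast hb

theorem sum_map_le {T : Type} (L : List T) (f : T → ℕ) (b : ℕ) (h : ∀ t ∈ L, f t ≤ b) :
    (L.map f).sum ≤ L.length * b := by
  have := List.sum_le_card_nsmul (L.map f) b fun x hx => by
    obtain ⟨t, ht, rfl⟩ := List.mem_map.1 hx
    exact h t ht
  simpa using this

theorem length_movers (ms : List (ℕ × ℕ × ℕ)) : (movers ms).length = 2 * ms.length := by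
  induction ms with
  | nil => rfl
  | cons m ms ih =>
    have : movers (m :: ms) = (m.1, m.2.2) :: (m.2.1, m.2.2) :: movers ms := rfl
    rw [this]; simp only [List.length_cons, ih]; ring

/-- Columns stay below `N` and rows below `2 * R + 2`, which fits into the cube. The vertical stage
has two paths of at most `R` hops per move and the horizontal one a path of at most `N` hops, each
hop counted twice; the summand `1` is for the exchanges. -/
theorem gather_opsOk (hk : 2 ≤ k) {C : Circuit (Fin k → ℤ) G} {W : Words}
    (hW : W.Ok C.wired1 C.wired2) (h : MovesOk N R ms) :
    ∀ f ∈ gather k W ms ++ scatter k W ms, ∀ p,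
      OpsOk C (CCNTC k) (cube k (N + 2 * R + 2)) ((4 * R + 2 * N + 1) * ms.length) (f p) := by
  obtain ⟨i1, i2, _⟩ := places_injective hk h
  have hmov : ∀ c ∈ movers ms, c.1 < N ∧ c.2 ≤ R := by
    intro c hc
    obtain ⟨m, hm, hc⟩ := List.mem_flatMap.1 hc
    have h1 := h.lt m hm
    have h2 := h.row m hm
    simp only [List.mem_cons, List.not_mem_nil, or_false] at hc
    rcases hc with rfl | rfl <;> exact ⟨by dsimp only; omega, h2.2⟩
  have hV := transport_rev_opsOk hW (home_injective hk) (vert_routes hk h) (A := CCNTC k)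
    (S := cube k (N + 2 * R + 2)) (b := (4 * R + 2 * N + 1) * ms.length) (fun t ht e he => by
      obtain ⟨c, hc, rfl⟩ := List.mem_map.1 ht
      obtain ⟨y, hy, rfl⟩ := mem_linePath he
      obtain ⟨h1, h2⟩ := hmov c hc
      exact ⟨⟨gridPt_adj_up hk _ _, gridPt_adj_up hk _ _⟩, gridPt_mem_cube (by omega) (by omega),
        gridPt_mem_cube (by omega) (by omega), gridPt_mem_cube (by omega) (by omega)⟩) (by
      have h1 := sum_map_le (vertPaths k ms) (fun t => t.2.length) R fun t ht => by
        obtain ⟨c, hc, rfl⟩ := List.mem_map.1 ht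
        rw [length_linePath]; exact (hmov c hc).2
      rw [vertPaths, List.length_map, length_movers] at h1
      refine (Nat.mul_le_mul_left 2 h1).trans ?_
      calc 2 * (2 * ms.length * R) = 4 * R * ms.length := by ring
        _ ≤ _ := Nat.mul_le_mul_right _ (by omega))
  have hH := transport_rev_opsOk hW i2 (hor_routes hk h) (A := CCNTC k)
    (S := cube k (N + 2 * R + 2)) (b := (4 * R + 2 * N + 1) * ms.length) (fun t ht e he => by
      obtain ⟨m, hm, rfl⟩ := List.mem_map.1 ht
      obtain ⟨y, hy, rfl⟩ := mem_linePath (f := fun x => gridPt k (m.1 + x) (2 * m.2.2))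
        (m := (m.2.1 - m.1) / 2) he
      have h1 := h.lt m hm
      have h2 := h.row m hm
      exact ⟨⟨gridPt_adj_right hk _ _, gridPt_adj_right hk _ _⟩, gridPt_mem_cube (by omega) (by omega),
        gridPt_mem_cube (by omega) (by omega), gridPt_mem_cube (by omega) (by omega)⟩) (by
      have h1 := sum_map_le (horPaths k ms) (fun t => t.2.length) N fun t ht => by
        obtain ⟨m, hm, rfl⟩ := List.mem_map.1 ht
        rw [length_linePath]
        have := h.lt m hm
        omega
      rw [horPaths, List.length_map] at h1
      refine (Nat.mul_le_mul_left 2 h1).trans ?_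
      calc 2 * (ms.length * N) = 2 * N * ms.length := by ring
        _ ≤ _ := Nat.mul_le_mul_right _ (by omega))
  have hS := exchange_opsOk hW (sideSteps_nodup hk h) (A := CCNTC k)
    (S := cube k (N + 2 * R + 2)) (b := (4 * R + 2 * N + 1) * ms.length) (fun t ht => by
      obtain ⟨m, hm, rfl⟩ := List.mem_map.1 ht
      have hm := (List.mem_filter.1 hm).1
      have h1 := h.lt m hm
      have h2 := h.row m hm
      exact ⟨gridPt_adj_up hk _ _, gridPt_mem_cube (by omega) (by omega),
        gridPt_mem_cube (by omega) (by omega)⟩) (by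
      rw [sideSteps, List.length_map]
      refine (List.length_filter_le _ _).trans ?_
      exact Nat.le_mul_of_pos_left _ (by omega))
  intro f hf p
  simp only [gather, scatter, List.mem_append] at hf
  rcases hf with (hf | hf | hf) | hf | hf | hf
  · exact hV.1 f hf p
  · exact hS.1 f hf p
  · exact hH.1 f hf p
  · exact hH.2 f hf p
  · exact hS.2 f hf p
  · exact hV.2 f hf p

theorem MovesOk.mono {R' : ℕ} (h : MovesOk N R ms) (hR : R ≤ R') : MovesOk N R' ms :=
  ⟨h.nodup, h.lt, fun m hm => ⟨(h.row m hm).1, (h.row m hm).2.trans hR⟩, h.rows⟩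

theorem mem_qubits_region (h : MovesOk N R ms) {i : ℕ} (hi : i < N) :
    places k (loEnd k) (hiOff k) ms i ∈ cube k (N + 2 * R + 2) := by
  by_cases hi' : i ∈ (movers ms).map Prod.fst
  · obtain ⟨m, hm, rfl | rfl⟩ := mem_movers.1 hi'
    all_goals
      have h1 := h.lt m hm
      have h2 := h.row m hm
    · rw [places_lo h _ _ hm]
      exact gridPt_mem_cube (by omega) (by omega)
    · rw [places_hi h _ _ hm]
      unfold hiOff
      split <;> exact gridPt_mem_cube (by omega) (by omega)
  · rw [places_other _ _ hi']
    exact gridPt_mem_cube (by omega) (by omega)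

/-- A round is gathering, the timestep itself, and scattering. The register starts and ends each
round at home, so the placement between rounds does not depend on the history, and the two motions
contribute scalars whose squared norms are given by their numbers of outcome bits. -/
theorem grid_rounds (hk : 2 ≤ k) {C : Circuit ℕ G} {C' : Circuit (Fin k → ℤ) G} {W : Words}
    (hW : W.Ok C'.wired1 C'.wired2) (hext : Extends C C') {n : ℕ} {xs rs : List Bool} {N P : ℕ}
    (hnext : ∀ h', C'.next xs rs h' =
      (C.next xs rs (dec (gatherLen W) (gatherLen W + 1 + gatherLen W) h').1).map fun l =>
        (phases k W l).getD (dec (gatherLen W) (gatherLen W + 1 + gatherLen W) h').2.length (fun _ => [])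
          (dec (gatherLen W) (gatherLen W + 1 + gatherLen W) h').2)
    (hok : ∀ h l, C.Possible CCAC n xs rs h → C.next xs rs h = some l →
      (l.flatMap Op.qubits).Nodup ∧ (∀ o ∈ l, C.Allowed CCAC o) ∧ (∀ q ∈ l.flatMap Op.qubits, q < N) ∧
        l.length ≤ P) :
    Rounds C CCAC C' (CCNTC k) (gatherLen W) (gatherLen W) n xs rs (fun _ l => phases k W l)
      (fun _ => home k) (4 * P + 2 * N + 1) (cube k (N + 2 * P + 2)) := by
  refine ⟨hnext, fun h l => ?_, fun _ => home_injective hk, fun h i => ?_, ?_, ?_⟩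
  · simp [phases, length_gather, length_scatter]; omega
  · funext j
    simp [home, gridPt, CCNTC, CCAC]
  · intro h l hp hl
    obtain ⟨hn, ha, hN, hP⟩ := hok h l hp hl
    have hm := moves_ok hn hN
    obtain ⟨L₁, hB1⟩ := gather_block hk hW hm
    obtain ⟨L₂, hB2⟩ := scatter_block hk hW hm
    have hl1 : L₁.length = gatherLen W := by rw [← hB1.1, length_gather]
    have hl2 : L₂.length = gatherLen W := by rw [← hB2.1, length_scatter]
    refine ⟨L₁, L₂, hl1, hl2, fun os₁ o os₂ e1 e2 => ?_⟩
    have hrun : ∀ ψ, run C' (phases k W l) [] (os₁ ++ o :: os₂) ψ =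
        run C' (scatter k W (moves l)) (o :: (os₁.reverse ++ [])) os₂
          (C'.applyOps (l.map (Op.map (places k (loEnd k) (hiOff k) (moves l)))) o
            (run C' (gather k W (moves l)) [] os₁ ψ)) := by
      intro ψ
      rw [phases, run_append C' _ _ _ _ _ _ (by rw [e1, length_gather])]
      rfl
    have hG := fun ψ => applyOps_map_place hext (places_injective hk hm).2.2 l ha o ψ
    have hb1 := hB1.2 [] os₁ (by rw [e1, length_gather])
    have hb2 := hB2.2 (o :: (os₁.reverse ++ [])) os₂ (by rw [e2, length_scatter])
    constructor
    · rintro ⟨e3, e4⟩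
      obtain ⟨s, hs, h1⟩ := hb1.1 e3
      obtain ⟨s', hs', h2⟩ := hb2.1 e4
      refine ⟨s * s', by rw [norm_mul, mul_pow, hs, hs', pow_add], fun d => ?_⟩
      rw [hrun, h1, applyOps_smul, run_smul, hG, h2, smul_smul, amp_cons_some hl]
    · intro hne d
      rw [hrun]
      by_cases e3 : os₁.map List.length = L₁
      · obtain ⟨s, hs, h1⟩ := hb1.1 e3
        rw [h1, applyOps_smul, run_smul, hG, hb2.2 fun e4 => hne ⟨e3, e4⟩, smul_zero]
      · rw [hb1.2 e3, applyOps_zero, run_zero]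
  · intro h l hp hl f hf p
    obtain ⟨hn, ha, hN, hP⟩ := hok h l hp hl
    -- The region has to be the same for all timesteps, so the number of rows is bounded by `P`
    -- instead of the number of operations.
    have hm := (moves_ok hn hN).mono hP
    rw [phases, List.mem_append, List.mem_cons] at hf
    have hgs : f ∈ gather k W (moves l) ++ scatter k W (moves l) →
        OpsOk C' (CCNTC k) (cube k (N + 2 * P + 2)) ((4 * P + 2 * N + 1) * l.length) (f p) := fun hf =>
      (gather_opsOk hk hW hm f hf p).mono (Nat.mul_le_mul_left _ (length_moves l))
    rcases hf with hf | rfl | hf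
    · exact hgs (List.mem_append_left _ hf)
    · have hq := flatMap_qubits_map (places k (loEnd k) (hiOff k) (moves l)) l
      refine ⟨?_, fun o ho => ?_, fun o ho q hqo => ?_, ?_⟩
      · rw [hq]; exact hn.map (places_injective hk hm).2.2
      · obtain ⟨o, hmo, rfl⟩ := List.mem_map.1 ho
        have hx := ha o hmo
        cases o with
        | meas q => trivial
        | gate1 g q =>
          obtain ⟨U, hU⟩ := Option.isSome_iff_exists.1 hx
          exact Option.isSome_iff_exists.2 ⟨U, hext.gate1 hU⟩
        | gate2 g p q =>
          obtain ⟨U, hU⟩ := Option.isSome_iff_exists.1 hx.1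
          refine ⟨Option.isSome_iff_exists.2 ⟨U, hext.gate2 hU⟩, ?_⟩
          obtain ⟨m, hmm, ⟨rfl, rfl⟩ | ⟨rfl, rfl⟩⟩ := mem_moves_gate2 hmo
          · exact (places_adj hk hm hmm).1
          · exact (places_adj hk hm hmm).2
      · have hmem : q ∈ (l.flatMap Op.qubits).map (places k (loEnd k) (hiOff k) (moves l)) := by
          rw [← hq]; exact List.mem_flatMap.2 ⟨o, ho, hqo⟩
        obtain ⟨i, hi, rfl⟩ := List.mem_map.1 hmem
        exact mem_qubits_region hm (hN i hi)
      · rw [List.length_map]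
        exact Nat.le_mul_of_pos_left _ (by omega)
    · exact hgs (List.mem_append_right _ hf)

/-! ### The unitaries used to move qubits are available -/

theorem bellM_unitary : bellM ∈ Matrix.unitaryGroup (Bool × Bool) ℂ := by
  rw [Matrix.mem_unitaryGroup_iff']
  have h := sqrt_two_inv_sq
  ext ⟨i, i'⟩ ⟨j, j'⟩
  simp only [Matrix.star_eq_conjTranspose, Matrix.mul_apply, Fintype.sum_prod_type, Fintype.sum_bool,
    Matrix.conjTranspose_apply, bellM, Matrix.of_apply, Matrix.one_apply]
  cases i <;> cases i' <;> cases j <;> cases j' <;> simp [sgn, h] <;> norm_num [h]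

theorem pauli_unitary (x z : Bool) :
    pauli x z ⊗ₖ (1 : Matrix Bool Bool ℂ) ∈ Matrix.unitaryGroup (Bool × Bool) ℂ := by
  rw [Matrix.mem_unitaryGroup_iff']
  ext ⟨i, i'⟩ ⟨j, j'⟩
  simp only [Matrix.star_eq_conjTranspose, Matrix.mul_apply, Fintype.sum_prod_type, Fintype.sum_bool,
    Matrix.conjTranspose_apply, pauli, Matrix.of_apply, Matrix.one_apply, Matrix.kroneckerMap_apply]
  cases x <;> cases z <;> cases i <;> cases i' <;> cases j <;> cases j' <;> simp [sgn]

theorem swapM_unitary : swapM ∈ Matrix.unitaryGroup (Bool × Bool) ℂ := by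
  rw [Matrix.mem_unitaryGroup_iff']
  ext ⟨i, i'⟩ ⟨j, j'⟩
  simp only [Matrix.star_eq_conjTranspose, Matrix.mul_apply, Fintype.sum_prod_type, Fintype.sum_bool,
    Matrix.conjTranspose_apply, swapM, Matrix.of_apply, Matrix.one_apply]
  cases i <;> cases i' <;> cases j <;> cases j' <;> simp

/-- The lists of wired-in gates are extended five times, and words found earlier survive the later
extensions. The words are chosen once for all `n`, so finitely many additional gates suffice. -/
theorem exists_words (hG : G.Universal) (w1 : List G.one) (w2 : List G.two) :
    ∃ w1' w2' W, w1 <+: w1' ∧ w2 <+: w2' ∧ Words.Ok W w1' w2' := by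
  obtain ⟨u1, v1, W1, a1, b1, h1⟩ := exists_isWord hG w1 w2 ⟨bellM, bellM_unitary⟩
  obtain ⟨u2, v2, W2, a2, b2, h2⟩ := exists_isWord hG u1 v1 (star ⟨bellM, bellM_unitary⟩)
  obtain ⟨u3, v3, W3, a3, b3, h3⟩ := exists_isWord hG u2 v2 ⟨xM, pauli_unitary true false⟩
  obtain ⟨u4, v4, W4, a4, b4, h4⟩ := exists_isWord hG u3 v3 ⟨zM, pauli_unitary false true⟩
  obtain ⟨u5, v5, W5, a5, b5, h5⟩ := exists_isWord hG u4 v4 ⟨swapM, swapM_unitary⟩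
  exact ⟨u5, v5, ⟨W1, W2, W3, W4, W5⟩, a1.trans (a2.trans (a3.trans (a4.trans a5))),
    b1.trans (b2.trans (b3.trans (b4.trans b5))),
    h1.mono (a2.trans (a3.trans (a4.trans a5))) (b2.trans (b3.trans (b4.trans b5))),
    h2.mono (a3.trans (a4.trans a5)) (b3.trans (b4.trans b5)),
    h3.mono (a4.trans a5) (b4.trans b5), h4.mono a5 b5, h5⟩

end
end QArch

namespace QArch
set_option linter.unusedSectionVars false
set_option linter.unusedSimpArgs false

/-! ## The simulation is computed in polynomial time -/

namespace PT

variable {α β γ Q : Type} {ea : α → Data} {eb : β → Data} {eg : γ → Data} {e : Q → Data}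

theorem zip {l : γ → List α} {m : γ → List β} (hl : PT eg (eL ea) l) (hm : PT eg (eL eb) m) :
    PT eg (eL (eP ea eb)) fun c => (l c).zip (m c) := by
  -- The accumulator holds the unread part of the second list together with the pairs formed so far.
  let F : List β × List (α × β) → α → List β × List (α × β) := fun s a =>
    match s.1 with
    | [] => s
    | b :: r => (r, s.2 ++ [(a, b)])
  have h : ∀ (l : List α) (m : List β) (acc : List (α × β)),
      l.foldl F (m, acc) = (m.drop l.length, acc ++ l.zip m) := fun l => by
    induction l with
    | nil => intro m acc; simp
    | cons a l ih =>
      intro m acc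
      cases m with
      | nil =>
        have := ih [] acc
        simp only [List.foldl_cons, F] at this ⊢
        rw [this]; simp
      | cons b m =>
        simp only [List.foldl_cons, F] at ih ⊢
        rw [ih]; simp
  have h' := foldl (ea := ea) (eb := eP (eL eb) (eL (eP ea eb))) (F := fun (_ : γ) => F) (l := l)
    (b := fun c => (m c, []))
    (fun c => 1 + (eL eb (m c)).size + (1 + (eL ea (l c)).size * (1 + (1 + (eL ea (l c)).size + (eL eb (m c)).size))))
    ?_ hl (hm.pair (const [])) (((PB.const 1).add hm.pb).add ((PB.const 1).add (hl.pb.mul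
      ((PB.const 1).add (((PB.const 1).add hl.pb).add hm.pb))))) ?_
  · exact h'.snd.congr fun c => by rw [h]; simp
  · refine (listCases (g := fun x b r => (r, x.2.1.2 ++ [(x.2.2, b)])) PT.id.snd.fst.fst PT.id.snd.fst
      ?_).congr fun x => ?_
    · exact PT.id.snd.snd.pair (PT.id.fst.snd.fst.snd.append
        ((PT.id.fst.snd.snd.pair PT.id.snd.fst).cons (const [])))
    · rcases x with ⟨_, ⟨_ | _, _⟩, _⟩ <;> rfl
  · intro c l₁ h₁
    rw [h, size_eP, List.nil_append]
    have e1 := size_eL_sublist (ea := eb) (List.drop_sublist l₁.length (m c))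
    have e2 := size_eL_le (ea := eP ea eb) (l₁.zip (m c)) (1 + (eL ea (l c)).size + (eL eb (m c)).size) ?_
    · have e3 : (l₁.zip (m c)).length ≤ (eL ea (l c)).size := by
        rw [List.length_zip]
        have := h₁.length_le
        have := length_lt_size_eL (ea := ea) (l c)
        omega
      have e4 := Nat.mul_le_mul_right (1 + (1 + (eL ea (l c)).size + (eL eb (m c)).size)) e3
      dsimp only
      omega
    · rintro ⟨a, b⟩ hab
      have h1 := (List.of_mem_zip hab).1
      have h2 := (List.of_mem_zip hab).2
      have h3 := size_lt_of_mem (ea := ea) (h₁.subset h1)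
      have h4 := size_lt_of_mem (ea := eb) h2
      rw [size_eP]
      dsimp only
      omega

theorem lookupD [DecidableEq α] (hi : Function.Injective ea) {l : γ → List (α × β)} {a : γ → α}
    {d : γ → β} (hl : PT eg (eL (eP ea eb)) l) (ha : PT eg ea a) (hd : PT eg eb d) :
    PT eg eb fun c => lookupD (l c) (a c) (d c) := by
  have h : ∀ (l : List (α × β)) (a : α) (d : β),
      l.foldr (fun p acc => if decide (p.1 = a) then p.2 else acc) d = QArch.lookupD l a d := by
    intro l a d
    simp only [QArch.lookupD, decide_eq_true_eq]
  have hmem : ∀ (l : List (α × β)) (a : α) (d : β),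
      (eb (QArch.lookupD l a d)).size ≤ (eL (eP ea eb) l).size + (eb d).size := by
    intro l a d
    induction l with
    | nil => simp [QArch.lookupD]
    | cons p l ih =>
      simp only [QArch.lookupD, List.foldr_cons, size_eL_cons, size_eP] at ih ⊢
      split <;> omega
  refine (foldr (F := fun c p acc => if decide (p.1 = a c) then p.2 else acc)
    (fun c => (eL (eP ea eb) (l c)).size + (eb (d c)).size)
    (PT.ite (beq hi PT.id.snd.fst.fst (comp ha PT.id.fst)) PT.id.snd.fst.snd PT.id.snd.snd) hl hd
    (hl.pb.add hd.pb) fun c l₁ h₁ => ?_).congr fun c => (h _ _ _).symm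
  rw [h]
  refine (hmem _ _ _).trans ?_
  have := size_eL_sublist (ea := eP ea eb) h₁.sublist
  omega

theorem drop (n : ℕ) {l : γ → List α} (hl : PT eg (eL ea) l) : PT eg (eL ea) fun c => (l c).drop n := by
  induction n with
  | zero => exact hl.congr fun _ => by simp
  | succ n ih => exact ih.tail.congr fun c => by rw [List.tail_drop]

theorem getD (n : ℕ) (d : α) {l : γ → List α} (hl : PT eg (eL ea) l) :
    PT eg ea fun c => (l c).getD n d :=
  (headD (hl.drop n) (const d)).congr fun c => by
    rw [List.headD_eq_head?_getD, List.head?_drop, List.getD_eq_getElem?_getD]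

end PT

/-! ### Families of timesteps computed in polynomial time. -/

section

variable {γ Q : Type} {eg : γ → Data} {e : Q → Data}

/-- Encoding of outcome histories. -/
abbrev eH : List (List Bool) → Data := eL (eL Data.ofBool)

/-- The timesteps are computed in polynomial time. -/
def PhasesPT (eg : γ → Data) (e : Q → Data) (m : ℕ)
    (fs : γ → List (List (List Bool) → List (Op Q))) : Prop :=
  (∀ c, (fs c).length = m) ∧
    ∀ i < m, PT (eP eg eH) (eL (eOp e)) fun x => (fs x.1).getD i (fun _ => []) x.2

theorem PhasesPT.append {m m' : ℕ} {fs fs' : γ → List (List (List Bool) → List (Op Q))}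
    (h : PhasesPT eg e m fs) (h' : PhasesPT eg e m' fs') :
    PhasesPT eg e (m + m') fun c => fs c ++ fs' c := by
  refine ⟨fun c => by rw [List.length_append, h.1, h'.1], fun i hi => ?_⟩
  by_cases hm : i < m
  · refine (h.2 i hm).congr fun x => ?_
    rw [List.getD_append _ _ _ _ (by rw [h.1]; exact hm)]
  · refine (h'.2 (i - m) (by omega)).congr fun x => ?_
    rw [List.getD_append_right _ _ _ _ (by rw [h.1]; omega), h.1]

theorem PhasesPT.cons {m : ℕ} {f : γ → List (List Bool) → List (Op Q)}
    {fs : γ → List (List (List Bool) → List (Op Q))}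
    (hf : PT (eP eg eH) (eL (eOp e)) fun x => f x.1 x.2) (h : PhasesPT eg e m fs) :
    PhasesPT eg e (m + 1) fun c => f c :: fs c := by
  refine ⟨fun c => by rw [List.length_cons, h.1], fun i hi => ?_⟩
  cases i with
  | zero => exact hf
  | succ i => exact h.2 i (by omega)

/-- The number `m` of timesteps is a constant, so the program compares the position in the round
with the finitely many possible values; no uniformity in the position is needed. -/
theorem PhasesPT.select {m : ℕ} {fs : γ → List (List (List Bool) → List (Op Q))}
    (h : PhasesPT eg e m fs) :
    PT (eP eg eH) (eL (eOp e)) fun x => (fs x.1).getD x.2.length (fun _ => []) x.2 := by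
  have key : ∀ j ≤ m, PT (eP eg eH) (eL (eOp e)) fun x =>
      if x.2.length < j then (fs x.1).getD x.2.length (fun _ => []) x.2 else [] := by
    intro j
    induction j with
    | zero => intro _; exact (PT.const []).congr fun x => by simp
    | succ j ih =>
      intro hj
      refine (PT.ite (PT.beq eU_injective PT.id.snd.length (PT.const j)) (h.2 j (by omega))
        (ih (by omega))).congr fun x => ?_
      by_cases h1 : x.2.length = j
      · simp [h1]
      · have : x.2.length < j + 1 ↔ x.2.length < j := by omega
        simp only [this, h1, decide_false, Bool.false_eq_true, if_false]
  refine (key m le_rfl).congr fun x => ?_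
  split
  · rfl
  · rename_i hlt
    rw [List.getD_eq_default _ _ (by rw [h.1]; omega)]

theorem PT.pref (r : PRef) {f : γ → Q × Q} (hf : PT eg (eP e e) f) : PT eg (eOp e) fun c => r.op (f c) := by
  cases r with
  | fst i => exact PT.gate1 (PT.const _) hf.fst
  | snd i => exact PT.gate1 (PT.const _) hf.snd
  | fwd i => exact PT.gate2 (PT.const _) hf.fst hf.snd
  | bwd i => exact PT.gate2 (PT.const _) hf.snd hf.fst

theorem layer_phasesPT (wd : List PRef) : ∀ {E : γ → List (List Bool) → List (Q × Q)}
    (_ : PT (eP eg eH) (eL (eP e e)) fun x => E x.1 x.2),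
    PhasesPT eg e wd.length fun c => layer wd (E c) := by
  induction wd with
  | nil => intro E _; exact ⟨fun c => rfl, fun i hi => absurd hi (by simp)⟩
  | cons r wd ih =>
    intro E hE
    refine PhasesPT.cons (f := fun c p => (E c p).map r.op) (PT.map (g := fun _ => r.op)
      (PT.pref r PT.id.snd) hE) (ih (E := fun c p => E c p.tail) ?_)
    exact PT.comp (g := fun x : γ × List (List Bool) => E x.1 x.2) hE (PT.id.fst.pair PT.id.snd.tail)

/-- Encoding of hops. -/
abbrev eHop (e : Q → Data) : Q × Q × Q → Data := eP e (eP e e)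

/-- Encoding of path systems. -/
abbrev ePaths (e : Q → Data) : Paths Q → Data := eL (eP eU (eL (eHop e)))

theorem PT.prepEdges {L : γ → Paths Q} (hL : PT eg (ePaths e) L) :
    PT eg (eL (eP e e)) fun c => prepEdges (L c) :=
  PT.flatMap (g := fun _ (t : ℕ × List (Q × Q × Q)) => edges1 t.2)
    (PT.map (g := fun _ (h : Q × Q × Q) => (h.2.1, h.2.2)) (PT.id.snd.snd.fst.pair PT.id.snd.snd.snd)
      PT.id.snd.snd) hL

theorem PT.measEdges {L : γ → Paths Q} (hL : PT eg (ePaths e) L) :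
    PT eg (eL (eP e e)) fun c => measEdges (L c) :=
  PT.flatMap (g := fun _ (t : ℕ × List (Q × Q × Q)) => edges2 t.2)
    (PT.map (g := fun _ (h : Q × Q × Q) => (h.1, h.2.1)) (PT.id.snd.fst.pair PT.id.snd.snd.fst)
      PT.id.snd.snd) hL

theorem PT.pairQubits {E : γ → List (Q × Q)} (hE : PT eg (eL (eP e e)) E) :
    PT eg (eL e) fun c => pairQubits (E c) :=
  PT.flatMap (g := fun _ (t : Q × Q) => [t.1, t.2])
    (PT.id.snd.fst.cons (PT.id.snd.snd.cons (PT.const []))) hE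

variable [DecidableEq Q]

theorem PT.bits (he : Function.Injective e) {E : γ → List (Q × Q)} {o : γ → List Bool} {q : γ → Q}
    (hE : PT eg (eL (eP e e)) E) (ho : PT eg (eL Data.ofBool) o) (hq : PT eg e q) :
    PT eg Data.ofBool fun c => bits (E c) (o c) (q c) :=
  PT.lookupD he (hE.pairQubits.zip ho) hq (PT.const false)

theorem PT.lastEdge {P : γ → List (Q × Q × Q)} (hP : PT eg (eL (eHop e)) P) :
    PT eg (eL (eP e e)) fun c => lastEdge (P c) :=
  (PT.listCases (f := fun _ => []) (g := fun _ (h : Q × Q × Q) _ => [(h.2.2, h.2.1)]) hP.reverse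
    (PT.const []) ((PT.id.snd.fst.snd.snd.pair PT.id.snd.fst.snd.fst).cons (PT.const []))).congr fun c => by
    unfold QArch.lastEdge
    rw [← List.head?_reverse]
    cases (P c).reverse <;> rfl

theorem transport_phasesPT (he : Function.Injective e) (W : Words) {L : γ → Paths Q}
    (hL : PT eg (ePaths e) L) : PhasesPT eg e (transportLen W) fun c => transport W (L c) := by
  have hL' : PT (eP eg eH) (ePaths e) fun x => L x.1 := PT.comp hL PT.id.fst
  have hM : ∀ {δ : Type} {ed : δ → Data} {f : δ → γ × List (List Bool)}, PT ed (eP eg eH) f →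
      PT ed (eL (eP e e)) fun d => measEdges (L (f d).1) := fun hf =>
    PT.comp (g := fun x : γ × List (List Bool) => measEdges (L x.1)) hL'.measEdges hf
  have ho : ∀ n : ℕ, PT (eP eg eH) (eL Data.ofBool) fun x : γ × List (List Bool) =>
      (x.2.drop n).headD [] := fun n => PT.headD (PT.id.snd.drop n) (PT.const [])
  have ho0 : PT (eP eg eH) (eL Data.ofBool) fun x : γ × List (List Bool) => x.2.headD [] :=
    PT.headD PT.id.snd (PT.const [])
  -- the edge functions, for outcomes `o`
  have h1 : ∀ o : γ × List (List Bool) → List Bool, PT (eP eg eH) (eL Data.ofBool) o →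
      PT (eP eg eH) (eL (eP e e)) fun x => resetEdges (L x.1) (o x) := fun o ho =>
    PT.filter (g := fun (x : γ × List (List Bool)) (t : Q × Q) => bits (measEdges (L x.1)) (o x) t.1)
      (PT.bits he (hM PT.id.fst) (PT.comp ho PT.id.fst) PT.id.snd.fst) hL'.measEdges
  have h2 : ∀ o : γ × List (List Bool) → List Bool, PT (eP eg eH) (eL Data.ofBool) o →
      PT (eP eg eH) (eL (eP e e)) fun x => resetEdges' (L x.1) (o x) := fun o ho =>
    PT.flatMap (g := fun _ (t : Q × Q) => [(t.2, t.1)])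
      ((PT.id.snd.snd.pair PT.id.snd.fst).cons (PT.const []))
      (PT.filter (g := fun (x : γ × List (List Bool)) (t : Q × Q) => bits (measEdges (L x.1)) (o x) t.2)
        (PT.bits he (hM PT.id.fst) (PT.comp ho PT.id.fst) PT.id.snd.snd) hL'.measEdges)
  have h3 : ∀ o : γ × List (List Bool) → List Bool, PT (eP eg eH) (eL Data.ofBool) o →
      PT (eP eg eH) (eL (eP e e)) fun x => flipEdges (L x.1) (o x) := fun o ho =>
    PT.flatMap (g := fun _ (t : ℕ × List (Q × Q × Q)) => lastEdge t.2) (PT.lastEdge PT.id.snd.snd)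
      (PT.filter (g := fun (x : γ × List (List Bool)) (t : ℕ × List (Q × Q × Q)) =>
          xorOn (fun h => bits (measEdges (L x.1)) (o x) h.2.1) t.2)
        (PT.xorFold (g := fun (y : (γ × List (List Bool)) × ℕ × List (Q × Q × Q)) (h : Q × Q × Q) =>
            bits (measEdges (L y.1.1)) (o y.1) h.2.1)
          (PT.bits he (hM PT.id.fst.fst) (PT.comp ho PT.id.fst.fst) PT.id.snd.snd.fst)
          PT.id.snd.snd) hL')
  have h4 : ∀ o : γ × List (List Bool) → List Bool, PT (eP eg eH) (eL Data.ofBool) o →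
      PT (eP eg eH) (eL (eP e e)) fun x => phaseEdges (L x.1) (o x) := fun o ho =>
    PT.flatMap (g := fun _ (t : ℕ × List (Q × Q × Q)) => lastEdge t.2) (PT.lastEdge PT.id.snd.snd)
      (PT.filter (g := fun (x : γ × List (List Bool)) (t : ℕ × List (Q × Q × Q)) =>
          xorOn (fun h => bits (measEdges (L x.1)) (o x) h.1) t.2)
        (PT.xorFold (g := fun (y : (γ × List (List Bool)) × ℕ × List (Q × Q × Q)) (h : Q × Q × Q) =>
            bits (measEdges (L y.1.1)) (o y.1) h.1)
          (PT.bits he (hM PT.id.fst.fst) (PT.comp ho PT.id.fst.fst) PT.id.snd.fst)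
          PT.id.snd.snd) hL')
  refine (layer_phasesPT W.bell (E := fun c _ => prepEdges (L c)) hL'.prepEdges).append
    ((layer_phasesPT W.bell' (E := fun c _ => measEdges (L c)) hL'.measEdges).append
    (PhasesPT.cons (f := fun c _ => measOps (measEdges (L c)))
      (PT.map (g := fun _ q => Op.meas q) (PT.meas PT.id.snd) hL'.measEdges.pairQubits)
    ((layer_phasesPT W.flip (E := fun c p => resetEdges (L c) (p.headD [])) (h1 _ ho0)).append
    ((layer_phasesPT W.flip (E := fun c p => resetEdges' (L c) ((p.drop W.flip.length).headD []))
      (h2 _ (ho _))).append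
    ((layer_phasesPT W.flip (E := fun c p =>
        flipEdges (L c) ((p.drop (W.flip.length + W.flip.length)).headD [])) (h3 _ (ho _))).append
    (layer_phasesPT W.phase (E := fun c p =>
        phaseEdges (L c) ((p.drop (W.flip.length + W.flip.length + W.flip.length)).headD []))
      (h4 _ (ho _))))))))

theorem PT.revPaths {L : γ → Paths Q} (hL : PT eg (ePaths e) L) :
    PT eg (ePaths e) fun c => revPaths (L c) :=
  PT.map (g := fun _ (t : ℕ × List (Q × Q × Q)) => (t.1, revPath t.2))
    (PT.id.snd.fst.pair (PT.reverse (PT.map (g := fun _ (h : Q × Q × Q) => (h.2.2, h.2.1, h.1))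
      (PT.id.snd.snd.snd.pair (PT.id.snd.snd.fst.pair PT.id.snd.fst)) PT.id.snd.snd))) hL

theorem exchange_phasesPT (W : Words) {L : γ → List (ℕ × Q × Q)}
    (hL : PT eg (eL (eP eU (eP e e))) L) : PhasesPT eg e W.swap.length fun c => exchange W (L c) :=
  layer_phasesPT W.swap (E := fun c _ => (L c).map Prod.snd)
    (PT.map (g := fun _ (t : ℕ × Q × Q) => t.2) PT.id.snd.snd (PT.comp hL PT.id.fst))

theorem PT.revSteps {L : γ → List (ℕ × Q × Q)} (hL : PT eg (eL (eP eU (eP e e))) L) :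
    PT eg (eL (eP eU (eP e e))) fun c => revSteps (L c) :=
  PT.map (g := fun _ (t : ℕ × Q × Q) => (t.1, t.2.2, t.2.1))
    (PT.id.snd.fst.pair (PT.id.snd.snd.snd.pair PT.id.snd.snd.fst)) hL

end

end QArch

namespace QArch
set_option linter.unusedSectionVars false
set_option linter.unusedSimpArgs false

/-! ## The grid circuit -/

section

variable {γ : Type} {eg : γ → Data} {k : ℕ}

theorem PT.intCast {f : γ → ℕ} (hf : PT eg eU f) : PT eg Coded.enc fun c => (f c : ℤ) :=
  ((PT.const (eb := Data.ofBool) (ea := eg) false).pair (PT.unary_binary.comp hf)).recode fun _ => rfl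

/-- Since `k` is fixed, all coordinates after the first two form a constant list. -/
theorem PT.gridPt (hk : 2 ≤ k) {a b : γ → ℕ} (ha : PT eg eU a) (hb : PT eg eU b) :
    PT eg Coded.enc fun c => gridPt k (a c) (b c) := by
  obtain ⟨k, rfl⟩ : ∃ k', k = k' + 2 := ⟨k - 2, by omega⟩
  refine (ha.intCast.cons (hb.intCast.cons (PT.const (List.replicate k (0 : ℤ))))).recode fun c => ?_
  show Coded.enc (List.ofFn (QArch.gridPt (k + 2) (a c) (b c))) = _
  rw [enc_list, List.ofFn_succ, List.ofFn_succ]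
  have : (List.ofFn fun i : Fin k => QArch.gridPt (k + 2) (a c) (b c) i.succ.succ) = List.replicate k 0 := by
    rw [← List.ofFn_const]
    congr 1
  rw [this]
  rfl

/-- Encoding of moves. -/
abbrev eMove : ℕ × ℕ × ℕ → Data := eP eU (eP eU eU)

theorem size_qubit_le {Q : Type} {e : Q → Data} {o : Op Q} {q : Q} (h : q ∈ o.qubits) :
    (e q).size ≤ (eOp e o).size := by
  cases o <;> simp only [Op.qubits, List.mem_cons, List.not_mem_nil, or_false] at h
  · subst h; simp [eOp, Data.size]
  · subst h; simp only [eOp, eP, Data.size]; omega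
  · rcases h with rfl | rfl <;> simp only [eOp, eP, Data.size] <;> omega

/-- Supplies the bound on accumulators for the fold that computes the moves. Row numbers are written
in unary but do not exceed the number of operations. -/
theorem size_moves_le (l : List (Op ℕ)) : (eL eMove (moves l)).size ≤
    1 + (eL (eOp eU) l).size * (1 + (4 * (eL (eOp eU) l).size + 3)) := by
  have h1 := size_eL_le (ea := eMove) (moves l) (4 * (eL (eOp eU) l).size + 3) ?_
  · have h2 := (length_moves l).trans (length_lt_size_eL (ea := eOp eU) l).le
    have h3 := Nat.mul_le_mul_right (1 + (4 * (eL (eOp eU) l).size + 3)) h2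
    omega
  · intro m hm
    have hq : ∀ i ∈ (movers (moves l)).map Prod.fst, (eU i).size ≤ (eL (eOp eU) l).size := by
      intro i hi
      obtain ⟨o, ho, hi⟩ := List.mem_flatMap.1 (movers_subset l i hi)
      exact (size_qubit_le hi).trans (size_lt_of_mem ho).le
    have h1 := hq m.1 (mem_movers.2 ⟨m, hm, Or.inl rfl⟩)
    have h2 := hq m.2.1 (mem_movers.2 ⟨m, hm, Or.inr rfl⟩)
    have h3 := (moves_row l m hm).2.trans (length_moves l)
    have h4 := length_lt_size_eL (ea := eOp eU) l
    have h5 := size_eU m.2.2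
    simp only [eMove, size_eP]
    omega

theorem PT.moves {l : γ → List (Op ℕ)} (hl : PT eg (eL (eOp eU)) l) :
    PT eg (eL eMove) fun c => moves (l c) := by
  let F : Op ℕ → List (ℕ × ℕ × ℕ) → List (ℕ × ℕ × ℕ) := fun x acc =>
    match x with
    | Op.meas _ => acc
    | Op.gate1 _ _ => acc
    | Op.gate2 _ p q => (if decide (p < q) then (p, q, acc.length + 1) else (q, p, acc.length + 1)) :: acc
  have h : ∀ l : List (Op ℕ), l.foldr F [] = QArch.moves l := fun l => by
    induction l with
    | nil => rfl
    | cons x l ih =>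
      rw [List.foldr_cons, ih]
      cases x <;> simp only [F, QArch.moves, decide_eq_true_eq]
  refine (PT.foldr (ea := eOp eU) (F := fun (_ : γ) => F) (b := fun _ => [])
    (fun c => 1 + (eL (eOp eU) (l c)).size * (1 + (4 * (eL (eOp eU) (l c)).size + 3)))
    ?_ hl (PT.const []) ((PB.const 1).add (hl.pb.mul ((PB.const 1).add
      (((PB.const 4).mul hl.pb).add (PB.const 3))))) fun c l₁ h₁ => ?_).congr fun c => (h _).symm
  · refine (PT.opCases (f := fun (x : γ × Op ℕ × List (ℕ × ℕ × ℕ)) _ => x.2.2) (g := fun x _ _ => x.2.2)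
      (k := fun x _ p q => (if decide (p < q) then (p, q, x.2.2.length + 1) else (q, p, x.2.2.length + 1)) ::
        x.2.2) PT.id.snd.fst PT.id.fst.snd.snd PT.id.fst.snd.snd
        (PT.cons (PT.ite (PT.lt PT.id.snd.snd.fst PT.id.snd.snd.snd)
          (PT.id.snd.snd.fst.pair (PT.id.snd.snd.snd.pair PT.id.fst.snd.snd.length.succ))
          (PT.id.snd.snd.snd.pair (PT.id.snd.snd.fst.pair PT.id.fst.snd.snd.length.succ)))
          PT.id.fst.snd.snd) []).congr fun x => ?_
    simp only [F]
    cases x.2.1 <;> rfl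
  · rw [h]
    refine (size_moves_le l₁).trans ?_
    have := size_eL_sublist (ea := eOp eU) h₁.sublist
    gcongr

theorem PT.movers {ms : γ → List (ℕ × ℕ × ℕ)} (h : PT eg (eL eMove) ms) :
    PT eg (eL (eP eU eU)) fun c => movers (ms c) :=
  PT.flatMap (g := fun _ (m : ℕ × ℕ × ℕ) => [(m.1, m.2.2), (m.2.1, m.2.2)])
    ((PT.id.snd.fst.pair PT.id.snd.snd.snd).cons
      ((PT.id.snd.snd.fst.pair PT.id.snd.snd.snd).cons (PT.const []))) h

theorem PT.double {f : γ → ℕ} (hf : PT eg eU f) : PT eg eU fun c => 2 * f c :=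
  (hf.add hf).congr fun _ => two_mul _

theorem PT.linePath {Q : Type} {e : Q → Data} {f : γ → ℕ → Q} {m : γ → ℕ}
    (hf : PT (eP eg eU) e fun x => f x.1 x.2) (hm : PT eg eU m) :
    PT eg (eL (eHop e)) fun c => linePath (f c) (m c) := by
  have hf' : ∀ {g : γ × ℕ → ℕ}, PT (eP eg eU) eU g → PT (eP eg eU) e fun x => f x.1 (g x) := fun hg =>
    PT.comp (g := fun x : γ × ℕ => f x.1 x.2) hf (PT.id.fst.pair hg)
  exact PT.map (g := fun c j => (f c (2 * j), f c (2 * j + 1), f c (2 * j + 2)))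
    ((hf' PT.id.snd.double).pair ((hf' PT.id.snd.double.succ).pair (hf' PT.id.snd.double.succ.succ)))
    hm.range

theorem PT.vertPaths (hk : 2 ≤ k) {ms : γ → List (ℕ × ℕ × ℕ)} (h : PT eg (eL eMove) ms) :
    PT eg (ePaths Coded.enc) fun c => vertPaths k (ms c) :=
  PT.map (g := fun _ (t : ℕ × ℕ) => (t.1, QArch.linePath (fun y => QArch.gridPt k t.1 y) t.2))
    (PT.id.snd.fst.pair (PT.linePath (f := fun (x : γ × ℕ × ℕ) y => QArch.gridPt k x.2.1 y)
      (PT.gridPt hk PT.id.fst.snd.fst PT.id.snd) PT.id.snd.snd)) h.movers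

theorem PT.horPaths (hk : 2 ≤ k) {ms : γ → List (ℕ × ℕ × ℕ)} (h : PT eg (eL eMove) ms) :
    PT eg (ePaths Coded.enc) fun c => horPaths k (ms c) :=
  PT.map (g := fun _ (m : ℕ × ℕ × ℕ) => (m.1, QArch.linePath (fun x => QArch.gridPt k (m.1 + x) (2 * m.2.2))
      ((m.2.1 - m.1) / 2)))
    (PT.id.snd.fst.pair (PT.linePath (f := fun (x : γ × ℕ × ℕ × ℕ) y =>
        QArch.gridPt k (x.2.1 + y) (2 * x.2.2.2))
      (PT.gridPt hk (PT.id.fst.snd.fst.add PT.id.snd) PT.id.fst.snd.snd.snd.double)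
      (PT.id.snd.snd.fst.sub PT.id.snd.fst).half)) h

theorem PT.sideSteps (hk : 2 ≤ k) {ms : γ → List (ℕ × ℕ × ℕ)} (h : PT eg (eL eMove) ms) :
    PT eg (eL (eP eU (eP Coded.enc Coded.enc))) fun c => sideSteps k (ms c) :=
  PT.map (g := fun _ (m : ℕ × ℕ × ℕ) =>
      (m.2.1, QArch.gridPt k m.2.1 (2 * m.2.2), QArch.gridPt k m.2.1 (2 * m.2.2 + 1)))
    (PT.id.snd.snd.fst.pair ((PT.gridPt hk PT.id.snd.snd.fst PT.id.snd.snd.snd.double).pair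
      (PT.gridPt hk PT.id.snd.snd.fst PT.id.snd.snd.snd.double.succ)))
    (PT.filter (g := fun _ (m : ℕ × ℕ × ℕ) => decide ((m.2.1 - m.1) % 2 = 0))
      (PT.id.snd.snd.fst.sub PT.id.snd.fst).even h)

theorem PT.finalPlaces (hk : 2 ≤ k) {ms : γ → List (ℕ × ℕ × ℕ)} {i : γ → ℕ} (h : PT eg (eL eMove) ms)
    (hi : PT eg eU i) : PT eg Coded.enc fun c => places k (loEnd k) (hiOff k) (ms c) (i c) := by
  refine PT.lookupD (ea := eU) eU_injective (PT.flatMap (eb := eP eU Coded.enc)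
    (g := fun _ (m : ℕ × ℕ × ℕ) => [(m.1, loEnd k m), (m.2.1, hiOff k m)]) ?_ h) hi
    (PT.gridPt hk hi (PT.const 0))
  have hd : PT (eP eg eMove) eU fun x => x.2.2.1 - x.2.1 := PT.id.snd.snd.fst.sub PT.id.snd.fst
  exact (PT.id.snd.fst.pair (PT.gridPt hk (PT.id.snd.fst.add hd.half.double) PT.id.snd.snd.snd.double)).cons
    ((PT.id.snd.snd.fst.pair (PT.ite hd.even
      (PT.gridPt hk PT.id.snd.snd.fst PT.id.snd.snd.snd.double.succ)
      (PT.gridPt hk PT.id.snd.snd.fst PT.id.snd.snd.snd.double))).cons (PT.const []))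

theorem phases_phasesPT (hk : 2 ≤ k) (W : Words) {l : γ → List (Op ℕ)} (hl : PT eg (eL (eOp eU)) l) :
    PhasesPT eg (Coded.enc : (Fin k → ℤ) → Data) (gatherLen W + (gatherLen W + 1)) fun c => phases k W (l c) := by
  have hinj : Function.Injective (Coded.enc : (Fin k → ℤ) → Data) := Coded.enc_injective
  have hm := hl.moves
  refine PhasesPT.append (fs := fun c => gather k W (moves (l c)))
    ((transport_phasesPT hinj W (PT.vertPaths hk hm)).append
      ((exchange_phasesPT W (PT.sideSteps hk hm)).append (transport_phasesPT hinj W (PT.horPaths hk hm))))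
    (PhasesPT.cons (f := fun c _ => (l c).map (Op.map (places k (loEnd k) (hiOff k) (moves (l c))))) ?_
    ((transport_phasesPT hinj W (PT.horPaths hk hm).revPaths).append
      ((exchange_phasesPT W (PT.sideSteps hk hm).revSteps).append
        (transport_phasesPT hinj W (PT.vertPaths hk hm).revPaths))))
  refine PT.map (g := fun (x : γ × List (List Bool)) (o : Op ℕ) =>
      o.map (places k (loEnd k) (hiOff k) (QArch.moves (l x.1)))) (PT.opMap ?_ PT.id.snd) (PT.comp hl PT.id.fst)
  exact PT.finalPlaces (ms := fun x : ((γ × List (List Bool)) × Op ℕ) × ℕ => QArch.moves (l x.1.1.1)) hk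
    (PT.comp (g := fun c => QArch.moves (l c)) hm PT.id.fst.fst.fst) PT.id.snd

theorem PT.dec (b : ℕ) {K : ℕ} (hK : 0 < K) {h : γ → List (List Bool)} (hh : PT eg (eL (eL Data.ofBool)) h) :
    PT eg (eP (eL (eL Data.ofBool)) (eL (eL Data.ofBool))) fun c => dec b K (h c) := by
  let F : List Bool → List (List Bool) × List (List Bool) → List (List Bool) × List (List Bool) :=
    fun o s => if decide (s.2.length + 1 = K) then ((o :: s.2).getD b [] :: s.1, []) else (s.1, o :: s.2)
  have hF : ∀ h : List (List Bool), h.foldr F ([], []) = QArch.dec b K h := fun h => by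
    induction h with
    | nil => rfl
    | cons o h ih =>
      rw [List.foldr_cons, ih]
      simp only [F, QArch.dec, decide_eq_true_eq]
  -- Needed for the bound on the accumulator: decoding only selects entries of the history, or the
  -- default empty list.
  have hmem : ∀ h : List (List Bool), ∀ x ∈ (QArch.dec b K h).1, x ∈ h ∨ x = [] := fun h => by
    induction h with
    | nil => simp [QArch.dec]
    | cons o h ih =>
      intro x hx
      rw [QArch.dec] at hx
      split at hx
      · rcases List.mem_cons.1 hx with rfl | hx
        · have h1 : ∀ y ∈ o :: (QArch.dec b K h).2, y ∈ o :: h := by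
            intro y hy
            obtain ⟨_, h₀, e1, _⟩ := dec_spec (b := b) hK h
            rcases List.mem_cons.1 hy with rfl | hy
            · exact List.mem_cons_self
            · rw [e1]; exact List.mem_cons_of_mem _ (List.mem_append_left _ hy)
          by_cases hb : b < (o :: (QArch.dec b K h).2).length
          · rw [List.getD_eq_getElem _ _ hb]
            exact Or.inl (h1 _ (List.getElem_mem hb))
          · exact Or.inr (List.getD_eq_default _ _ (not_lt.1 hb))
        · exact (ih x hx).imp_left (List.mem_cons_of_mem _)
      · exact (ih x hx).imp_left (List.mem_cons_of_mem _)
  refine (PT.foldr (ea := eL Data.ofBool) (eb := eP (eL (eL Data.ofBool)) (eL (eL Data.ofBool))) (F := fun (_ : γ) => F) (b := fun _ => ([], []))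
    (fun c => 1 + (1 + (eL (eL Data.ofBool) (h c)).size * (1 + (1 + (eL (eL Data.ofBool) (h c)).size))) + (eL (eL Data.ofBool) (h c)).size)
    ?_ hh (PT.const ([], [])) (((PB.const 1).add ((PB.const 1).add (hh.pb.mul ((PB.const 1).add
      ((PB.const 1).add hh.pb))))).add hh.pb) fun c h₁ hs => ?_).congr fun c => (hF _).symm
  · exact PT.ite (PT.beq eU_injective PT.id.snd.snd.snd.length.succ (PT.const K))
      ((PT.cons (PT.getD b [] (PT.id.snd.fst.cons PT.id.snd.snd.snd)) PT.id.snd.snd.fst).pair (PT.const []))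
      (PT.id.snd.snd.fst.pair (PT.id.snd.fst.cons PT.id.snd.snd.snd))
  · rw [hF, size_eP]
    have hsz := size_eL_sublist (ea := eL Data.ofBool) hs.sublist
    have e1 := size_eL_le (ea := eL Data.ofBool) (QArch.dec b K h₁).1 (1 + (eL (eL Data.ofBool) (h c)).size) fun x hx => by
      rcases hmem h₁ x hx with hx | rfl
      · have := size_lt_of_mem (ea := eL Data.ofBool) hx
        omega
      · simp [eL, Data.size]
    have e2 : (QArch.dec b K h₁).1.length ≤ (eL (eL Data.ofBool) (h c)).size := by
      have h1 := length_dec (b := b) (K := K) h₁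
      have h2 := length_lt_size_eL (ea := eL Data.ofBool) h₁
      have h3 := Nat.le_mul_of_pos_left (QArch.dec b K h₁).1.length hK
      omega
    have e3 := Nat.mul_le_mul_right (1 + (1 + (eL (eL Data.ofBool) (h c)).size)) e2
    obtain ⟨_, h₀, e4, _⟩ := dec_spec (b := b) hK h₁
    have e5 : (QArch.dec b K h₁).2.Sublist h₁ := by
      conv_rhs => rw [e4]
      exact List.sublist_append_left _ _
    have e6 := size_eL_sublist (ea := eL Data.ofBool) e5
    omega

variable {G : GateSet}

/-- The circuit on the grid. -/
def onGrid (hk : 2 ≤ k) (C : Circuit ℕ G) (hC : PT Coded.enc (eO (eL (eOp eU)))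
      fun i : List Bool × List Bool × List (List Bool) => C.next i.1 i.2.1 i.2.2)
    (w1 : List G.one) (w2 : List G.two) (W : Words) : Circuit (Fin k → ℤ) G where
  seedLen := C.seedLen
  wired1 := w1
  wired2 := w2
  next xs rs h' := (C.next xs rs (dec (gatherLen W) (gatherLen W + 1 + gatherLen W) h').1).map fun l =>
    (phases k W l).getD (dec (gatherLen W) (gatherLen W + 1 + gatherLen W) h').2.length (fun _ => [])
      (dec (gatherLen W) (gatherLen W + 1 + gatherLen W) h').2
  polyTime := by
    have hE : (Coded.enc : List (List Bool) → Data) = eH := by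
      rw [enc_list, enc_list]; rfl
    have hh : PT Coded.enc eH fun i : List Bool × List Bool × List (List Bool) => i.2.2 := by
      have : PT (eP Coded.enc (eP Coded.enc Coded.enc)) Coded.enc
        fun i : List Bool × List Bool × List (List Bool) => i.2.2 := PT.id.snd.snd
      exact this.recode fun i => (congrFun hE _).symm
    have hd := PT.dec (gatherLen W) (K := gatherLen W + 1 + gatherLen W) (by omega) hh
    have h1 : PT Coded.enc (eO (eL (eOp eU))) fun i : List Bool × List Bool × List (List Bool) =>
        C.next i.1 i.2.1 (dec (gatherLen W) (gatherLen W + 1 + gatherLen W) i.2.2).1 := by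
      refine PT.comp (g := fun i : List Bool × List Bool × List (List Bool) => C.next i.1 i.2.1 i.2.2)
        hC (f := fun i : List Bool × List Bool × List (List Bool) => (i.1, i.2.1, (dec (gatherLen W) (gatherLen W + 1 + gatherLen W) i.2.2).1)) ?_
      have e1 : PT (eP Coded.enc (eP Coded.enc Coded.enc)) Coded.enc
        fun i : List Bool × List Bool × List (List Bool) => i.1 := PT.id.fst
      have e2 : PT (eP Coded.enc (eP Coded.enc Coded.enc)) Coded.enc
        fun i : List Bool × List Bool × List (List Bool) => i.2.1 := PT.id.snd.fst
      have e3 : PT Coded.enc Coded.enc fun i : List Bool × List Bool × List (List Bool) =>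
          (dec (gatherLen W) (gatherLen W + 1 + gatherLen W) i.2.2).1 := by
        exact hd.fst.recode fun i => congrFun hE _
      exact e1.pair (e2.pair e3)
    have h2 := (phases_phasesPT (eg := eP (Coded.enc : List Bool × List Bool × List (List Bool) → Data)
      (eL (eOp eU))) (l := Prod.snd) hk W PT.id.snd).select
    have h3 : PT Coded.enc (eO (eL (eOp Coded.enc))) fun i : List Bool × List Bool × List (List Bool) =>
        (C.next i.1 i.2.1 (dec (gatherLen W) (gatherLen W + 1 + gatherLen W) i.2.2).1).map fun l =>
          (phases k W l).getD (dec (gatherLen W) (gatherLen W + 1 + gatherLen W) i.2.2).2.length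
            (fun _ => []) (dec (gatherLen W) (gatherLen W + 1 + gatherLen W) i.2.2).2 := by
      refine (PT.optionCases (f := fun _ => none) (g := fun i l => some ((phases k W l).getD
        (dec (gatherLen W) (gatherLen W + 1 + gatherLen W) i.2.2).2.length (fun _ => [])
          (dec (gatherLen W) (gatherLen W + 1 + gatherLen W) i.2.2).2)) h1 (PT.const none)
          (PT.some ?_)).congr fun i => ?_
      · exact PT.comp (g := fun x : ((List Bool × List Bool × List (List Bool)) × List (Op ℕ)) ×
            List (List Bool) => (phases k W x.1.2).getD x.2.length (fun _ => []) x.2) h2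
          (f := fun x => (x, (dec (gatherLen W) (gatherLen W + 1 + gatherLen W) x.1.2.2).2))
          (PT.id.pair (PT.comp (g := fun i : List Bool × List Bool × List (List Bool) =>
            (dec (gatherLen W) (gatherLen W + 1 + gatherLen W) i.2.2).2) hd.snd PT.id.fst))
      · cases C.next i.1 i.2.1 (dec (gatherLen W) (gatherLen W + 1 + gatherLen W) i.2.2).1 <;> rfl
    rw [← enc_op, ← enc_list, ← enc_option] at h3
    exact h3

end
end QArch

namespace QArch
set_option linter.unusedSectionVars false
set_option linter.unusedSimpArgs false

/-! ## Comparison of the two architectures -/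

section

variable {G : GateSet}
  {E : (n : ℕ) → Matrix (Fin n → Bool) (Fin n → Bool) ℂ →ₗ[ℂ] Matrix (Fin n → Bool) (Fin n → Bool) ℂ}
  {ε : ℕ → ℝ}

/-- `Achieves` requires the exact depth, while a simulation yields only an upper bound; a bounded
depth is a natural number and can be taken as the new function. -/
theorem achieves_of_le {Q : Type} [DecidableEq Q] [Coded Q] {A : Architecture Q} (C : Circuit Q G)
    (hleg : C.Legal A) (T : ℕ → ℕ) (hT : ∀ n, C.depth A n ≤ T n) (P P' : Polynomial ℕ)
    (hP : ∀ n, C.size A n ≤ (P.eval n : ℕ)) (hP' : ∀ n, C.width A n ≤ (P'.eval n : ℕ))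
    (hC : ∀ n x, DiamondClose (E n) (C.channel A n x) (ε n)) :
    ∃ d : ℕ → ℕ, (∀ n, d n ≤ T n) ∧ Achieves A G E ε d := by
  have h : ∀ n, ∃ m : ℕ, m ≤ T n ∧ C.depth A n = m := fun n => by
    obtain ⟨m, hm⟩ := ENat.ne_top_iff_exists.1 (ne_top_of_le_ne_top (ENat.natCast_ne_top _) (hT n))
    exact ⟨m, by have := hT n; rw [← hm] at this; exact_mod_cast this, hm.symm⟩
  choose d h1 h2 using h
  refine ⟨d, h1, C, hleg, h2, ⟨P + P', fun n => ⟨(hP n).trans ?_, (hP' n).trans ?_⟩⟩, hC⟩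
  · rw [Polynomial.eval_add]; exact_mod_cast Nat.le_add_right _ _
  · rw [Polynomial.eval_add]; exact_mod_cast Nat.le_add_left _ _

theorem width_CCAC_le {C : Circuit ℕ G} {n m : ℕ} (h : ∀ x, C.acted CCAC n x ⊆ {q | q < m}) :
    C.width CCAC n ≤ m := by
  refine iSup_le fun x => ?_
  refine (Set.encard_le_encard (h x)).trans ?_
  have : {q : ℕ | q < m} = (Finset.range m : Set ℕ) := by ext; simp
  rw [this, Set.encard_coe_eq_coe_finsetCard, Finset.card_range]

theorem width_CCNTC_le {k : ℕ} {C : Circuit (Fin k → ℤ) G} {n m : ℕ}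
    (h : ∀ x, C.acted (CCNTC k) n x ⊆ cube k m) : C.width (CCNTC k) n ≤ (m ^ k : ℕ) := by
  refine iSup_le fun x => ?_
  exact iInf₂_le m ⟨fun _ => 0, fun z hz i => by simpa using h x hz i⟩

/-- Circuits on the grid are simulated in the same time with arbitrary interactions. -/
theorem achieves_CCAC {k : ℕ} (hk : 2 ≤ k) {d : ℕ → ℕ} (h : Achieves (CCNTC k) G E ε d) :
    ∃ d' : ℕ → ℕ, (∀ n, d' n ≤ d n) ∧ Achieves CCAC G E ε d' := by
  obtain ⟨C, hleg, hd, ⟨P, hP⟩, hC⟩ := h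
  have hD : PT Coded.enc Coded.enc fun xs : List Bool => (List.range xs.length).map fun i => gridPt k i 0 := by
    have : PT (eL Coded.enc) (eL Coded.enc) fun xs : List Bool =>
        (List.range xs.length).map fun i => gridPt k i 0 :=
      PT.map (g := fun _ i => gridPt k i 0) (PT.gridPt hk PT.id.snd (PT.const 0)) PT.id.length.range
    rwa [← enc_list, ← enc_list] at this
  have hdata : ∀ n i, (CCNTC k).data n i = gridPt k i 0 := fun n i => by
    funext j
    simp [gridPt, CCNTC]
  -- Relabelling by natural numbers makes the grid circuit a CCAC circuit, because two distinct
  -- qubits may always interact there.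
  obtain ⟨C₁, -, h1, h2, h3, h4, h5⟩ := exists_relabel C (CCNTC k) _ hD
    (fun n i j hij => by
      rw [hdata, hdata] at hij
      exact Fin.ext ((gridPt_inj hk).1 hij).1)
    (fun xs => by
      refine List.ext_getElem (by simp) fun i _ _ => ?_
      simp [hdata]) hleg d (fun n => P.eval n) (fun n => (hd n).le) fun n => (hP n).1
  exact achieves_of_le C₁ h1 d h2 P (Polynomial.X + 2 * P) h3
    (fun n => by
      refine (width_CCAC_le (h4 n)).trans (le_of_eq ?_)
      simp) fun n x => by rw [h5]; exact hC n x

/-- Circuits with arbitrary interactions are simulated on the grid, with a constant slowdown. -/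
theorem achieves_CCNTC (hG : G.Universal) {k : ℕ} (hk : 2 ≤ k) {d : ℕ → ℕ} (h : Achieves CCAC G E ε d) :
    ∃ (K : ℕ) (d' : ℕ → ℕ), (∀ n, d' n ≤ K * d n) ∧ Achieves (CCNTC k) G E ε d' := by
  obtain ⟨C, hleg, hd, ⟨P, hP⟩, hC⟩ := h
  have hD : PT Coded.enc Coded.enc fun xs : List Bool => List.range xs.length := by
    have h1 : PT (eL Coded.enc) eU fun xs : List Bool => xs.length := PT.id.length
    have h2 : PT (eL Coded.enc) (eL Coded.enc) fun xs : List Bool =>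
        (List.range xs.length).map fun i => i :=
      PT.map (g := fun _ i => i) (PT.unary_binary.comp PT.id.snd) h1.range
    rw [← enc_list, ← enc_list] at h2
    exact h2.congr fun xs => (List.map_id' _).symm
  -- Relabelling is needed even though the qubits are natural numbers already: polynomial width does
  -- not keep their indices small, and the indices become columns of the grid.
  obtain ⟨C₁, hpt, h1, h2, h3, h4, h5⟩ := exists_relabel C CCAC _ hD
    (fun n i j hij => Fin.ext hij)
    (fun xs => by
      refine List.ext_getElem (by simp) fun i _ _ => ?_
      simp [CCAC]) hleg d (fun n => P.eval n) (fun n => (hd n).le) fun n => (hP n).1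
  obtain ⟨w1, w2, W, hw1, hw2, hW⟩ := exists_words hG C₁.wired1 C₁.wired2
  have hsim := simulation C₁ CCAC (onGrid hk C₁ hpt w1 w2 W) (CCNTC k) (gatherLen W) (gatherLen W)
    (fun n => 4 * P.eval n + 2 * (n + 2 * P.eval n) + 1)
    (fun n => cube k (n + 2 * P.eval n + 2 * P.eval n + 2)) rfl
    (fun n i j hij => Fin.ext hij) h1 d (fun n => P.eval n) h2 h3 fun n xs rs hxs hrs => by
      obtain ⟨x, rfl⟩ := exists_ofFn_of_length hxs
      obtain ⟨r, rfl⟩ := exists_ofFn_of_length hrs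
      refine ⟨_, _, grid_rounds hk hW ⟨hw1, hw2⟩ (fun h' => rfl) fun h l hp hl => ?_⟩
      obtain ⟨hn, ha⟩ := h1 n x r h hp l hl
      refine ⟨hn, ha, fun q hq => ?_, ?_⟩
      · obtain ⟨o, ho, hq⟩ := List.mem_flatMap.1 hq
        exact h4 n x ⟨r, h, l, hp, hl, o, ho, hq⟩
      -- The operations of a single timestep are counted in the total size once the history is
      -- extended by a possible outcome.
      · obtain ⟨a, ha'⟩ := hp
        obtain ⟨o, ho⟩ := exists_outcome C₁ CCAC l hn ha _ ha'
        have h6 := h3 n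
        simp only [Circuit.size, iSup_le_iff] at h6
        have h7 : C₁.opCount (List.ofFn x) (List.ofFn r) (o :: h) ≤ P.eval n := by
          exact_mod_cast h6 x r (o :: h) ⟨a, by rw [amp_cons_some hl]; exact ho⟩
        rw [Circuit.opCount, hl, Option.getD_some] at h7
        omega
  obtain ⟨g1, g2, g3, g4, g5⟩ := hsim
  refine ⟨gatherLen W + 1 + gatherLen W, achieves_of_le (onGrid hk C₁ hpt w1 w2 W) g1 _ g2
    ((4 * P + 2 * (Polynomial.X + 2 * P) + 1) * (Polynomial.C (gatherLen W + 1 + gatherLen W) * P))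
    ((Polynomial.X + 2 * P + 2 * P + 2) ^ k) (fun n => ?_) (fun n => ?_) fun n x => ?_⟩
  · refine (g3 n).trans (le_of_eq ?_)
    simp
  · refine (width_CCNTC_le (g4 n)).trans (le_of_eq ?_)
    simp
  · rw [g5, h5]; exact hC n x

theorem isBigO_of_le_mul {f g : ℕ → ℕ} (K : ℕ) (h : ∀ n, f n ≤ K * g n) :
    Asymptotics.IsBigO Filter.atTop (fun n => (f n : ℝ)) fun n => (g n : ℝ) :=
  Asymptotics.IsBigO.of_bound K (Filter.Eventually.of_forall fun n => by
    rw [Real.norm_of_nonneg (Nat.cast_nonneg _), Real.norm_of_nonneg (Nat.cast_nonneg _)]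
    exact_mod_cast h n)

end
end QArch

/-! ### The corollary. -/

theorem mainTheorem4 (k : ℕ) (hk : 2 ≤ k) (G : QArch.GateSet) (hG : G.Universal)
    (E : (n : ℕ) → Matrix (Fin n → Bool) (Fin n → Bool) ℂ →ₗ[ℂ] Matrix (Fin n → Bool) (Fin n → Bool) ℂ)
    (hE : ∀ n, QArch.IsCPTP (E n)) (ε : ℕ → ℝ) (hε : ∀ n, 0 ≤ ε n)
    (d₁ : ℕ → ℕ) (hd₁ : QArch.IsMinDepth QArch.CCAC G E ε d₁) :
    (∃ d₂ : ℕ → ℕ, QArch.IsMinDepth (QArch.CCNTC k) G E ε d₂) ∧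
    ∀ d₂ : ℕ → ℕ, QArch.IsMinDepth (QArch.CCNTC k) G E ε d₂ →
      Asymptotics.IsTheta Filter.atTop (fun n => (d₁ n : ℝ)) (fun n => (d₂ n : ℝ)) := by
  obtain ⟨K, d, hdK, hd⟩ := QArch.achieves_CCNTC hG hk hd₁.1
  have hle := QArch.isBigO_of_le_mul K hdK
  -- No depth on the grid is of smaller order than `d₁`, since the same computation runs in CCAC
  -- without loss of time.
  have hge : ∀ d' : ℕ → ℕ, QArch.Achieves (QArch.CCNTC k) G E ε d' →
      Asymptotics.IsBigO Filter.atTop (fun n => (d₁ n : ℝ)) (fun n => (d' n : ℝ)) := by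
    intro d' hd'
    obtain ⟨d'', h1, h2⟩ := QArch.achieves_CCAC hk hd'
    exact (hd₁.2 d'' h2).trans (QArch.isBigO_of_le_mul 1 fun n => by simpa using h1 n)
  -- The simulated depth `d` is of order at most `d₁`, hence minimal; any minimum depth `d₂` is
  -- bounded by `d` by its own minimality and bounds `d₁` because it is achieved.
  exact ⟨⟨d, hd, fun d' hd' => hle.trans (hge d' hd')⟩, fun d₂ hd₂ =>
    ⟨hge d₂ hd₂.1, (hd₂.2 d hd).trans hle⟩⟩
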